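/- Let $\alpha\in(1,2)$, let $\beta:\mathbb R\to[-1,1]$ be a Borel function, and let $Z_\alpha$ be an independently scattered strictly $\alpha$-stable random measure on $\mathbb R$, defined on a probability space $(\Omega,\mathcal F,\mathbb P)$, with Lebesgue control measure and skewness intensity $\beta$. For $f\in L^\alpha(\mathbb R)$, $\int f\,dZ_\alpha$ denotes the stochastic integral, i.e. the limit in probability of the integrals of simple functions converging to $f$ in $L^\alpha(\mathbb R)$; it is defined up to almost sure equality. Write $(x)_+^\kappa=x^\kappa$ for $x>0$ and $(x)_+^\kappa=0$ for $x\le 0$. For a function $H:\mathbb R\to(1/\alpha,1)$, a linear multifractional stable motion (LMSM) with functional Hurst parameter $H$ is a process $\widetilde Y$ such that, for every $t\in\mathbb R$, $$\widetilde Y(t)=\int_{\mathbb R}\big\{(t-s)_+^{H(t)-1/\alpha}-(-s)_+^{H(t)-1/\alpha}\big\}\,Z_\alpha(ds)\quad\text{almost surely.}$$ **(A)** Let $\psi:\mathbb R\to\mathbb R$ be a three times continuously differentiable, compactly supported orthonormal mother wavelet with $Q\ge 15$ vanishing moments (for instance a sufficiently smooth Daubechies wavelet); that is, the functions $2^{j/2}\psi(2^j\cdot-k)$,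 $(j,k)\in\mathbb Z^2$, form an orthonormal basis of $L^2(\mathbb R)$, $\int t^m\psi(t)\,dt=0$ for $0\le m<Q$, and $\int t^Q\psi(t)\,dt\ne0$. Put $\Psi(x,v)=\int_{\mathbb R}(x-s)_+^{v-1/\alpha}\psi(s)\,ds$ and let $\epsilon_{j,k}$ be any version of $2^{j/\alpha}\int_{\mathbb R}\psi(2^js-k)\,Z_\alpha(ds)$ (these integrals exist). Then there is an event $\Omega_0^*$ of probability $1$ such that for every $\omega\in\Omega_0^*$ and every $\eta>0$ there is a finite $C(\omega)$, depending on $\omega$ and $\eta$, with $$|\epsilon_{j,k}(\omega)|\le C(\omega)(1+|j|)^{1/\alpha+\eta}(1+|k|)^{1/\alpha}\log^{1/\alpha+\eta}(2+|k|)\qquad\text{for all }(j,k)\in\mathbb Z^2.$$ Let $\Omega_0^*$ be any such event. For all $\omega\in\Omega_0^*$, $u\in\mathbb R$ and $v\in(1/\alpha,1)$, the series $$X(u,v,\omega)=\sum_{(j,k)\in\mathbb Z^2}2^{-jv}\epsilon_{j,k}(\omega)\big(\Psi(2^ju-k,v)-\Psi(-k,v)\big)$$ converges absolutely; put $X(u,v,\omega)=0$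 for $\omega\notin\Omega_0^*$. Let $H:\mathbb R\to(1/\alpha,1)$ be continuous and let $Y(t)=X(t,H(t))$. Then: 1. for each $\omega\in\Omega_0^*$ and all $M,\eta>0$ there is a finite constant $C$ such that, for all $t,s\in[-M,M]$, $$|Y(t,\omega)-Y(s,\omega)|\le C\Big(|t-s|^{\max(H(t),H(s))-1/\alpha}\big(1+\big|\log|t-s|\big|\big)^{2/\alpha+\eta}+|H(t)-H(s)|\Big)$$ (for $t=s$ the right-hand side is read as $0$); 2. for each $\omega\in\Omega_0^*$ the path $t\mapsto Y(t,\omega)$ is continuous; 3. $Y$ is an LMSM with functional Hurst parameter $H$, and it is a modification of every such LMSM $\widetilde Y$: $Y(t)=\widetilde Y(t)$ almost surely, for each $t\in\mathbb R$. **(B)** Consequently, for every continuous $H:\mathbb R\to(1/\alpha,1)$, LMSM with functional Hurst parameter $H$ exists, and every such LMSM has a modification with almost surely continuous paths (this settles the conjecture of Stoev and Taqqu). -/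

import Mathlib

open MeasureTheory ProbabilityTheory Filter Topology Set

noncomputable section

/-- The truncated power `(x)_+^κ`, equal to `x ^ κ` for `x > 0` and to `0` for `x ≤ 0`. -/
def truncPow (x κ : ℝ) : ℝ := if 0 < x then x ^ κ else 0

/-- The random variable `ξ` has the stable law `S_α(σ, b, 0)` (for `α ≠ 1`), with stability
parameter `α`, scale parameter `σ`, skewness parameter `b` and shift `0`. -/
def HasStrictlyStableLaw {Ω : Type*} [MeasurableSpace Ω] (μ : Measure Ω) (α σ b : ℝ)
    (ξ : Ω → ℝ) : Prop :=
  ∀ θ : ℝ, charFun (μ.map ξ) θ =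
    Complex.exp (-((σ ^ α * |θ| ^ α : ℝ) : ℂ) *
      (1 - Complex.I * ((b * Real.sign θ * Real.tan (Real.pi * α / 2) : ℝ) : ℂ)))

/-- `Z` is an independently scattered strictly `α`-stable random measure on `ℝ`, with Lebesgue
measure as control measure and with skewness intensity `β`. Only the values of `Z` on the Borel
sets of finite Lebesgue measure matter. -/
structure IsStableRandomMeasure {Ω : Type*} [MeasurableSpace Ω] (μ : Measure Ω) (α : ℝ)
    (β : ℝ → ℝ) (Z : Set ℝ → Ω → ℝ) : Prop where
  measurable : ∀ A : Set ℝ, MeasurableSet A → volume A < ⊤ → Measurable (Z A)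
  law : ∀ A : Set ℝ, MeasurableSet A → volume A < ⊤ →
    HasStrictlyStableLaw μ α ((volume.real A) ^ (1 / α))
      ((∫ s in A, β s) / volume.real A) (Z A)
  indep : ∀ (n : ℕ) (A : Fin n → Set ℝ), (∀ i, MeasurableSet (A i)) →
    (∀ i, volume (A i) < ⊤) → Pairwise (fun i j => Disjoint (A i) (A j)) →
    iIndepFun (fun i => Z (A i)) μ
  sigma_additive : ∀ A : ℕ → Set ℝ, (∀ i, MeasurableSet (A i)) →
    Pairwise (fun i j => Disjoint (A i) (A j)) → volume (⋃ i, A i) < ⊤ →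
    ∀ᵐ ω ∂μ, Tendsto (fun n => ∑ i ∈ Finset.range n, Z (A i) ω) atTop (𝓝 (Z (⋃ i, A i) ω))

/-- The integral of a simple function `∑ c 1_{g = c}` against `Z`. -/
def simpleStableIntegral {Ω : Type*} (Z : Set ℝ → Ω → ℝ) (g : SimpleFunc ℝ ℝ) (ω : Ω) : ℝ :=
  ∑ c ∈ g.range, c * Z (g ⁻¹' {c}) ω

/-- The random variable `ξ` is (a version of) the stochastic integral `∫ f(s) Z(ds)` of the
function `f ∈ L^α(ℝ)`: it is the limit in probability of the integrals of some simple functions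
in `L^α(ℝ)` which converge to `f` in `L^α(ℝ)`. -/
def IsStableIntegral {Ω : Type*} [MeasurableSpace Ω] (μ : Measure Ω) (α : ℝ)
    (Z : Set ℝ → Ω → ℝ) (f : ℝ → ℝ) (ξ : Ω → ℝ) : Prop :=
  MemLp f (ENNReal.ofReal α) volume ∧ Measurable ξ ∧
    ∃ g : ℕ → SimpleFunc ℝ ℝ,
      (∀ n, MemLp (g n) (ENNReal.ofReal α) volume) ∧
      Tendsto (fun n => eLpNorm (fun s => g n s - f s) (ENNReal.ofReal α) volume) atTop (𝓝 0) ∧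
      TendstoInMeasure μ (fun n => simpleStableIntegral Z (g n)) atTop ξ

/-- The process `Y` is a linear multifractional stable motion with functional Hurst parameter `H`:
for each `t`, `Y t` is a version of `∫ ((t - s)_+^{H(t)-1/α} - (-s)_+^{H(t)-1/α}) Z(ds)`. -/
def IsLMSM {Ω : Type*} [MeasurableSpace Ω] (μ : Measure Ω) (α : ℝ)
    (Z : Set ℝ → Ω → ℝ) (H : ℝ → ℝ) (Y : ℝ → Ω → ℝ) : Prop :=
  ∀ t : ℝ, IsStableIntegral μ α Z
    (fun s => truncPow (t - s) (H t - 1 / α) - truncPow (-s) (H t - 1 / α)) (Y t)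

/-- `ψ` is a three times continuously differentiable, compactly supported, real-valued orthonormal
mother wavelet, with `Q ≥ 15` vanishing moments. All Daubechies wavelets which are three times
continuously differentiable and have at least 15 vanishing moments belong to this class. -/
structure IsSmoothMotherWavelet (ψ : ℝ → ℝ) : Prop where
  contDiff : ContDiff ℝ 3 ψ
  hasCompactSupport : HasCompactSupport ψ
  orthonormal_basis : ∃ b : HilbertBasis (ℤ × ℤ) ℝ (Lp ℝ 2 (volume : Measure ℝ)),
    ∀ j k : ℤ, (b (j, k) : ℝ → ℝ) =ᵐ[volume]
      fun s => (2 : ℝ) ^ ((j : ℝ) / 2) * ψ ((2 : ℝ) ^ j * s - k)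
  vanishing_moments : ∃ Q : ℕ, 15 ≤ Q ∧ (∀ m : ℕ, m < Q → ∫ t : ℝ, t ^ m * ψ t = 0) ∧
    ∫ t : ℝ, t ^ Q * ψ t ≠ 0

/-- The function `Ψ(x, v) = ∫ (x - s)_+^{v-1/α} ψ(s) ds`. -/
def waveletPrimitive (α : ℝ) (ψ : ℝ → ℝ) (x v : ℝ) : ℝ :=
  ∫ s : ℝ, truncPow (x - s) (v - 1 / α) * ψ s

/-- `ε j k` is, for all integers `j` and `k`, a version of
`2^{j/α} ∫ ψ(2^j s - k) Z(ds)`. -/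
def IsWaveletCoeff {Ω : Type*} [MeasurableSpace Ω] (μ : Measure Ω) (α : ℝ)
    (Z : Set ℝ → Ω → ℝ) (ψ : ℝ → ℝ) (ε : ℤ → ℤ → Ω → ℝ) : Prop :=
  ∀ j k : ℤ, IsStableIntegral μ α Z
    (fun s => (2 : ℝ) ^ ((j : ℝ) / α) * ψ ((2 : ℝ) ^ j * s - k)) (ε j k)

/-- `Ω₀` is an event of probability `1` on which, for every `η > 0`, the random variables
`ε j k` are bounded, up to a finite factor which may depend on `ω` and `η`, by
`(1+|j|)^{1/α+η} (1+|k|)^{1/α} log^{1/α+η}(2+|k|)`. -/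
structure IsGoodEvent {Ω : Type*} [MeasurableSpace Ω] (μ : Measure Ω) (α : ℝ)
    (ε : ℤ → ℤ → Ω → ℝ) (Ω₀ : Set Ω) : Prop where
  measurableSet : MeasurableSet Ω₀
  measure_eq_one : μ Ω₀ = 1
  growth : ∀ ω ∈ Ω₀, ∀ η : ℝ, 0 < η → ∃ C : ℝ, ∀ j k : ℤ,
    |ε j k ω| ≤ C * (1 + |(j : ℝ)|) ^ (1 / α + η) * (1 + |(k : ℝ)|) ^ (1 / α) *
      Real.log (2 + |(k : ℝ)|) ^ (1 / α + η)

/-- The term of index `(j, k)` of the random wavelet series at `(u, v)`. -/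
def waveletTerm {Ω : Type*} (α : ℝ) (ψ : ℝ → ℝ) (ε : ℤ → ℤ → Ω → ℝ) (u v : ℝ) (ω : Ω)
    (p : ℤ × ℤ) : ℝ :=
  (2 : ℝ) ^ (-(p.1 : ℝ) * v) * ε p.1 p.2 ω *
    (waveletPrimitive α ψ ((2 : ℝ) ^ p.1 * u - p.2) v - waveletPrimitive α ψ (-(p.2 : ℝ)) v)

/-- The field `X(u, v)`: the sum of the random wavelet series on `Ω₀`, and `0` outside `Ω₀`. -/
def waveletField {Ω : Type*} (α : ℝ) (ψ : ℝ → ℝ) (ε : ℤ → ℤ → Ω → ℝ) (Ω₀ : Set Ω)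
    (u v : ℝ) : Ω → ℝ :=
  Ω₀.indicator fun ω => ∑' p : ℤ × ℤ, waveletTerm α ψ ε u v ω p

/-- The process `Y(t) = X(t, H(t))`. -/
def waveletLMSM {Ω : Type*} (α : ℝ) (ψ : ℝ → ℝ) (ε : ℤ → ℤ → Ω → ℝ) (Ω₀ : Set Ω)
    (H : ℝ → ℝ) (t : ℝ) : Ω → ℝ :=
  waveletField α ψ ε Ω₀ t (H t)

end

/-!
The stochastic integral is handled through one estimate. The characteristic function of `Z A`
satisfies `|1 - φ(θ)| ≤ C |A| |θ|^α`, and independence extends this to the integrals of simple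
functions, with `‖g‖_α^α` in place of `|A|`. Hence `P(|∫ f dZ| > r) ≤ C (‖f‖_α / r)^α`
(`IsStableIntegral.measureReal_gt_le`), which gives existence, uniqueness, linearity and closedness
of the integral, and, by the Borel-Cantelli lemma, the growth condition on the coefficients
(`IsWaveletCoeff.exists_isGoodEvent`), whatever the function whose dilates and translates are
integrated.

The regularity of the random series is deterministic and only uses two vanishing moments
(`IsMotherFunction`): if `θ = G''` with `G` compactly supported, two integrations by parts show that
the fractional primitive of `θ` of exponent `κ < 1`, its derivative in `x` and its increments in
`κ` decay like `|x|^(-L)` for each `L < 2 - κ`. As `κ = v - 1/α`, one may take `L > 1 + 1/α`, which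
is what is needed to sum over the translations against coefficients that grow like `|k|^{1/α}` up
to logarithms. The scale `j` then contributes
`2^{-jv} (1 + |j|)^{2/α + 2η} max(1, 2^j)^{1/α} min(1, 2^j |t - s|)` to an increment in space, and
the sum over `j` is of the order of its terms with `2^j ≈ 1 / |t - s|`
(`exists_sumLE_scaleTerm`). Increments in `v` are bounded in the same way. This gives absolute
convergence, the modulus of continuity and the continuity of the paths.

That the sum of the series is the stochastic integral of the kernel `(u - s)_+^κ - (-s)_+^κ` is a
statement about functions: the deterministic series obtained by undoing the integration against `Z`
converges absolutely in `L^α`, as the case of unit coefficients of the convergence just described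
shows, and its sum has to be identified (`isStableIntegral_waveletField`). For an orthonormal
wavelet the kernel lies in `L²` since `κ < 1/2`, and the `L²` expansion gives the sum.

The existence of a continuous version needs a wavelet series for the kernel, but not an orthonormal
one, so that no smooth orthonormal wavelet has to be constructed. Averages of the kernel
around the points `2^{-j} k` are interpolated by piecewise linear functions. The corrections from
one scale to the next are sums of translated and dilated hat functions, whose coefficients are
integrals of the kernel against dilates and translates of two mother functions `evenMother` and
`oddMother`, and these corrections telescope to the kernel
(`IsAveragingKernel.ae_add_eq_fracKernel`). The sum of the two corresponding random series is
therefore a linear multifractional stable motion with continuous paths.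
-/

noncomputable section

/-! ### Independently scattered stable random measures -/

namespace IsStableRandomMeasure

variable {Ω : Type*} [MeasurableSpace Ω] {μ : Measure Ω} {α : ℝ} {β : ℝ → ℝ} {Z : Set ℝ → Ω → ℝ}

theorem ae_empty (hZ : IsStableRandomMeasure μ α β Z) : ∀ᵐ ω ∂μ, Z ∅ ω = 0 := by
  have h := hZ.sigma_additive (fun _ => ∅) (fun _ => MeasurableSet.empty)
    (fun i j _ => disjoint_bot_left) (by simp)
  filter_upwards [h] with ω hω
  simp only [Finset.sum_const, Finset.card_range, iUnion_empty] at hω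
  -- the partial sums `n • Z ∅ ω` converge, so that their increments `Z ∅ ω` tend to `0`
  have h1 : Tendsto (fun n : ℕ => (n + 1) • Z ∅ ω - n • Z ∅ ω) atTop (𝓝 (Z ∅ ω - Z ∅ ω)) :=
    (hω.comp (tendsto_add_atTop_nat 1)).sub hω
  have h2 : (fun n : ℕ => (n + 1) • Z ∅ ω - n • Z ∅ ω) = fun _ => Z ∅ ω := by
    funext n; rw [succ_nsmul]; ring
  rw [h2, sub_self] at h1
  exact tendsto_nhds_unique tendsto_const_nhds h1

theorem ae_union (hZ : IsStableRandomMeasure μ α β Z) {A B : Set ℝ} (hA : MeasurableSet A)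
    (hB : MeasurableSet B) (hAB : Disjoint A B) (hfA : volume A < ⊤) (hfB : volume B < ⊤) :
    ∀ᵐ ω ∂μ, Z (A ∪ B) ω = Z A ω + Z B ω := by
  let S : ℕ → Set ℝ := fun n => if n = 0 then A else if n = 1 then B else ∅
  have hU : ⋃ i, S i = A ∪ B := by
    ext x
    simp only [mem_iUnion, mem_union, S]
    constructor
    · rintro ⟨i, hi⟩
      split_ifs at hi
      · exact Or.inl hi
      · exact Or.inr hi
      · exact absurd hi (notMem_empty x)
    · rintro (h | h)
      · exact ⟨0, by simpa using h⟩
      · exact ⟨1, by simpa using h⟩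
  have hS : ∀ i, MeasurableSet (S i) := by
    intro i; simp only [S]; split_ifs <;> simp [hA, hB]
  have hd : Pairwise (fun i j => Disjoint (S i) (S j)) := by
    intro i j hij
    simp only [S]
    split_ifs <;> first | omega | exact hAB | exact hAB.symm | simp
  have hm : volume (⋃ i, S i) < ⊤ := by
    rw [hU]; exact measure_union_lt_top hfA hfB
  filter_upwards [hZ.sigma_additive S hS hd hm, hZ.ae_empty] with ω hω h0
  rw [hU] at hω
  have hev : (fun n => ∑ i ∈ Finset.range n, Z (S i) ω) =ᶠ[atTop] fun _ => Z A ω + Z B ω := by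
    filter_upwards [eventually_ge_atTop 2] with n hn
    obtain ⟨m, rfl⟩ := Nat.exists_eq_add_of_le hn
    rw [add_comm, Finset.sum_range_succ', Finset.sum_range_succ']
    have : ∀ i ∈ Finset.range m, Z (S (i + 1 + 1)) ω = 0 := by
      intro i _
      simp [S, h0]
    rw [Finset.sum_eq_zero this]
    simp [S]; ring
  exact tendsto_nhds_unique hω (tendsto_const_nhds.congr' hev.symm)

theorem ae_biUnion (hZ : IsStableRandomMeasure μ α β Z) {ι : Type*} (s : Finset ι)
    (A : ι → Set ℝ) (hA : ∀ i ∈ s, MeasurableSet (A i)) (hf : ∀ i ∈ s, volume (A i) < ⊤)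
    (hd : (s : Set ι).PairwiseDisjoint A) :
    ∀ᵐ ω ∂μ, Z (⋃ i ∈ s, A i) ω = ∑ i ∈ s, Z (A i) ω := by
  classical
  induction s using Finset.induction_on with
  | empty => simpa using hZ.ae_empty
  | insert a s has ih =>
    have h1 := ih (fun i hi => hA i (Finset.mem_insert_of_mem hi))
      (fun i hi => hf i (Finset.mem_insert_of_mem hi))
      (hd.subset (by simp))
    have h2 := hZ.ae_union (hA a (Finset.mem_insert_self a s))
      (Finset.measurableSet_biUnion s fun i hi => hA i (Finset.mem_insert_of_mem hi))
      (by
        rw [Set.disjoint_iUnion₂_right]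
        intro i hi
        exact hd (by simp) (by simp [hi]) (fun h => has (h ▸ hi)))
      (hf a (Finset.mem_insert_self a s))
      ((measure_biUnion_lt_top s.finite_toSet
        fun i hi => hf i (Finset.mem_insert_of_mem hi)))
    filter_upwards [h1, h2] with ω h1 h2
    rw [Finset.set_biUnion_insert, h2, h1, Finset.sum_insert has]

/-- The characteristic function of `Z A` differs from `1` by at most a constant times
`|A| |θ|^α`. When `A` is a null set, the skewness `0 / 0 = 0` in the law of `Z A` is harmless,
since the scale is `0`. -/
theorem norm_one_sub_charFun_le (hZ : IsStableRandomMeasure μ α β Z) (hα : 0 < α)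
    (hβ : ∀ s, β s ∈ Icc (-1 : ℝ) 1) [IsProbabilityMeasure μ] {A : Set ℝ} (hA : MeasurableSet A)
    (hfA : volume A < ⊤) (θ : ℝ) :
    ‖1 - charFun (μ.map (Z A)) θ‖ ≤
      2 * (1 + |Real.tan (Real.pi * α / 2)|) * (volume.real A * |θ| ^ α) := by
  have : IsProbabilityMeasure (μ.map (Z A)) :=
    Measure.isProbabilityMeasure_map (hZ.measurable A hA hfA).aemeasurable
  have hle2 : ‖1 - charFun (μ.map (Z A)) θ‖ ≤ 2 := norm_one_sub_charFun_le_two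
  set V := volume.real A with hV
  have hV0 : 0 ≤ V := measureReal_nonneg
  set b := (∫ s in A, β s) / V with hb
  have hb1 : |b| ≤ 1 := by
    rw [hb, abs_div, abs_of_nonneg hV0]
    refine div_le_one_of_le₀ ?_ hV0
    have := norm_setIntegral_le_of_norm_le_const (f := β) (C := 1) hfA
      (fun x _ => by rw [Real.norm_eq_abs, abs_le]; exact hβ x)
    simpa [Real.norm_eq_abs] using this
  set t := Real.tan (Real.pi * α / 2) with ht
  set z : ℂ := ((((V ^ (1 / α)) ^ α * |θ| ^ α : ℝ) : ℂ) *
      (1 - Complex.I * ((b * Real.sign θ * t : ℝ) : ℂ))) with hz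
  have hlaw : charFun (μ.map (Z A)) θ = Complex.exp (-z) := by
    rw [hZ.law A hA hfA θ, hz, neg_mul]
  have hpow : (V ^ (1 / α)) ^ α = V := by
    rw [← Real.rpow_mul hV0, one_div_mul_cancel hα.ne', Real.rpow_one]
  have hsign : |Real.sign θ| ≤ 1 := by
    rcases Real.sign_apply_eq θ with h | h | h <;> simp [h]
  have hznorm : ‖z‖ ≤ (1 + |t|) * (V * |θ| ^ α) := by
    rw [hz, hpow, norm_mul, Complex.norm_real, Real.norm_eq_abs,
      abs_of_nonneg (by positivity), mul_comm]
    refine mul_le_mul_of_nonneg_right ?_ (by positivity)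
    refine (norm_sub_le _ _).trans ?_
    rw [norm_one, norm_mul, Complex.norm_I, one_mul, Complex.norm_real, Real.norm_eq_abs, abs_mul,
      abs_mul]
    have : |b| * |Real.sign θ| ≤ 1 := mul_le_one₀ hb1 (abs_nonneg _) hsign
    nlinarith [abs_nonneg t]
  by_cases h1 : ‖z‖ ≤ 1
  · have h2 := Complex.norm_exp_sub_one_le (x := -z) (by simpa using h1)
    rw [hlaw, norm_sub_rev]
    rw [norm_neg] at h2
    linarith
  · push Not at h1
    linarith

end IsStableRandomMeasure

/-! ### Integrals of simple functions -/

section simple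

variable {Ω : Type*} [MeasurableSpace Ω] {μ : Measure Ω} {α : ℝ} {β : ℝ → ℝ} {Z : Set ℝ → Ω → ℝ}

theorem simpleFunc_volume_preimage_lt_top (hα : 0 < α) {g : SimpleFunc ℝ ℝ}
    (hg : MemLp g (ENNReal.ofReal α) volume) {c : ℝ} (hc : c ≠ 0) : volume (g ⁻¹' {c}) < ⊤ :=
  SimpleFunc.measure_preimage_lt_top_of_memLp (by simpa using hα) ENNReal.ofReal_ne_top g hg c hc

theorem measurable_simpleStableIntegral (hZ : IsStableRandomMeasure μ α β Z) (hα : 0 < α)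
    {g : SimpleFunc ℝ ℝ} (hg : MemLp g (ENNReal.ofReal α) volume) :
    Measurable (simpleStableIntegral Z g) := by
  refine Finset.measurable_fun_sum _ fun c _ => ?_
  by_cases hc : c = 0
  · simp [hc]
  · exact (hZ.measurable _ (g.measurableSet_fiber c)
      (simpleFunc_volume_preimage_lt_top hα hg hc)).const_mul c

/-- The integral of a simple function may be computed on any finite measurable partition on whose
parts the function is constant. Only the parts where the function does not vanish need to have
finite measure: nothing is known of the values of `Z` on the other ones, but these values are
multiplied by `0`. -/
theorem simpleStableIntegral_map (hZ : IsStableRandomMeasure μ α β Z) {E : Type*}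
    (p : SimpleFunc ℝ E) (φ : E → ℝ)
    (hp : ∀ b ∈ p.range, φ b ≠ 0 → volume (p ⁻¹' {b}) < ⊤) :
    ∀ᵐ ω ∂μ, simpleStableIntegral Z (p.map φ) ω = ∑ b ∈ p.range, φ b * Z (p ⁻¹' {b}) ω := by
  classical
  have key : ∀ c ∈ (p.map φ).range, ∀ᵐ ω ∂μ, c * Z ((p.map φ) ⁻¹' {c}) ω =
      ∑ b ∈ p.range with φ b = c, φ b * Z (p ⁻¹' {b}) ω := by
    intro c _
    by_cases hc : c = 0
    · refine Eventually.of_forall fun ω => ?_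
      rw [hc, zero_mul, Finset.sum_eq_zero]
      intro b hb
      rw [(Finset.mem_filter.1 hb).2, zero_mul]
    have hset : (p.map φ) ⁻¹' {c} = ⋃ b ∈ p.range.filter (fun b => φ b = c), p ⁻¹' {b} := by
      ext x
      simp
    have h := hZ.ae_biUnion (p.range.filter (fun b => φ b = c)) (fun b => p ⁻¹' {b})
      (fun b _ => p.measurableSet_fiber b)
      (fun b hb => hp b (Finset.mem_filter.1 hb).1 (by rw [(Finset.mem_filter.1 hb).2]; exact hc))
      (by
        intro b _ b' _ hbb'
        exact Disjoint.preimage _ (by simpa using hbb'))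
    filter_upwards [h] with ω hω
    rw [hset, hω, Finset.mul_sum]
    refine Finset.sum_congr rfl fun b hb => ?_
    rw [(Finset.mem_filter.1 hb).2]
  have key' := (Finset.eventually_all (p.map φ).range).2 key
  filter_upwards [key'] with ω hω
  rw [simpleStableIntegral, Finset.sum_congr rfl hω]
  exact Finset.sum_fiberwise_of_maps_to
    (fun b hb => by rw [SimpleFunc.range_map]; exact Finset.mem_image_of_mem φ hb) _

/-- The integral of simple functions is linear, almost surely: both functions are constant on the
parts of the partition generated by the pair. -/
theorem simpleStableIntegral_linear (hZ : IsStableRandomMeasure μ α β Z) (hα : 0 < α)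
    {g h : SimpleFunc ℝ ℝ} (hg : MemLp g (ENNReal.ofReal α) volume)
    (hh : MemLp h (ENNReal.ofReal α) volume) (a b : ℝ) :
    ∀ᵐ ω ∂μ, simpleStableIntegral Z ((g.pair h).map fun q => a * q.1 + b * q.2) ω =
      a * simpleStableIntegral Z g ω + b * simpleStableIntegral Z h ω := by
  have hsub1 : ∀ q : ℝ × ℝ, q.1 ≠ 0 → volume ((g.pair h) ⁻¹' {q}) < ⊤ := fun q hq =>
    (measure_mono (fun x hx => by
      simp only [mem_preimage, SimpleFunc.pair_apply, mem_singleton_iff] at hx ⊢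
      rw [← hx])).trans_lt (simpleFunc_volume_preimage_lt_top hα hg hq)
  have hsub2 : ∀ q : ℝ × ℝ, q.2 ≠ 0 → volume ((g.pair h) ⁻¹' {q}) < ⊤ := fun q hq =>
    (measure_mono (fun x hx => by
      simp only [mem_preimage, SimpleFunc.pair_apply, mem_singleton_iff] at hx ⊢
      rw [← hx])).trans_lt (simpleFunc_volume_preimage_lt_top hα hh hq)
  have h1 := simpleStableIntegral_map hZ (g.pair h) Prod.fst (fun q _ hq => hsub1 q hq)
  have h2 := simpleStableIntegral_map hZ (g.pair h) Prod.snd (fun q _ hq => hsub2 q hq)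
  have h3 := simpleStableIntegral_map hZ (g.pair h) (fun q => a * q.1 + b * q.2)
    (fun q _ hq => by
      by_cases hq1 : q.1 = 0
      · refine hsub2 q fun hq2 => hq ?_
        simp [hq1, hq2]
      · exact hsub1 q hq1)
  have e1 : (g.pair h).map Prod.fst = g := by ext x; simp
  have e2 : (g.pair h).map Prod.snd = h := by ext x; simp
  rw [e1] at h1
  rw [e2] at h2
  filter_upwards [h1, h2, h3] with ω h1 h2 h3
  rw [h1, h2, h3, Finset.mul_sum, Finset.mul_sum, ← Finset.sum_add_distrib]
  exact Finset.sum_congr rfl fun q _ => by ring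

theorem norm_one_sub_prod_le {ι : Type*} (s : Finset ι) (f : ι → ℂ) (hf : ∀ i ∈ s, ‖f i‖ ≤ 1) :
    ‖1 - ∏ i ∈ s, f i‖ ≤ ∑ i ∈ s, ‖1 - f i‖ := by
  classical
  induction s using Finset.induction_on with
  | empty => simp
  | insert a s has ih =>
    rw [Finset.prod_insert has, Finset.sum_insert has]
    have h1 := ih fun i hi => hf i (Finset.mem_insert_of_mem hi)
    have h2 : 1 - f a * ∏ i ∈ s, f i = (1 - f a) + f a * (1 - ∏ i ∈ s, f i) := by ring
    rw [h2]
    refine (norm_add_le _ _).trans (add_le_add le_rfl ?_)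
    rw [norm_mul]
    calc _ ≤ 1 * ‖1 - ∏ i ∈ s, f i‖ :=
          mul_le_mul_of_nonneg_right (hf a (Finset.mem_insert_self a s)) (norm_nonneg _)
      _ ≤ _ := by rw [one_mul]; exact h1

/-- The `L^α` norm of a function, as a real number. It is the scale parameter of the stochastic
integral of the function. -/
def stableScale (α : ℝ) (f : ℝ → ℝ) : ℝ := (eLpNorm f (ENNReal.ofReal α) volume).toReal

theorem stableScale_nonneg (α : ℝ) (f : ℝ → ℝ) : 0 ≤ stableScale α f := ENNReal.toReal_nonneg

theorem stableScale_simpleFunc_rpow (hα : 0 < α) {g : SimpleFunc ℝ ℝ}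
    (hg : MemLp g (ENNReal.ofReal α) volume) :
    stableScale α g ^ α = ∑ c ∈ g.range with c ≠ 0, |c| ^ α * volume.real (g ⁻¹' {c}) := by
  have h0 : ENNReal.ofReal α ≠ 0 := by simpa using hα
  have h1 : eLpNorm g (ENNReal.ofReal α) volume ^ α =
      ∑ c ∈ g.range, ‖c‖ₑ ^ α * volume (g ⁻¹' {c}) := by
    rw [eLpNorm_eq_lintegral_rpow_enorm_toReal h0 ENNReal.ofReal_ne_top,
      ENNReal.toReal_ofReal hα.le, ← ENNReal.rpow_mul, one_div_mul_cancel hα.ne',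
      ENNReal.rpow_one, ← SimpleFunc.map_lintegral, ← SimpleFunc.lintegral_eq_lintegral]
    rfl
  have h2 : ∑ c ∈ g.range, ‖c‖ₑ ^ α * volume (g ⁻¹' {c}) =
      ∑ c ∈ g.range with c ≠ 0, ‖c‖ₑ ^ α * volume (g ⁻¹' {c}) := by
    refine (Finset.sum_filter_of_ne ?_).symm
    rintro c _ hc rfl
    simp [hα] at hc
  rw [stableScale, ENNReal.toReal_rpow, h1, h2, ENNReal.toReal_sum]
  · refine Finset.sum_congr rfl fun c _ => ?_
    rw [ENNReal.toReal_mul, ← ENNReal.toReal_rpow, toReal_enorm, Real.norm_eq_abs]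
    rfl
  · intro c hc
    exact ENNReal.mul_ne_top (by simp [ENNReal.rpow_ne_top_of_nonneg hα.le])
      (simpleFunc_volume_preimage_lt_top hα hg (Finset.mem_filter.1 hc).2).ne

/-- The integral of a simple function is a sum of independent variables, so its characteristic
function is a product, to which the estimate of each factor passes. -/
theorem norm_one_sub_charFun_simpleStableIntegral_le (hZ : IsStableRandomMeasure μ α β Z)
    (hα : 0 < α) (hβ : ∀ s, β s ∈ Icc (-1 : ℝ) 1) [IsProbabilityMeasure μ] {g : SimpleFunc ℝ ℝ}
    (hg : MemLp g (ENNReal.ofReal α) volume) (θ : ℝ) :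
    ‖1 - charFun (μ.map (simpleStableIntegral Z g)) θ‖ ≤
      2 * (1 + |Real.tan (Real.pi * α / 2)|) * (stableScale α g ^ α * |θ| ^ α) := by
  classical
  set s := g.range.filter (· ≠ 0) with hs
  have hsne : ∀ c : s, (c : ℝ) ≠ 0 := fun c => (Finset.mem_filter.1 c.2).2
  set e := s.equivFin
  have hfin : ∀ c : s, volume (g ⁻¹' {(c : ℝ)}) < ⊤ :=
    fun c => simpleFunc_volume_preimage_lt_top hα hg (hsne c)
  have hmeas : ∀ i, Measurable (Z (g ⁻¹' {((e.symm i : s) : ℝ)})) := fun i =>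
    hZ.measurable _ (g.measurableSet_fiber _) (hfin _)
  have hind := hZ.indep s.card (fun i => g ⁻¹' {((e.symm i : s) : ℝ)})
    (fun i => g.measurableSet_fiber _) (fun i => hfin _)
    (by
      intro i j hij
      refine Disjoint.preimage _ ?_
      simp only [disjoint_singleton, ne_eq]
      exact fun h => hij (e.symm.injective (Subtype.ext h)))
  have hind2 : iIndepFun (fun i => fun ω => ((e.symm i : s) : ℝ) *
      Z (g ⁻¹' {((e.symm i : s) : ℝ)}) ω) μ :=
    hind.comp (fun i => fun x => ((e.symm i : s) : ℝ) * x) (fun i => measurable_const_mul _)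
  have hsum : simpleStableIntegral Z g = fun ω => ∑ i, ((e.symm i : s) : ℝ) *
      Z (g ⁻¹' {((e.symm i : s) : ℝ)}) ω := by
    funext ω
    rw [simpleStableIntegral, e.symm.sum_comp (fun c : s => (c : ℝ) * Z (g ⁻¹' {(c : ℝ)}) ω),
      Finset.sum_coe_sort s (fun c => c * Z (g ⁻¹' {c}) ω), hs, Finset.sum_filter_of_ne]
    rintro c _ hc rfl
    simp at hc
  rw [hsum, hind2.charFun_map_fun_sum_eq_prod (fun i => ((hmeas i).const_mul _).aemeasurable),
    Finset.prod_apply]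
  have hprob : ∀ i, IsProbabilityMeasure (μ.map (fun ω => ((e.symm i : s) : ℝ) *
      Z (g ⁻¹' {((e.symm i : s) : ℝ)}) ω)) := fun i =>
    Measure.isProbabilityMeasure_map ((hmeas i).const_mul _).aemeasurable
  refine (norm_one_sub_prod_le _ _ fun i _ => norm_charFun_le_one _).trans ?_
  rw [stableScale_simpleFunc_rpow hα hg, ← hs, ← Finset.sum_coe_sort s, Finset.sum_mul,
    Finset.mul_sum, ← e.symm.sum_comp]
  refine Finset.sum_le_sum fun i _ => ?_
  rw [charFun_map_mul_comp (hmeas i).aemeasurable]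
  refine (hZ.norm_one_sub_charFun_le hα hβ (g.measurableSet_fiber _) (hfin _) _).trans_eq ?_
  rw [abs_mul, Real.mul_rpow (abs_nonneg _) (abs_nonneg _)]
  ring

/-- The constant in the tail estimate `P(|∫ f dZ| > r) ≤ C (‖f‖_α / r)^α` for the integrals of
simple functions. -/
def stableTailConst (α : ℝ) : ℝ := 4 * 2 ^ α * (1 + |Real.tan (Real.pi * α / 2)|)

theorem stableTailConst_pos (α : ℝ) : 0 < stableTailConst α := by
  unfold stableTailConst; positivity

/-- The tail of the integral of a simple function, deduced from the behaviour of the characteristic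
function near the origin. -/
theorem measureReal_simpleStableIntegral_gt_le (hZ : IsStableRandomMeasure μ α β Z)
    (hα : 0 < α) (hβ : ∀ s, β s ∈ Icc (-1 : ℝ) 1) [IsProbabilityMeasure μ] {g : SimpleFunc ℝ ℝ}
    (hg : MemLp g (ENNReal.ofReal α) volume) {r : ℝ} (hr : 0 < r) :
    μ.real {ω | r < |simpleStableIntegral Z g ω|} ≤
      stableTailConst α * (stableScale α g / r) ^ α := by
  have hm := measurable_simpleStableIntegral hZ hα hg
  have hprob : IsProbabilityMeasure (μ.map (simpleStableIntegral Z g)) :=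
    Measure.isProbabilityMeasure_map hm.aemeasurable
  have h1 := measureReal_abs_gt_le_integral_charFun (μ := μ.map (simpleStableIntegral Z g)) hr
  rw [map_measureReal_apply hm
    (measurableSet_lt measurable_const (by fun_prop : Measurable fun x : ℝ => |x|))] at h1
  refine h1.trans ?_
  set K := 2 * (1 + |Real.tan (Real.pi * α / 2)|) with hK
  have hS := stableScale_nonneg α g
  have h2 : ‖∫ t in (-2 * r⁻¹)..(2 * r⁻¹),
      1 - charFun (μ.map (simpleStableIntegral Z g)) t‖ ≤
      (K * (stableScale α g ^ α * (2 * r⁻¹) ^ α)) * |2 * r⁻¹ - (-2 * r⁻¹)| := by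
    refine intervalIntegral.norm_integral_le_of_norm_le_const fun t ht => ?_
    refine (norm_one_sub_charFun_simpleStableIntegral_le hZ hα hβ hg t).trans ?_
    have hle : -2 * r⁻¹ ≤ 2 * r⁻¹ := by
      have : 0 < r⁻¹ := inv_pos.2 hr
      linarith
    rw [uIoc_of_le hle] at ht
    have : |t| ≤ 2 * r⁻¹ := abs_le.2 ⟨by linarith [ht.1], ht.2⟩
    gcongr
  have h3 : |2 * r⁻¹ - (-2 * r⁻¹)| = 4 * r⁻¹ := by
    rw [abs_of_nonneg] <;> [ring; (ring_nf; positivity)]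
  rw [h3] at h2
  refine (mul_le_mul_of_nonneg_left h2 (by positivity)).trans_eq ?_
  rw [stableTailConst, Real.div_rpow hS hr.le, Real.mul_rpow (by norm_num) (by positivity),
    Real.inv_rpow hr.le, hK]
  field_simp

end simple

/-! ### Calculus of the stochastic integral -/

section calculus

theorem tendstoInMeasure_linear {Ω : Type*} [MeasurableSpace Ω] {μ : Measure Ω}
    {X Y : ℕ → Ω → ℝ} {x y : Ω → ℝ} (hX : TendstoInMeasure μ X atTop x)
    (hY : TendstoInMeasure μ Y atTop y) (a b : ℝ) :
    TendstoInMeasure μ (fun n ω => a * X n ω + b * Y n ω) atTop (fun ω => a * x ω + b * y ω) := by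
  rw [tendstoInMeasure_iff_norm] at *
  intro ε hε
  have h1 := hX (ε / (2 * (|a| + 1))) (by positivity)
  have h2 := hY (ε / (2 * (|b| + 1))) (by positivity)
  have h3 := h1.add h2
  rw [add_zero] at h3
  refine tendsto_of_tendsto_of_tendsto_of_le_of_le tendsto_const_nhds h3 (fun _ => zero_le)
    fun n => ?_
  refine (measure_mono ?_).trans (measure_union_le _ _)
  intro ω hω
  by_contra hcon
  simp only [mem_union, mem_ofPred_eq, not_or, not_le, Real.norm_eq_abs] at hcon hω
  obtain ⟨h1, h2⟩ := hcon
  rw [lt_div_iff₀ (by positivity)] at h1 h2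
  have h3 : |a * X n ω + b * Y n ω - (a * x ω + b * y ω)| ≤
      |a| * |X n ω - x ω| + |b| * |Y n ω - y ω| := by
    rw [← abs_mul, ← abs_mul]
    refine le_trans (le_of_eq ?_) (abs_add_le _ _)
    congr 1; ring
  nlinarith [abs_nonneg (X n ω - x ω), abs_nonneg (Y n ω - y ω)]

variable {Ω : Type*} [MeasurableSpace Ω] {μ : Measure Ω} {α : ℝ} {β : ℝ → ℝ} {Z : Set ℝ → Ω → ℝ}

theorem stableScale_add_le (hα : 1 ≤ α) {f g : ℝ → ℝ} (hf : MemLp f (ENNReal.ofReal α) volume)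
    (hg : MemLp g (ENNReal.ofReal α) volume) :
    stableScale α (f + g) ≤ stableScale α f + stableScale α g := by
  unfold stableScale
  rw [← ENNReal.toReal_add hf.eLpNorm_ne_top hg.eLpNorm_ne_top]
  exact ENNReal.toReal_mono (ENNReal.add_ne_top.2 ⟨hf.eLpNorm_ne_top, hg.eLpNorm_ne_top⟩)
    (eLpNorm_add_le hf.1 hg.1 (by simpa using ENNReal.ofReal_le_ofReal hα))

theorem tendsto_stableScale {ι : Type*} {u : Filter ι} {F : ι → ℝ → ℝ}
    (h : Tendsto (fun n => eLpNorm (F n) (ENNReal.ofReal α) volume) u (𝓝 0)) :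
    Tendsto (fun n => stableScale α (F n)) u (𝓝 0) := by
  simpa [Function.comp_def, stableScale] using
    (ENNReal.tendsto_toReal (a := 0) (by simp)).comp h

theorem IsStableIntegral.zero : IsStableIntegral μ α Z (fun _ => 0) (fun _ => 0) := by
  refine ⟨MemLp.zero', measurable_const, fun _ => 0, fun _ => ?_, ?_, ?_⟩
  · simp
  · simp
  · have : ∀ n : ℕ, simpleStableIntegral Z (0 : SimpleFunc ℝ ℝ) =ᵐ[μ] (fun _ => (0 : ℝ)) := by
      intro n
      refine Eventually.of_forall fun ω => Finset.sum_eq_zero fun c hc => ?_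
      obtain ⟨x, hx⟩ := SimpleFunc.mem_range.1 hc
      simp at hx
      simp [← hx]
    refine TendstoInMeasure.congr_left (fun n => (this n).symm) ?_
    rw [tendstoInMeasure_iff_norm]
    intro ε hε
    simp [not_le.2 hε]

theorem IsStableIntegral.congr {f f' : ℝ → ℝ} {ξ ξ' : Ω → ℝ} (h : IsStableIntegral μ α Z f ξ)
    (hf : f =ᵐ[volume] f') (hξ : ξ =ᵐ[μ] ξ') (hξ' : Measurable ξ') :
    IsStableIntegral μ α Z f' ξ' := by
  obtain ⟨h1, h2, g, h3, h4, h5⟩ := h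
  refine ⟨h1.ae_eq hf, hξ', g, h3, ?_, h5.congr_right hξ⟩
  refine h4.congr fun n => eLpNorm_congr_ae ?_
  filter_upwards [hf] with x hx
  rw [hx]

theorem IsStableIntegral.linear (hZ : IsStableRandomMeasure μ α β Z) (hα : 1 ≤ α) {f f' : ℝ → ℝ}
    {ξ ξ' : Ω → ℝ} (h : IsStableIntegral μ α Z f ξ) (h' : IsStableIntegral μ α Z f' ξ')
    (a b : ℝ) :
    IsStableIntegral μ α Z (fun s => a * f s + b * f' s) (fun ω => a * ξ ω + b * ξ' ω) := by
  obtain ⟨h1, h2, g, h3, h4, h5⟩ := h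
  obtain ⟨k1, k2, l, k3, k4, k5⟩ := h'
  have hα0 : 0 < α := by linarith
  have hone : 1 ≤ ENNReal.ofReal α := by simpa using ENNReal.ofReal_le_ofReal hα
  have hcoe : ∀ n, (⇑((g n |>.pair (l n)).map fun q => a * q.1 + b * q.2) : ℝ → ℝ) =
      fun s => a * g n s + b * l n s := fun n => by ext s; simp
  refine ⟨(h1.const_mul a).add (k1.const_mul b), (h2.const_mul a).add (k2.const_mul b),
    fun n => (g n |>.pair (l n)).map fun q => a * q.1 + b * q.2, fun n => ?_, ?_, ?_⟩
  · rw [hcoe]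
    exact ((h3 n).const_mul a).add ((k3 n).const_mul b)
  · have hlim : Tendsto (fun n =>
        ‖a‖ₑ * eLpNorm (fun s => g n s - f s) (ENNReal.ofReal α) volume +
        ‖b‖ₑ * eLpNorm (fun s => l n s - f' s) (ENNReal.ofReal α) volume) atTop (𝓝 0) := by
      have := (ENNReal.Tendsto.const_mul h4 (Or.inr (by simp : ‖a‖ₑ ≠ ⊤))).add
        (ENNReal.Tendsto.const_mul k4 (Or.inr (by simp : ‖b‖ₑ ≠ ⊤)))
      simpa using this
    refine tendsto_of_tendsto_of_tendsto_of_le_of_le tendsto_const_nhds hlim (fun _ => zero_le)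
      fun n => ?_
    have e : (fun s => ((g n |>.pair (l n)).map fun q => a * q.1 + b * q.2) s -
        (a * f s + b * f' s)) =
        a • (fun s => g n s - f s) + b • (fun s => l n s - f' s) := by
      rw [hcoe]
      ext s
      simp only [Pi.add_apply, Pi.smul_apply, smul_eq_mul]
      ring
    dsimp only
    rw [e]
    refine (eLpNorm_add_le (((h3 n).sub h1).1.const_smul a) (((k3 n).sub k1).1.const_smul b)
      hone).trans_eq ?_
    rw [eLpNorm_const_smul, eLpNorm_const_smul]
    rfl
  · refine TendstoInMeasure.congr_left (fun n => ?_) (tendstoInMeasure_linear h5 k5 a b)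
    filter_upwards [simpleStableIntegral_linear hZ hα0 (h3 n) (k3 n) a b] with ω hω
    exact hω.symm

theorem IsStableIntegral.sum (hZ : IsStableRandomMeasure μ α β Z) (hα : 1 ≤ α) {ι : Type*}
    (s : Finset ι) {e : ι → ℝ → ℝ} {ξ : ι → Ω → ℝ}
    (h : ∀ i ∈ s, IsStableIntegral μ α Z (e i) (ξ i)) (c : ι → ℝ) :
    IsStableIntegral μ α Z (fun x => ∑ i ∈ s, c i * e i x) (fun ω => ∑ i ∈ s, c i * ξ i ω) := by
  classical
  induction s using Finset.induction_on with
  | empty => simpa using IsStableIntegral.zero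
  | insert a s has ih =>
    have h1 := (h a (Finset.mem_insert_self a s)).linear hZ hα
      (ih fun i hi => h i (Finset.mem_insert_of_mem hi)) (c a) 1
    simpa [Finset.sum_insert has] using h1

/-- The tail estimate for stochastic integrals. It is stated with `r / 2` because it is deduced from
the one for simple functions by splitting off the error of approximation. -/
theorem IsStableIntegral.measureReal_gt_le [IsProbabilityMeasure μ]
    (hZ : IsStableRandomMeasure μ α β Z) (hα : 1 ≤ α)
    (hβ : ∀ s, β s ∈ Icc (-1 : ℝ) 1) {f : ℝ → ℝ} {ξ : Ω → ℝ} (h : IsStableIntegral μ α Z f ξ)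
    {r : ℝ} (hr : 0 < r) :
    μ.real {ω | r < |ξ ω|} ≤ stableTailConst α * (stableScale α f / (r / 2)) ^ α := by
  obtain ⟨h1, h2, g, h3, h4, h5⟩ := h
  have hα0 : 0 < α := by linarith
  rw [tendstoInMeasure_iff_measureReal_norm] at h5
  have h6 := h5 (r / 2) (by positivity)
  have h7 := tendsto_stableScale h4
  have h8 : Tendsto (fun n => stableTailConst α *
      ((stableScale α f + stableScale α (fun s => g n s - f s)) / (r / 2)) ^ α +
      μ.real {x | r / 2 ≤ ‖simpleStableIntegral Z (g n) x - ξ x‖}) atTop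
      (𝓝 (stableTailConst α * ((stableScale α f + 0) / (r / 2)) ^ α + 0)) := by
    refine Tendsto.add (Tendsto.const_mul _ ?_) h6
    exact ((h7.const_add _).div_const _).rpow_const (Or.inr hα0.le)
  rw [add_zero, add_zero] at h8
  refine ge_of_tendsto' h8 fun n => ?_
  have hsub : {ω | r < |ξ ω|} ⊆ {ω | r / 2 < |simpleStableIntegral Z (g n) ω|} ∪
      {x | r / 2 ≤ ‖simpleStableIntegral Z (g n) x - ξ x‖} := by
    intro ω hω
    by_contra hcon
    simp only [mem_union, mem_ofPred_eq, not_or, not_lt, not_le, Real.norm_eq_abs] at hcon hω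
    have : |ξ ω| ≤ |simpleStableIntegral Z (g n) ω| + |simpleStableIntegral Z (g n) ω - ξ ω| := by
      have := abs_sub_abs_le_abs_sub (ξ ω) (simpleStableIntegral Z (g n) ω)
      rw [abs_sub_comm] at this
      linarith
    linarith [hcon.1, hcon.2]
  refine (measureReal_mono hsub).trans ((measureReal_union_le _ _).trans ?_)
  refine add_le_add ((measureReal_simpleStableIntegral_gt_le hZ hα0 hβ (h3 n)
    (half_pos hr)).trans ?_) le_rfl
  have hle : stableScale α (g n) ≤ stableScale α f + stableScale α (fun s => g n s - f s) := by
    have := stableScale_add_le hα h1 ((h3 n).sub h1)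
    rwa [add_sub_cancel] at this
  have := stableTailConst_pos α
  have := stableScale_nonneg α (g n)
  gcongr

/-- The stochastic integral is unique up to almost sure equality: the difference of two versions is
an integral of `0`, whose tail vanishes. -/
theorem IsStableIntegral.ae_eq [IsProbabilityMeasure μ] (hZ : IsStableRandomMeasure μ α β Z)
    (hα : 1 ≤ α) (hβ : ∀ s, β s ∈ Icc (-1 : ℝ) 1) {f : ℝ → ℝ} {ξ ξ' : Ω → ℝ}
    (h : IsStableIntegral μ α Z f ξ) (h' : IsStableIntegral μ α Z f ξ') : ξ =ᵐ[μ] ξ' := by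
  have h0 := h.linear hZ hα h' 1 (-1)
  have hz : (fun s => 1 * f s + (-1) * f s) = fun _ => 0 := by funext s; ring
  rw [hz] at h0
  have hα0 : 0 < α := by linarith
  have hs : stableScale α (fun _ => 0) = 0 := by simp [stableScale]
  have hn : ∀ n : ℕ, ∀ᵐ ω ∂μ, |1 * ξ ω + (-1) * ξ' ω| ≤ 1 / ((n : ℝ) + 1) := by
    intro n
    have h1 := h0.measureReal_gt_le hZ hα hβ (r := 1 / ((n : ℝ) + 1)) (by positivity)
    rw [hs, zero_div, Real.zero_rpow hα0.ne', mul_zero] at h1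
    have h2 := le_antisymm h1 measureReal_nonneg
    rw [measureReal_eq_zero_iff] at h2
    rw [ae_iff]
    simpa using h2
  filter_upwards [ae_all_iff.2 hn] with ω hω
  have h3 : |1 * ξ ω + (-1) * ξ' ω| ≤ 0 :=
    ge_of_tendsto' tendsto_one_div_add_atTop_nhds_zero_nat hω
  have h4 := abs_nonpos_iff.1 h3
  linarith

/-- Every function in `L^α` has a stochastic integral. The integrals of simple functions which
converge geometrically fast converge almost surely, by the tail estimate and the Borel-Cantelli
lemma. -/
theorem exists_isStableIntegral [IsProbabilityMeasure μ] (hZ : IsStableRandomMeasure μ α β Z)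
    (hα : 1 ≤ α) (hβ : ∀ s, β s ∈ Icc (-1 : ℝ) 1) {f : ℝ → ℝ}
    (hf : MemLp f (ENNReal.ofReal α) volume) : ∃ ξ, IsStableIntegral μ α Z f ξ := by
  have hα0 : 0 < α := by linarith
  have hone : 1 ≤ ENNReal.ofReal α := by simpa using ENNReal.ofReal_le_ofReal hα
  -- errors `4⁻ⁿ` make the probabilities of increments larger than `2⁻ⁿ` summable
  have hδ : ∀ n : ℕ, ENNReal.ofReal ((1 / 4 : ℝ) ^ n) ≠ 0 := fun n => by simp
  choose g hg1 hg2 using fun n : ℕ =>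
    hf.exists_simpleFunc_eLpNorm_sub_lt ENNReal.ofReal_ne_top (hδ n)
  have hlim : Tendsto (fun n => eLpNorm (fun s => g n s - f s) (ENNReal.ofReal α) volume) atTop
      (𝓝 0) := by
    have h1 : Tendsto (fun n : ℕ => ENNReal.ofReal ((1 / 4 : ℝ) ^ n)) atTop (𝓝 0) := by
      have := ENNReal.tendsto_ofReal (tendsto_pow_atTop_nhds_zero_of_lt_one
        (by norm_num : (0 : ℝ) ≤ 1 / 4) (by norm_num))
      simpa using this
    refine tendsto_of_tendsto_of_tendsto_of_le_of_le tendsto_const_nhds h1 (fun _ => zero_le)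
      fun n => ?_
    have := (hg1 n).le
    rwa [eLpNorm_sub_comm] at this
  have hclose : ∀ n, stableScale α (fun s => g (n + 1) s - g n s) ≤ 2 * (1 / 4 : ℝ) ^ n := by
    intro n
    have e : (fun s => g (n + 1) s - g n s) = (fun s => g (n + 1) s - f s) + (f - g n) := by
      ext s; simp
    have hb : ∀ m, stableScale α (f - g m) ≤ (1 / 4 : ℝ) ^ m := fun m =>
      ENNReal.toReal_le_of_le_ofReal (by positivity) (hg1 m).le
    have hb' : stableScale α (fun s => g (n + 1) s - f s) ≤ (1 / 4 : ℝ) ^ (n + 1) := by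
      have := hb (n + 1)
      unfold stableScale at *
      rwa [eLpNorm_sub_comm] at this
    rw [e]
    refine (stableScale_add_le hα ((hg2 (n + 1)).sub hf) (hf.sub (hg2 n))).trans ?_
    have := hb n
    change stableScale α (fun s => g (n + 1) s - f s) + _ ≤ _
    have h4 : (1 / 4 : ℝ) ^ (n + 1) ≤ (1 / 4 : ℝ) ^ n := by
      rw [pow_succ]; nlinarith [pow_pos (by norm_num : (0 : ℝ) < 1 / 4) n]
    linarith
  have hprob : ∀ n, μ.real {ω | (1 / 2 : ℝ) ^ n < |simpleStableIntegral Z (g (n + 1)) ω -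
      simpleStableIntegral Z (g n) ω|} ≤ stableTailConst α * 2 ^ α * (1 / 2) ^ n := by
    intro n
    have h1 := simpleStableIntegral_linear hZ hα0 (hg2 (n + 1)) (hg2 n) 1 (-1)
    set h := ((g (n + 1)).pair (g n)).map fun q => 1 * q.1 + (-1) * q.2 with hh
    have hcoe : (⇑h : ℝ → ℝ) = fun s => g (n + 1) s - g n s := by
      ext s; simp [hh]; ring
    have hmem : MemLp h (ENNReal.ofReal α) volume := by
      rw [hcoe]; exact (hg2 (n + 1)).sub (hg2 n)
    have h2 := measureReal_simpleStableIntegral_gt_le hZ hα0 hβ hmem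
      (r := (1 / 2 : ℝ) ^ n) (by positivity)
    have h3 : {ω | (1 / 2 : ℝ) ^ n < |simpleStableIntegral Z (g (n + 1)) ω -
      simpleStableIntegral Z (g n) ω|} =ᵐ[μ] {ω | (1 / 2 : ℝ) ^ n <
        |simpleStableIntegral Z h ω|} := by
      filter_upwards [h1] with ω hω
      refine propext ?_
      change (_ < _) ↔ (_ < _)
      rw [hω]
      ring_nf
    rw [measureReal_congr h3]
    refine h2.trans ?_
    rw [mul_assoc]
    refine mul_le_mul_of_nonneg_left ?_ (stableTailConst_pos α).le
    have h4 : stableScale α h / (1 / 2) ^ n ≤ 2 * (1 / 2) ^ n := by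
      rw [div_le_iff₀ (by positivity), hcoe]
      refine (hclose n).trans_eq ?_
      rw [mul_assoc, ← mul_pow]
      norm_num
    refine (Real.rpow_le_rpow (div_nonneg (stableScale_nonneg _ _) (by positivity)) h4
      hα0.le).trans ?_
    rw [Real.mul_rpow (by norm_num) (by positivity)]
    refine mul_le_mul_of_nonneg_left ?_ (by positivity)
    have h5 := Real.rpow_le_rpow_of_exponent_ge (x := (1 / 2 : ℝ) ^ n) (by positivity)
      (pow_le_one₀ (by norm_num) (by norm_num)) hα
    rwa [Real.rpow_one] at h5
  have hmeas := fun n => measurable_simpleStableIntegral hZ hα0 (hg2 n)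
  have hsum : ∑' n, μ {ω | (1 / 2 : ℝ) ^ n < |simpleStableIntegral Z (g (n + 1)) ω -
      simpleStableIntegral Z (g n) ω|} ≠ ⊤ := by
    have hS : Summable fun n : ℕ => stableTailConst α * 2 ^ α * (1 / 2 : ℝ) ^ n :=
      (summable_geometric_of_lt_one (by norm_num) (by norm_num)).mul_left _
    refine ne_top_of_le_ne_top hS.tsum_ofReal_ne_top (ENNReal.tsum_le_tsum fun n => ?_)
    rw [← ofReal_measureReal]
    exact ENNReal.ofReal_le_ofReal (hprob n)
  have hconv : ∀ᵐ ω ∂μ, ∃ l : ℝ,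
      Tendsto (fun n => simpleStableIntegral Z (g n) ω) atTop (𝓝 l) := by
    filter_upwards [ae_eventually_notMem hsum] with ω hω
    refine cauchySeq_tendsto_of_complete ?_
    obtain ⟨N, hN⟩ := eventually_atTop.1 hω
    refine (cauchySeq_shift N).1 ?_
    refine cauchySeq_of_le_geometric (1 / 2) 1 (by norm_num) fun n => ?_
    have h1 := hN (n + N) (by omega)
    simp only [not_lt] at h1
    rw [dist_comm, Real.dist_eq, one_mul]
    rw [show n + 1 + N = n + N + 1 by ring]
    refine h1.trans ?_
    exact pow_le_pow_of_le_one (by norm_num) (by norm_num) (by omega)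
  obtain ⟨ξ, hξ1, hξ2⟩ := measurable_limit_of_tendsto_metrizable_ae
    (fun n => (hmeas n).aemeasurable) hconv
  exact ⟨ξ, hf, hξ1, g, hg2, hlim, tendstoInMeasure_of_tendsto_ae
    (fun n => (hmeas n).aestronglyMeasurable) hξ2⟩

/-- The stochastic integral is closed: if `f n → f` in `L^α` and the stochastic integrals of the
`f n` converge almost surely to `ξ`, then `ξ` is a version of the stochastic integral of `f`. -/
theorem isStableIntegral_of_tendsto [IsProbabilityMeasure μ]
    (hZ : IsStableRandomMeasure μ α β Z) (hα : 1 ≤ α) (hβ : ∀ s, β s ∈ Icc (-1 : ℝ) 1)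
    {f : ℝ → ℝ} {F : ℕ → ℝ → ℝ} {ξ : Ω → ℝ} {X : ℕ → Ω → ℝ}
    (hf : MemLp f (ENNReal.ofReal α) volume) (hX : ∀ n, IsStableIntegral μ α Z (F n) (X n))
    (hF : Tendsto (fun n => eLpNorm (fun s => F n s - f s) (ENNReal.ofReal α) volume) atTop
      (𝓝 0))
    (hξ : Measurable ξ) (hlim : ∀ᵐ ω ∂μ, Tendsto (fun n => X n ω) atTop (𝓝 (ξ ω))) :
    IsStableIntegral μ α Z f ξ := by
  have hα0 : 0 < α := by linarith
  obtain ⟨ξ', hξ'⟩ := exists_isStableIntegral hZ hα hβ hf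
  have h1 : TendstoInMeasure μ X atTop ξ :=
    tendstoInMeasure_of_tendsto_ae (fun n => (hX n).2.1.aestronglyMeasurable) hlim
  have h2 : TendstoInMeasure μ X atTop ξ' := by
    rw [tendstoInMeasure_iff_measureReal_norm]
    intro ε hε
    have h3 : Tendsto (fun n => stableTailConst α *
        (stableScale α (fun s => F n s - f s) / (ε / 2 / 2)) ^ α) atTop
        (𝓝 (stableTailConst α * (0 / (ε / 2 / 2)) ^ α)) :=
      (((tendsto_stableScale hF).div_const _).rpow_const (Or.inr hα0.le)).const_mul _
    rw [zero_div, Real.zero_rpow hα0.ne', mul_zero] at h3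
    refine tendsto_of_tendsto_of_tendsto_of_le_of_le tendsto_const_nhds h3
      (fun _ => measureReal_nonneg) fun n => ?_
    have h4 := (hX n).linear hZ hα hξ' 1 (-1)
    have h5 := h4.measureReal_gt_le hZ hα hβ (half_pos hε)
    have e : (fun s => 1 * F n s + (-1) * f s) = fun s => F n s - f s := by funext s; ring
    rw [e] at h5
    refine le_trans (measureReal_mono fun ω hω => ?_) h5
    simp only [mem_ofPred_eq, Real.norm_eq_abs] at hω ⊢
    rw [show 1 * X n ω + (-1) * ξ' ω = X n ω - ξ' ω by ring]
    linarith
  exact hξ'.congr EventuallyEq.rfl (tendstoInMeasure_ae_unique h2 h1) hξ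

end calculus

/-! ### Summability of the growth weights -/

section growth

theorem summable_int_of_abs {f : ℝ → ℝ} (h : Summable fun n : ℕ => f n) :
    Summable fun k : ℤ => f |(k : ℝ)| := by
  apply Summable.of_nat_of_neg <;> simpa using h

theorem summable_one_add_abs_int_rpow {p : ℝ} (hp : 1 < p) :
    Summable fun k : ℤ => (1 + |(k : ℝ)|) ^ (-p) := by
  refine summable_int_of_abs (f := fun x => (1 + x) ^ (-p)) ?_
  have h := (summable_nat_add_iff 1).2 (Real.summable_nat_rpow.2 (by linarith : -p < -1))
  refine h.congr fun n => ?_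
  push_cast
  rw [add_comm]

/-- The series `∑ 1 / (n (log n)^q)` converges for `q > 1`, by Cauchy condensation. -/
theorem summable_inv_mul_log_rpow {q : ℝ} (hq : 1 < q) :
    Summable fun n : ℕ => ((1 + (n : ℝ)) * Real.log (2 + n) ^ q)⁻¹ := by
  have hlog : ∀ n : ℕ, 0 < Real.log (2 + n) := fun n =>
    Real.log_pos (by have : (0 : ℝ) ≤ n := n.cast_nonneg; linarith)
  refine (summable_condensed_iff_of_nonneg (fun n => ?_) fun m n _ hmn => ?_).1 ?_
  · have := hlog n
    positivity
  · have := hlog m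
    have hmn' : (m : ℝ) ≤ n := by exact_mod_cast hmn
    gcongr
  · have hs : Summable fun k : ℕ => (Real.log 2 ^ q)⁻¹ * (k : ℝ) ^ (-q) :=
      (Real.summable_nat_rpow.2 (by linarith)).mul_left _
    refine (summable_nat_add_iff 1).1 (Summable.of_nonneg_of_le (fun k => ?_) (fun k => ?_)
      ((summable_nat_add_iff 1).2 hs))
    · have := hlog (2 ^ (k + 1))
      positivity
    · have h2 : (0 : ℝ) < Real.log 2 := Real.log_pos (by norm_num)
      have hk : ((k : ℝ) + 1) * Real.log 2 ≤ Real.log (2 + ((2 ^ (k + 1) : ℕ) : ℝ)) := by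
        have : ((k : ℝ) + 1) * Real.log 2 = Real.log (2 ^ (k + 1)) := by
          rw [Real.log_pow]; push_cast; ring
        rw [this]
        refine Real.log_le_log (by positivity) ?_
        push_cast
        linarith
      calc (2 : ℝ) ^ (k + 1) * ((1 + ((2 ^ (k + 1) : ℕ) : ℝ)) *
            Real.log (2 + ((2 ^ (k + 1) : ℕ) : ℝ)) ^ q)⁻¹
          ≤ 2 ^ (k + 1) * (2 ^ (k + 1) * (((k : ℝ) + 1) * Real.log 2) ^ q)⁻¹ := by
            gcongr
            push_cast
            linarith
        _ = (Real.log 2 ^ q)⁻¹ * ((k + 1 : ℕ) : ℝ) ^ (-q) := by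
            rw [Real.mul_rpow (by positivity) h2.le, Real.rpow_neg (by positivity)]
            push_cast
            field_simp

/-- The size allowed to the coefficient of index `(j, k)` on a good event. -/
def growthWeight (α η : ℝ) (j k : ℤ) : ℝ :=
  (1 + |(j : ℝ)|) ^ (1 / α + η) * (1 + |(k : ℝ)|) ^ (1 / α) *
    Real.log (2 + |(k : ℝ)|) ^ (1 / α + η)

theorem log_two_add_abs_pos (x : ℝ) : 0 < Real.log (2 + |x|) :=
  Real.log_pos (by have := abs_nonneg x; linarith)

theorem growthWeight_pos (α η : ℝ) (j k : ℤ) : 0 < growthWeight α η j k := by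
  have := log_two_add_abs_pos (k : ℝ)
  unfold growthWeight
  positivity

/-- The exponents of the weights are those for which the tail estimate makes the exceptional
probabilities summable over all indices. -/
theorem summable_growthWeight_rpow {α η : ℝ} (hα : 0 < α) (hη : 0 < η) :
    Summable fun p : ℤ × ℤ => growthWeight α η p.1 p.2 ^ (-α) := by
  have hq : 1 < 1 + α * η := by nlinarith [mul_pos hα hη]
  have h1 := summable_one_add_abs_int_rpow hq
  have h2 : Summable fun k : ℤ =>
      ((1 + |(k : ℝ)|) * Real.log (2 + |(k : ℝ)|) ^ (1 + α * η))⁻¹ :=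
    summable_int_of_abs (f := fun x => ((1 + x) * Real.log (2 + x) ^ (1 + α * η))⁻¹)
      (summable_inv_mul_log_rpow hq)
  have hn2 : ∀ k : ℤ, 0 ≤ ((1 + |(k : ℝ)|) * Real.log (2 + |(k : ℝ)|) ^ (1 + α * η))⁻¹ :=
    fun k => by have := log_two_add_abs_pos (k : ℝ); positivity
  refine (h1.mul_of_nonneg h2 (fun j => by positivity) hn2).congr fun p => ?_
  have hl := log_two_add_abs_pos (p.2 : ℝ)
  have e1 : (1 / α + η) * (-α) = -(1 + α * η) := by field_simp
  have e2 : 1 / α * (-α) = -1 := by field_simp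
  rw [growthWeight, Real.mul_rpow (by positivity) (by positivity),
    Real.mul_rpow (by positivity) (by positivity), ← Real.rpow_mul (by positivity),
    ← Real.rpow_mul (by positivity), ← Real.rpow_mul (by positivity), e1, e2,
    Real.rpow_neg_one, Real.rpow_neg hl.le]
  rw [mul_inv, mul_assoc]

theorem growthWeight_le_of_le {α η η' : ℝ} (h : η' ≤ η) (j k : ℤ) :
    growthWeight α η' j k ≤ Real.log 2 ^ (η' - η) * growthWeight α η j k := by
  have hl := log_two_add_abs_pos (k : ℝ)
  have h2 : (0 : ℝ) < Real.log 2 := Real.log_pos (by norm_num)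
  have e : Real.log (2 + |(k : ℝ)|) ^ (1 / α + η') ≤
      Real.log 2 ^ (η' - η) * Real.log (2 + |(k : ℝ)|) ^ (1 / α + η) := by
    rw [show 1 / α + η' = (η' - η) + (1 / α + η) by ring, Real.rpow_add hl]
    refine mul_le_mul_of_nonneg_right ?_ (by positivity)
    refine Real.rpow_le_rpow_of_nonpos h2 (Real.log_le_log (by norm_num) ?_) (by linarith)
    linarith [abs_nonneg (k : ℝ)]
  have e' : (1 + |(j : ℝ)|) ^ (1 / α + η') ≤ (1 + |(j : ℝ)|) ^ (1 / α + η) :=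
    Real.rpow_le_rpow_of_exponent_le (by linarith [abs_nonneg (j : ℝ)]) (by linarith)
  unfold growthWeight
  calc _ ≤ (1 + |(j : ℝ)|) ^ (1 / α + η) * (1 + |(k : ℝ)|) ^ (1 / α) *
        (Real.log 2 ^ (η' - η) * Real.log (2 + |(k : ℝ)|) ^ (1 / α + η)) := by gcongr
    _ = _ := by ring

theorem one_le_growthWeight {α η : ℝ} (hα : 0 < α) (hη : 0 < η) :
    ∃ C : ℝ, ∀ j k : ℤ, 1 ≤ C * growthWeight α η j k := by
  have h2 : (0 : ℝ) < Real.log 2 := Real.log_pos (by norm_num)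
  refine ⟨(Real.log 2 ^ (1 / α + η))⁻¹, fun j k => ?_⟩
  rw [← div_eq_inv_mul, le_div_iff₀ (by positivity), one_mul, growthWeight]
  have h3 : Real.log 2 ^ (1 / α + η) ≤ Real.log (2 + |(k : ℝ)|) ^ (1 / α + η) := by
    refine Real.rpow_le_rpow h2.le (Real.log_le_log (by norm_num) ?_) (by positivity)
    linarith [abs_nonneg (k : ℝ)]
  have h4 : 1 ≤ (1 + |(j : ℝ)|) ^ (1 / α + η) :=
    Real.one_le_rpow (by linarith [abs_nonneg (j : ℝ)]) (by positivity)
  have h5 : 1 ≤ (1 + |(k : ℝ)|) ^ (1 / α) :=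
    Real.one_le_rpow (by linarith [abs_nonneg (k : ℝ)]) (by positivity)
  calc _ ≤ 1 * Real.log (2 + |(k : ℝ)|) ^ (1 / α + η) := by rw [one_mul]; exact h3
    _ ≤ _ := by
      refine mul_le_mul_of_nonneg_right (one_le_mul_of_one_le_of_one_le h4 h5) ?_
      exact h3.trans' (by positivity)

/-! ### Growth of the random coefficients -/

theorem measurableEmbedding_affine {a : ℝ} (ha : a ≠ 0) (b : ℝ) :
    MeasurableEmbedding fun s : ℝ => a * s - b :=
  (measurableEmbedding_subRight b).comp (measurableEmbedding_mulLeft₀ ha)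

theorem map_affine_volume {a : ℝ} (ha : a ≠ 0) (b : ℝ) :
    Measure.map (fun s : ℝ => a * s - b) volume = ENNReal.ofReal |a⁻¹| • volume := by
  have h1 : Measure.map (fun s : ℝ => a * s - b) volume =
      Measure.map (fun s => s - b) (Measure.map (fun s => a * s) volume) := by
    rw [Measure.map_map (by fun_prop) (by fun_prop)]
    rfl
  rw [h1, Real.map_volume_mul_left ha, Measure.map_smul, map_sub_right_eq_self]

theorem eLpNorm_comp_affine {e : ℝ → ℝ} {p : ℝ} (hp : 0 < p) {a : ℝ} (ha : 0 < a) (b : ℝ) :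
    eLpNorm (fun s => a ^ (1 / p) * e (a * s - b)) (ENNReal.ofReal p) volume =
      eLpNorm e (ENNReal.ofReal p) volume := by
  have h1 : (fun s => a ^ (1 / p) * e (a * s - b)) = (a ^ (1 / p)) • (e ∘ fun s => a * s - b) := by
    ext s; simp
  rw [h1, eLpNorm_const_smul, ← (measurableEmbedding_affine ha.ne' b).eLpNorm_map_measure,
    map_affine_volume ha.ne', eLpNorm_smul_measure_of_ne_top ENNReal.ofReal_ne_top, smul_eq_mul,
    ← mul_assoc]
  have h2 : (1 / ENNReal.ofReal p).toReal = 1 / p := by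
    rw [ENNReal.toReal_div, ENNReal.toReal_one, ENNReal.toReal_ofReal hp.le]
  rw [h2, Real.enorm_eq_ofReal (by positivity), ENNReal.ofReal_rpow_of_nonneg (abs_nonneg _)
    (by positivity), ← ENNReal.ofReal_mul (by positivity), abs_of_pos (inv_pos.2 ha),
    ← Real.mul_rpow ha.le (inv_pos.2 ha).le, mul_inv_cancel₀ ha.ne', Real.one_rpow,
    ENNReal.ofReal_one, one_mul]

theorem memLp_comp_affine {e : ℝ → ℝ} {p : ENNReal} (he : MemLp e p volume)
    {a : ℝ} (ha : a ≠ 0) (b c : ℝ) :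
    MemLp (fun s => c * e (a * s - b)) p volume := by
  refine MemLp.const_mul ?_ c
  change MemLp (e ∘ fun s => a * s - b) p volume
  rw [← (measurableEmbedding_affine ha b).memLp_map_measure_iff, map_affine_volume ha]
  exact he.smul_measure ENNReal.ofReal_ne_top

theorem two_rpow_div_eq (j : ℤ) (p : ℝ) :
    (2 : ℝ) ^ ((j : ℝ) / p) = ((2 : ℝ) ^ j) ^ (1 / p) := by
  rw [← Real.rpow_intCast, ← Real.rpow_mul (by norm_num)]
  ring_nf

/-- The normalization `2^{j/α}` makes all the dilated and translated functions have the same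
`L^α` norm. -/
theorem stableScale_wavelet {e : ℝ → ℝ} {α : ℝ} (hα : 0 < α) (j k : ℤ) :
    stableScale α (fun s => (2 : ℝ) ^ ((j : ℝ) / α) * e ((2 : ℝ) ^ j * s - k)) =
      stableScale α e := by
  unfold stableScale
  rw [two_rpow_div_eq, eLpNorm_comp_affine hα (by positivity)]

variable {Ω : Type*} [MeasurableSpace Ω] {μ : Measure Ω} {α : ℝ} {β : ℝ → ℝ} {Z : Set ℝ → Ω → ℝ}

theorem exists_isWaveletCoeff [IsProbabilityMeasure μ] (hZ : IsStableRandomMeasure μ α β Z)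
    (hα : 1 ≤ α) (hβ : ∀ s, β s ∈ Icc (-1 : ℝ) 1) {e : ℝ → ℝ}
    (he : MemLp e (ENNReal.ofReal α) volume) : ∃ ε, IsWaveletCoeff μ α Z e ε := by
  choose ε hε using fun j k : ℤ => exists_isStableIntegral hZ hα hβ
    (memLp_comp_affine he (a := (2 : ℝ) ^ j) (by positivity) k ((2 : ℝ) ^ ((j : ℝ) / α)))
  exact ⟨ε, hε⟩

/-- The Borel-Cantelli lemma: almost surely, only finitely many coefficients exceed their weight.
No independence of the coefficients is needed. -/
theorem IsWaveletCoeff.ae_exists_bound [IsProbabilityMeasure μ]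
    (hZ : IsStableRandomMeasure μ α β Z) (hα : 1 ≤ α) (hβ : ∀ s, β s ∈ Icc (-1 : ℝ) 1)
    {e : ℝ → ℝ} {ε : ℤ → ℤ → Ω → ℝ} (hε : IsWaveletCoeff μ α Z e ε) {η : ℝ} (hη : 0 < η) :
    ∀ᵐ ω ∂μ, ∃ C : ℕ, ∀ j k : ℤ, |ε j k ω| ≤ C * growthWeight α η j k := by
  have hα0 : 0 < α := by linarith
  have hprob : ∀ p : ℤ × ℤ, μ.real {ω | growthWeight α η p.1 p.2 < |ε p.1 p.2 ω|} ≤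
      stableTailConst α * (2 * stableScale α e) ^ α * growthWeight α η p.1 p.2 ^ (-α) := by
    intro p
    have hw := growthWeight_pos α η p.1 p.2
    refine ((hε p.1 p.2).measureReal_gt_le hZ hα hβ hw).trans_eq ?_
    have := stableScale_nonneg α e
    rw [stableScale_wavelet hα0, mul_assoc, Real.rpow_neg hw.le, ← Real.inv_rpow hw.le,
      ← Real.mul_rpow (by positivity) (by positivity)]
    congr 2
    field_simp
  have hsum : ∑' p : ℤ × ℤ, μ {ω | growthWeight α η p.1 p.2 < |ε p.1 p.2 ω|} ≠ ⊤ := by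
    refine ne_top_of_le_ne_top
      ((summable_growthWeight_rpow hα0 hη).mul_left
        (stableTailConst α * (2 * stableScale α e) ^ α)).tsum_ofReal_ne_top
      (ENNReal.tsum_le_tsum fun p => ?_)
    rw [← ofReal_measureReal]
    exact ENNReal.ofReal_le_ofReal (hprob p)
  filter_upwards [ae_finite_setOfPred_mem hsum] with ω hω
  obtain ⟨B, hB⟩ := (hω.image fun p : ℤ × ℤ => |ε p.1 p.2 ω| / growthWeight α η p.1 p.2).bddAbove
  obtain ⟨C, hC⟩ := exists_nat_ge (max 1 B)
  refine ⟨C, fun j k => ?_⟩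
  have hw := growthWeight_pos α η j k
  by_cases h : growthWeight α η j k < |ε j k ω|
  · have h1 := hB (mem_image_of_mem _ (show (j, k) ∈ {p : ℤ × ℤ | ω ∈
      {ω | growthWeight α η p.1 p.2 < |ε p.1 p.2 ω|}} from h))
    dsimp only at h1
    rw [div_le_iff₀ hw] at h1
    exact h1.trans (mul_le_mul_of_nonneg_right ((le_max_right _ _).trans hC) hw.le)
  · push Not at h
    refine h.trans ?_
    have := (le_max_left 1 B).trans hC
    nlinarith

theorem IsWaveletCoeff.exists_isGoodEvent [IsProbabilityMeasure μ]
    (hZ : IsStableRandomMeasure μ α β Z) (hα : 1 ≤ α) (hβ : ∀ s, β s ∈ Icc (-1 : ℝ) 1)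
    {e : ℝ → ℝ} {ε : ℤ → ℤ → Ω → ℝ} (hε : IsWaveletCoeff μ α Z e ε) :
    ∃ Ω₀, IsGoodEvent μ α ε Ω₀ := by
  -- countably many `η` and `C` suffice, which makes the event measurable
  let G : Set Ω := ⋂ n : ℕ, ⋃ C : ℕ, ⋂ j : ℤ, ⋂ k : ℤ,
    {ω | |ε j k ω| ≤ C * growthWeight α (1 / ((n : ℝ) + 1)) j k}
  have hG : ∀ ω, ω ∈ G ↔ ∀ n : ℕ, ∃ C : ℕ, ∀ j k : ℤ,
      |ε j k ω| ≤ C * growthWeight α (1 / ((n : ℝ) + 1)) j k := by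
    intro ω; simp [G]
  have hmeas : MeasurableSet G := by
    refine MeasurableSet.iInter fun n => MeasurableSet.iUnion fun C => MeasurableSet.iInter fun j =>
      MeasurableSet.iInter fun k => measurableSet_le ?_ measurable_const
    have := (hε j k).2.1
    fun_prop
  refine ⟨G, hmeas, ?_, fun ω hω η hη => ?_⟩
  · rw [← prob_compl_eq_zero_iff hmeas]
    have : ∀ᵐ ω ∂μ, ω ∈ G := by
      have := ae_all_iff.2 fun n : ℕ => hε.ae_exists_bound hZ hα hβ
        (show (0 : ℝ) < 1 / ((n : ℝ) + 1) by positivity)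
      filter_upwards [this] with ω hω
      exact (hG ω).2 hω
    exact this
  · obtain ⟨n, hn⟩ := exists_nat_one_div_lt hη
    obtain ⟨C, hC⟩ := (hG ω).1 hω n
    refine ⟨C * Real.log 2 ^ (1 / ((n : ℝ) + 1) - η), fun j k => ?_⟩
    refine (hC j k).trans ((mul_le_mul_of_nonneg_left (growthWeight_le_of_le hn.le j k)
      (Nat.cast_nonneg C)).trans_eq ?_)
    rw [growthWeight]
    ring

end growth

/-! ### Fractional primitives of functions with vanishing moments -/

section primitive

theorem truncPow_of_ne_zero (x : ℝ) {κ : ℝ} (hκ : κ ≠ 0) : truncPow x κ = max x 0 ^ κ := by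
  unfold truncPow
  split_ifs with h
  · rw [max_eq_left h.le]
  · rw [max_eq_right (not_lt.1 h), Real.zero_rpow hκ]

theorem continuous_truncPow {κ : ℝ} (hκ : 0 < κ) : Continuous fun x => truncPow x κ := by
  simp_rw [truncPow_of_ne_zero _ hκ.ne']
  exact (continuous_id.max continuous_const).rpow_const fun x => Or.inr hκ.le

theorem truncPow_nonneg (x κ : ℝ) : 0 ≤ truncPow x κ := by
  unfold truncPow
  split_ifs with h
  · exact Real.rpow_nonneg h.le _
  · exact le_rfl

theorem truncPow_mul {a : ℝ} (ha : 0 < a) (x κ : ℝ) :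
    truncPow (a * x) κ = a ^ κ * truncPow x κ := by
  unfold truncPow
  by_cases h : 0 < x
  · rw [if_pos h, if_pos (mul_pos ha h), Real.mul_rpow ha.le h.le]
  · rw [if_neg h, if_neg (by rwa [mul_pos_iff_of_pos_left ha]), mul_zero]

/-- The convolution of the truncated power of exponent `κ` with `θ`, which is, up to a constant
factor, the fractional primitive of order `κ + 1` of `θ`. -/
def fracPrimitive (θ : ℝ → ℝ) (κ x : ℝ) : ℝ := ∫ s, truncPow (x - s) κ * θ s

theorem waveletPrimitive_eq (α : ℝ) (ψ : ℝ → ℝ) (x v : ℝ) :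
    waveletPrimitive α ψ x v = fracPrimitive ψ (v - 1 / α) x := rfl

theorem abs_exp_sub_exp_le (x y : ℝ) :
    |Real.exp x - Real.exp y| ≤ |x - y| * (Real.exp x + Real.exp y) := by
  wlog h : y ≤ x generalizing x y
  · have := this y x (by linarith)
    rw [abs_sub_comm, abs_sub_comm x y, add_comm]
    exact this
  have h1 : Real.exp x * (1 - (x - y)) ≤ Real.exp y := by
    have h2 := Real.add_one_le_exp (y - x)
    have h3 : Real.exp y = Real.exp x * Real.exp (y - x) := by
      rw [← Real.exp_add]; ring_nf
    rw [h3]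
    refine mul_le_mul_of_nonneg_left (by linarith) (Real.exp_pos x).le
  rw [abs_of_nonneg (sub_nonneg.2 (Real.exp_le_exp.2 h)), abs_of_nonneg (by linarith)]
  nlinarith [Real.exp_pos y, Real.exp_pos x, mul_nonneg (sub_nonneg.2 h) (Real.exp_pos y).le]

theorem rpow_le_rpow_add_rpow {a p q r : ℝ} (ha : 0 < a) (h1 : p ≤ q) (h2 : q ≤ r) :
    a ^ q ≤ a ^ p + a ^ r := by
  rcases le_total a 1 with h | h
  · exact (Real.rpow_le_rpow_of_exponent_ge ha h h1).trans
      (le_add_of_nonneg_right (Real.rpow_nonneg ha.le _))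
  · exact (Real.rpow_le_rpow_of_exponent_le h h2).trans
      (le_add_of_nonneg_left (Real.rpow_nonneg ha.le _))

theorem abs_log_le_rpow_add_rpow {a δ : ℝ} (ha : 0 < a) (hδ : 0 < δ) :
    |Real.log a| ≤ (a ^ δ + a ^ (-δ)) / δ := by
  have h1 := Real.log_le_rpow_div ha.le hδ
  have h2 := Real.log_le_rpow_div (inv_pos.2 ha).le hδ
  rw [Real.log_inv, Real.inv_rpow ha.le, ← Real.rpow_neg ha.le] at h2
  have h3 : 0 ≤ a ^ δ / δ := by positivity
  have h4 : 0 ≤ a ^ (-δ) / δ := by positivity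
  rw [add_div, abs_le]
  constructor <;> linarith

/-- Powers are Lipschitz continuous in the exponent, at the price of slightly enlarging the range
of the exponents. -/
theorem abs_rpow_sub_rpow_le {a p q m M δ : ℝ} (ha : 0 < a) (hδ : 0 < δ)
    (hp : p ∈ Icc m M) (hq : q ∈ Icc m M) :
    |a ^ p - a ^ q| ≤ 4 / δ * |p - q| * (a ^ (m - δ) + a ^ (M + δ)) := by
  have key : ∀ r ∈ Icc m M,
      (a ^ δ + a ^ (-δ)) * a ^ r ≤ 2 * (a ^ (m - δ) + a ^ (M + δ)) := by
    intro r hr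
    rw [add_mul, ← Real.rpow_add ha, ← Real.rpow_add ha]
    have h1 := rpow_le_rpow_add_rpow (a := a) (p := m - δ) (q := δ + r) (r := M + δ) ha
      (by linarith [hr.1]) (by linarith [hr.2])
    have h2 := rpow_le_rpow_add_rpow (a := a) (p := m - δ) (q := -δ + r) (r := M + δ) ha
      (by linarith [hr.1]) (by linarith [hr.2])
    linarith
  have h1 := abs_exp_sub_exp_le (Real.log a * p) (Real.log a * q)
  rw [← Real.rpow_def_of_pos ha, ← Real.rpow_def_of_pos ha, ← mul_sub, abs_mul] at h1
  refine h1.trans ?_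
  have h2 := abs_log_le_rpow_add_rpow ha hδ
  have h3 := key p hp
  have h4 := key q hq
  have h5 : 0 < a ^ p := Real.rpow_pos_of_pos ha _
  have h6 : 0 < a ^ q := Real.rpow_pos_of_pos ha _
  calc |Real.log a| * |p - q| * (a ^ p + a ^ q)
      ≤ (a ^ δ + a ^ (-δ)) / δ * |p - q| * (a ^ p + a ^ q) := by gcongr
    _ = |p - q| / δ * ((a ^ δ + a ^ (-δ)) * a ^ p + (a ^ δ + a ^ (-δ)) * a ^ q) := by
        field_simp
    _ ≤ |p - q| / δ * (2 * (a ^ (m - δ) + a ^ (M + δ)) + 2 * (a ^ (m - δ) + a ^ (M + δ))) := by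
        gcongr
    _ = _ := by ring

theorem exists_radius {G : ℝ → ℝ} (h : HasCompactSupport G) :
    ∃ R : ℝ, 0 < R ∧ ∀ x, R ≤ |x| → G x = 0 := by
  obtain ⟨R, hR, h⟩ := h.exists_pos_le_norm
  exact ⟨R, hR, fun x hx => h x (by simpa using hx)⟩

theorem integral_eq_interval {f : ℝ → ℝ} {R : ℝ} (hf : ∀ x, R ≤ |x| → f x = 0) :
    ∫ s, f s = ∫ s in (-R)..R, f s := by
  refine (intervalIntegral.integral_eq_integral_of_support_subset fun x hx => ?_).symm
  by_contra hcon
  refine hx (hf x ?_)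
  rw [mem_Ioc, not_and_or, not_lt, not_le] at hcon
  rcases hcon with h | h
  · exact le_abs.2 (Or.inr (by linarith))
  · exact le_abs.2 (Or.inl h.le)

/-- Two integrations by parts: far to the right of the support of `G`, the fractional primitive of
`G''` decays faster than that of a general function, by two powers. -/
theorem fracPrimitive_deriv_deriv {G : ℝ → ℝ} (hG : ContDiff ℝ 2 G) {R : ℝ} (hR : 0 < R)
    (h0 : ∀ x, R ≤ |x| → G x = 0) (h1 : ∀ x, R ≤ |x| → deriv G x = 0)
    (h2 : ∀ x, R ≤ |x| → deriv (deriv G) x = 0) (κ : ℝ) {x : ℝ} (hx : R < x) :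
    fracPrimitive (deriv (deriv G)) κ x =
      ∫ s in (-R)..R, (κ * (κ - 1)) * (x - s) ^ (κ - 2) * G s := by
  have hG1 : ContDiff ℝ 1 (deriv G) := by
    have : ContDiff ℝ (1 + 1) G := by simpa [one_add_one_eq_two] using hG
    exact (contDiff_succ_iff_deriv.1 this).2.2
  have hdG : ∀ s, HasDerivAt G (deriv G s) s := fun s =>
    (hG.differentiable (by norm_num) s).hasDerivAt
  have hdG1 : ∀ s, HasDerivAt (deriv G) (deriv (deriv G) s) s := fun s =>
    (hG1.differentiable (by norm_num) s).hasDerivAt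
  have hc2 : Continuous (deriv (deriv G)) := hG1.continuous_deriv le_rfl
  have hpos : ∀ s ∈ uIcc (-R) R, 0 < x - s := by
    intro s hs
    rw [uIcc_of_le (by linarith)] at hs
    linarith [hs.2]
  have hpow : ∀ p : ℝ, ∀ s ∈ uIcc (-R) R,
      HasDerivAt (fun s => (x - s) ^ p) (-(p * (x - s) ^ (p - 1))) s := by
    intro p s hs
    have := ((hasDerivAt_id s).const_sub x).rpow_const (p := p) (Or.inl (hpos s hs).ne')
    simpa using this
  have hcont : ∀ p : ℝ, ContinuousOn (fun s => (x - s) ^ p) (uIcc (-R) R) := fun p s hs =>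
    (hpow p s hs).continuousAt.continuousWithinAt
  have hI : ∀ p c : ℝ, IntervalIntegrable (fun s => -(c * (x - s) ^ p)) volume (-R) R :=
    fun p c => ((continuousOn_const.mul (hcont p)).neg).intervalIntegrable
  have habs : |R| = R := abs_of_pos hR
  have hb : deriv G R = 0 ∧ deriv G (-R) = 0 ∧ G R = 0 ∧ G (-R) = 0 :=
    ⟨h1 _ (by rw [habs]), h1 _ (by rw [abs_neg, habs]), h0 _ (by rw [habs]),
      h0 _ (by rw [abs_neg, habs])⟩
  have e1 : fracPrimitive (deriv (deriv G)) κ x =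
      ∫ s in (-R)..R, (x - s) ^ κ * deriv (deriv G) s := by
    rw [fracPrimitive, integral_eq_interval (R := R) (fun s hs => by rw [h2 s hs, mul_zero])]
    refine intervalIntegral.integral_congr fun s hs => ?_
    rw [truncPow, if_pos (hpos s hs)]
  have e2 := intervalIntegral.integral_mul_deriv_eq_deriv_mul (hpow κ) (fun s _ => hdG1 s)
    (hI _ _) (hc2.intervalIntegrable _ _)
  have e3 := intervalIntegral.integral_mul_deriv_eq_deriv_mul (hpow (κ - 1)) (fun s _ => hdG s)
    (hI _ _) (hG1.continuous.intervalIntegrable _ _)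
  obtain ⟨b1, b2, b3, b4⟩ := hb
  rw [e1, e2, b1, b2]
  have e4 : ∫ s in (-R)..R, -(κ * (x - s) ^ (κ - 1)) * deriv G s =
      -κ * ∫ s in (-R)..R, (x - s) ^ (κ - 1) * deriv G s := by
    rw [← intervalIntegral.integral_const_mul]
    congr 1; ext s; ring
  have e5 : ∫ s in (-R)..R, -((κ - 1) * (x - s) ^ (κ - 1 - 1)) * G s =
      -(κ - 1) * ∫ s in (-R)..R, (x - s) ^ (κ - 2) * G s := by
    rw [← intervalIntegral.integral_const_mul]
    congr 1; ext s; rw [show κ - 1 - 1 = κ - 2 by ring]; ring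
  have e6 : ∫ s in (-R)..R, (κ * (κ - 1)) * (x - s) ^ (κ - 2) * G s =
      κ * (κ - 1) * ∫ s in (-R)..R, (x - s) ^ (κ - 2) * G s := by
    rw [← intervalIntegral.integral_const_mul]
    congr 1; ext s; ring
  rw [e4, e3, e5, e6, b3, b4]
  ring

theorem integrable_truncPow_mul {θ : ℝ → ℝ} (hθ : Continuous θ) (hs : HasCompactSupport θ)
    {κ : ℝ} (hκ : 0 < κ) (x : ℝ) : Integrable fun s => truncPow (x - s) κ * θ s := by
  refine Continuous.integrable_of_hasCompactSupport ?_ hs.mul_left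
  exact ((continuous_truncPow hκ).comp (continuous_const.sub continuous_id)).mul hθ

theorem fracPrimitive_sub_eq {θ : ℝ → ℝ} (hθ : Continuous θ) (hs : HasCompactSupport θ)
    {κ κ' : ℝ} (hκ : 0 < κ) (hκ' : 0 < κ') (x : ℝ) :
    fracPrimitive θ κ x - fracPrimitive θ κ' x =
      ∫ s, (truncPow (x - s) κ - truncPow (x - s) κ') * θ s := by
  rw [fracPrimitive, fracPrimitive, ← integral_sub (integrable_truncPow_mul hθ hs hκ x)
    (integrable_truncPow_mul hθ hs hκ' x)]
  congr 1; ext s; ring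

theorem exists_common_radius {G : ℝ → ℝ} (hs : HasCompactSupport G) :
    ∃ R : ℝ, 0 < R ∧ (∀ x, R ≤ |x| → G x = 0) ∧ (∀ x, R ≤ |x| → deriv G x = 0) ∧
      ∀ x, R ≤ |x| → deriv (deriv G) x = 0 := by
  obtain ⟨R0, hR0, h0⟩ := exists_radius hs
  obtain ⟨R1, hR1, h1⟩ := exists_radius hs.deriv
  obtain ⟨R2, hR2, h2⟩ := exists_radius hs.deriv.deriv
  refine ⟨max R0 (max R1 R2), lt_max_of_lt_left hR0, fun x hx => h0 x ?_, fun x hx => h1 x ?_,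
    fun x hx => h2 x ?_⟩
  · exact (le_max_left _ _).trans hx
  · exact ((le_max_left _ _).trans (le_max_right _ _)).trans hx
  · exact ((le_max_right _ _).trans (le_max_right _ _)).trans hx

/-- Decay of the fractional primitive of `G''`, and of its increments in the exponent. -/
theorem exists_fracPrimitive_bound {G : ℝ → ℝ} (hG : ContDiff ℝ 2 G) (hs : HasCompactSupport G)
    {m M L : ℝ} (hm : 0 < m) (hM : M < 1) (hL0 : 0 < L) (hL : L < 2 - M) :
    ∃ C : ℝ, 0 ≤ C ∧ ∀ κ ∈ Icc m M, ∀ κ' ∈ Icc m M, ∀ x : ℝ,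
      |fracPrimitive (deriv (deriv G)) κ x| ≤ C * (1 + |x|) ^ (-L) ∧
      |fracPrimitive (deriv (deriv G)) κ x - fracPrimitive (deriv (deriv G)) κ' x| ≤
        C * |κ - κ'| * (1 + |x|) ^ (-L) := by
  obtain ⟨R, hR, h0, h1, h2⟩ := exists_common_radius hs
  have hG1 : ContDiff ℝ 1 (deriv G) := by
    have : ContDiff ℝ (1 + 1) G := by simpa [one_add_one_eq_two] using hG
    exact (contDiff_succ_iff_deriv.1 this).2.2
  have hc2 : Continuous (deriv (deriv G)) := hG1.continuous_deriv le_rfl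
  have hs2 : HasCompactSupport (deriv (deriv G)) := hs.deriv.deriv
  obtain ⟨B0, hB0⟩ := hG.continuous.bounded_above_of_compact_support hs
  obtain ⟨B2, hB2⟩ := hc2.bounded_above_of_compact_support hs2
  set B := max 0 (max B0 B2) with hB
  have hBn : 0 ≤ B := le_max_left _ _
  have hBG : ∀ x, |G x| ≤ B := fun x => (hB0 x).trans ((le_max_left _ _).trans (le_max_right _ _))
  have hBG2 : ∀ x, |deriv (deriv G) x| ≤ B := fun x =>
    (hB2 x).trans ((le_max_right _ _).trans (le_max_right _ _))
  -- widening the range of the exponents by `δ` keeps it in `(0, 1]`, and leaves the decay of the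
  -- powers of exponent at most `M - 2 + δ` as fast as that of order `-L`
  set δ := min (m / 2) (min ((2 - M - L)) (1 - M)) with hδ
  have hδ0 : 0 < δ := by
    refine lt_min (by linarith) (lt_min (by linarith) (by linarith))
  have hδm : δ ≤ m / 2 := min_le_left _ _
  have hδL : δ ≤ 2 - M - L := (min_le_right _ _).trans (min_le_left _ _)
  have hδM : δ ≤ 1 - M := (min_le_right _ _).trans (min_le_right _ _)
  -- `D` dominates the constants in the estimates of the powers and of their increments in the
  -- exponent, which stem from `abs_rpow_sub_rpow_le`
  set D := 1 + 8 / δ with hD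
  have hD0 : 0 < D := by positivity
  set C := D * (2 * R + 1) * B * (2 * R) * (R + 2) ^ L with hC
  have hC0 : 0 ≤ C := by positivity
  have hP : ∀ κ ∈ Icc m M, |κ * (κ - 1)| ≤ 1 := fun κ hκ => by
    rw [abs_le]; constructor <;> nlinarith [hκ.1, hκ.2]
  have hP' : ∀ κ ∈ Icc m M, ∀ κ' ∈ Icc m M,
      |κ * (κ - 1) - κ' * (κ' - 1)| ≤ |κ - κ'| := fun κ hκ κ' hκ' => by
    rw [show κ * (κ - 1) - κ' * (κ' - 1) = (κ + κ' - 1) * (κ - κ') by ring, abs_mul]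
    refine mul_le_of_le_one_left (abs_nonneg _) ?_
    rw [abs_le]; constructor <;> linarith [hκ.1, hκ.2, hκ'.1, hκ'.2]
  refine ⟨C, hC0, fun κ hκ κ' hκ' x => ?_⟩
  have hκ0 : 0 < κ := hm.trans_le hκ.1
  have hκ0' : 0 < κ' := hm.trans_le hκ'.1
  have h8 : 0 ≤ 8 / δ := by positivity
  have hxL : 0 < (1 + |x|) ^ (-L) := by positivity
  rcases le_or_gt x (-R) with hx | hx
  -- to the left of the support
  · have hz : ∀ κ, fracPrimitive (deriv (deriv G)) κ x = 0 := by
      intro κ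
      refine integral_eq_zero_of_ae (Eventually.of_forall fun s => ?_)
      by_cases hs : R ≤ |s|
      · simp [h2 s hs]
      · have := (abs_lt.1 (not_le.1 hs)).1
        simp [truncPow, show ¬ s < x by linarith]
    rw [hz, hz, sub_zero, abs_zero]
    exact ⟨by positivity, by positivity⟩
  rcases le_or_gt x (R + 1) with hx' | hx'
  -- near the support
  · have hxR : (1 : ℝ) ≤ (R + 2) ^ L * (1 + |x|) ^ (-L) := by
      rw [Real.rpow_neg (by positivity), ← div_eq_mul_inv, one_le_div (by positivity)]
      refine Real.rpow_le_rpow (by positivity) ?_ hL0.le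
      have : |x| ≤ R + 1 := abs_le.2 ⟨by linarith, hx'⟩
      linarith
    have hmaxle : ∀ s ∈ Ioc (-R) R, ∀ p : ℝ, 0 ≤ p → p ≤ 1 → 0 < x - s →
        (x - s) ^ p ≤ 2 * R + 1 := by
      intro s hs p hp0 hp1 hpos
      calc (x - s) ^ p ≤ (2 * R + 1) ^ p :=
            Real.rpow_le_rpow hpos.le (by linarith [hs.1]) hp0
        _ ≤ (2 * R + 1) ^ (1 : ℝ) := Real.rpow_le_rpow_of_exponent_le (by linarith) hp1
        _ = _ := Real.rpow_one _
    have hle : -R ≤ R := by linarith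
    have habs2R : |R - -R| = 2 * R := by rw [abs_of_nonneg (by linarith)]; ring
    constructor
    · rw [fracPrimitive, integral_eq_interval (R := R) (fun s hs => by rw [h2 s hs, mul_zero])]
      have hb := intervalIntegral.norm_integral_le_of_norm_le_const (a := -R) (b := R)
        (f := fun s => truncPow (x - s) κ * deriv (deriv G) s) (C := (2 * R + 1) * B)
        (fun s hs => by
          rw [uIoc_of_le hle] at hs
          rw [norm_mul]
          refine mul_le_mul ?_ (hBG2 s) (norm_nonneg _) (by positivity)
          rw [Real.norm_eq_abs, abs_of_nonneg (truncPow_nonneg _ _), truncPow]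
          split_ifs with hpos
          · exact hmaxle s hs κ hκ0.le (by linarith [hκ.2]) hpos
          · linarith)
      rw [habs2R, Real.norm_eq_abs] at hb
      refine hb.trans ?_
      calc (2 * R + 1) * B * (2 * R) ≤ 1 * ((2 * R + 1) * B * (2 * R)) *
            ((R + 2) ^ L * (1 + |x|) ^ (-L)) := by
              rw [one_mul]
              exact le_mul_of_one_le_right (by positivity) hxR
        _ ≤ D * ((2 * R + 1) * B * (2 * R)) * ((R + 2) ^ L * (1 + |x|) ^ (-L)) := by
              gcongr
              linarith
        _ = _ := by rw [hC]; ring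
    · rw [fracPrimitive_sub_eq hc2 hs2 hκ0 hκ0',
        integral_eq_interval (R := R) (fun s hs => by rw [h2 s hs, mul_zero])]
      have hb := intervalIntegral.norm_integral_le_of_norm_le_const (a := -R) (b := R)
        (f := fun s => (truncPow (x - s) κ - truncPow (x - s) κ') * deriv (deriv G) s)
        (C := 8 / δ * |κ - κ'| * (2 * R + 1) * B)
        (fun s hs => by
          rw [uIoc_of_le hle] at hs
          rw [norm_mul]
          refine mul_le_mul ?_ (hBG2 s) (norm_nonneg _) (by positivity)
          rw [Real.norm_eq_abs, truncPow, truncPow]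
          split_ifs with hpos
          · refine (abs_rpow_sub_rpow_le hpos hδ0 hκ hκ').trans ?_
            have hl1 := hmaxle s hs (m - δ) (by linarith)
              (by linarith [hκ.1, hκ.2]) hpos
            have hl2 := hmaxle s hs (M + δ) (by linarith [hκ.1, hκ.2]) (by linarith) hpos
            calc _ ≤ 4 / δ * |κ - κ'| * ((2 * R + 1) + (2 * R + 1)) := by gcongr
              _ = _ := by ring
          · rw [sub_zero, abs_zero]; positivity)
      rw [habs2R, Real.norm_eq_abs] at hb
      refine hb.trans ?_
      calc 8 / δ * |κ - κ'| * (2 * R + 1) * B * (2 * R)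
          ≤ 8 / δ * |κ - κ'| * (2 * R + 1) * B * (2 * R) *
            ((R + 2) ^ L * (1 + |x|) ^ (-L)) := le_mul_of_one_le_right (by positivity) hxR
        _ ≤ D * |κ - κ'| * (2 * R + 1) * B * (2 * R) * ((R + 2) ^ L * (1 + |x|) ^ (-L)) := by
              gcongr
              linarith
        _ = _ := by rw [hC]; ring
  -- far to the right of the support, where two integrations by parts give the decay
  · have hRx : R < x := by linarith
    have hle : -R ≤ R := by linarith
    have habs2R : |R - -R| = 2 * R := by rw [abs_of_nonneg (by linarith)]; ring
    have hx0 : |x| = x := abs_of_pos (by linarith)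
    have hpw : ∀ s ∈ Ioc (-R) R, (x - s) ^ (-L) ≤ (R + 2) ^ L * (1 + |x|) ^ (-L) := by
      intro s hs
      have h3 : (1 + x) / (R + 2) ≤ x - s := by
        rw [div_le_iff₀ (by linarith)]
        nlinarith [hs.2, mul_le_mul_of_nonneg_left hx'.le hR.le]
      rw [hx0]
      calc (x - s) ^ (-L) ≤ ((1 + x) / (R + 2)) ^ (-L) :=
            Real.rpow_le_rpow_of_nonpos (div_pos (by linarith) (by linarith)) h3 (by linarith)
        _ = _ := by
          rw [Real.div_rpow (by linarith) (by linarith), Real.rpow_neg (by linarith : 0 ≤ R + 2),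
            div_inv_eq_mul, mul_comm]
    have hge1 : ∀ s ∈ Ioc (-R) R, 1 ≤ x - s := fun s hs => by linarith [hs.2]
    have hexp : ∀ s ∈ Ioc (-R) R, ∀ p : ℝ, p ≤ -L → (x - s) ^ p ≤ (x - s) ^ (-L) :=
      fun s hs p hp => Real.rpow_le_rpow_of_exponent_le (hge1 s hs) hp
    rw [fracPrimitive_deriv_deriv hG hR h0 h1 h2 κ hRx,
      fracPrimitive_deriv_deriv hG hR h0 h1 h2 κ' hRx]
    constructor
    · have hb := intervalIntegral.norm_integral_le_of_norm_le_const (a := -R) (b := R)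
        (f := fun s => (κ * (κ - 1)) * (x - s) ^ (κ - 2) * G s)
        (C := ((R + 2) ^ L * (1 + |x|) ^ (-L)) * B)
        (fun s hs => by
          rw [uIoc_of_le hle] at hs
          rw [norm_mul]
          refine mul_le_mul ?_ (hBG s) (norm_nonneg _) (by positivity)
          have hpos := hge1 s hs
          rw [norm_mul, Real.norm_eq_abs, Real.norm_eq_abs,
            abs_of_nonneg (Real.rpow_nonneg (by linarith) _)]
          calc _ ≤ 1 * (x - s) ^ (-L) :=
                mul_le_mul (hP κ hκ) (hexp s hs _ (by linarith [hκ.2]))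
                  (Real.rpow_nonneg (by linarith) _) zero_le_one
            _ ≤ _ := by rw [one_mul]; exact hpw s hs)
      rw [habs2R, Real.norm_eq_abs] at hb
      refine hb.trans ?_
      calc (R + 2) ^ L * (1 + |x|) ^ (-L) * B * (2 * R) =
            1 * 1 * (B * (2 * R) * (R + 2) ^ L) * (1 + |x|) ^ (-L) := by ring
        _ ≤ D * (2 * R + 1) * (B * (2 * R) * (R + 2) ^ L) * (1 + |x|) ^ (-L) := by
              gcongr <;> linarith
        _ = _ := by rw [hC]; ring
    · have hcontI : ∀ κ : ℝ, IntervalIntegrable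
          (fun s => (κ * (κ - 1)) * (x - s) ^ (κ - 2) * G s) volume (-R) R := by
        intro κ
        refine ContinuousOn.intervalIntegrable ?_
        refine (continuousOn_const.mul ?_).mul hG.continuous.continuousOn
        refine (continuousOn_const.sub continuousOn_id).rpow_const fun s hs => Or.inl ?_
        rw [uIcc_of_le hle] at hs
        change x - s ≠ 0
        linarith [hs.2]
      rw [← intervalIntegral.integral_sub (hcontI κ) (hcontI κ')]
      have hb := intervalIntegral.norm_integral_le_of_norm_le_const (a := -R) (b := R)
        (f := fun s => (κ * (κ - 1)) * (x - s) ^ (κ - 2) * G s -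
          (κ' * (κ' - 1)) * (x - s) ^ (κ' - 2) * G s)
        (C := D * |κ - κ'| * ((R + 2) ^ L * (1 + |x|) ^ (-L)) * B)
        (fun s hs => by
          rw [uIoc_of_le hle] at hs
          rw [← sub_mul, norm_mul]
          refine mul_le_mul ?_ (hBG s) (norm_nonneg _) (by positivity)
          have hpos := hge1 s hs
          have hpos' : 0 < x - s := by linarith
          have e : κ * (κ - 1) * (x - s) ^ (κ - 2) - κ' * (κ' - 1) * (x - s) ^ (κ' - 2) =
            (κ * (κ - 1) - κ' * (κ' - 1)) * (x - s) ^ (κ - 2) +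
            (κ' * (κ' - 1)) * ((x - s) ^ (κ - 2) - (x - s) ^ (κ' - 2)) := by ring
          have hd := abs_rpow_sub_rpow_le (p := κ - 2) (q := κ' - 2) (m := m - 2) (M := M - 2)
            hpos' hδ0 ⟨by linarith [hκ.1], by linarith [hκ.2]⟩
            ⟨by linarith [hκ'.1], by linarith [hκ'.2]⟩
          rw [show κ - 2 - (κ' - 2) = κ - κ' by ring] at hd
          rw [e, Real.norm_eq_abs]
          refine (abs_add_le _ _).trans ?_
          rw [abs_mul, abs_mul, abs_of_nonneg (Real.rpow_nonneg hpos'.le (κ - 2))]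
          calc _ ≤ |κ - κ'| * (x - s) ^ (-L) +
                1 * (4 / δ * |κ - κ'| * ((x - s) ^ (-L) + (x - s) ^ (-L))) := by
                refine add_le_add (mul_le_mul (hP' κ hκ κ' hκ')
                  (hexp s hs _ (by linarith [hκ.2])) (Real.rpow_nonneg hpos'.le _)
                  (abs_nonneg _)) (mul_le_mul (hP κ' hκ') (hd.trans ?_) (abs_nonneg _) zero_le_one)
                refine mul_le_mul_of_nonneg_left (add_le_add (hexp s hs _ ?_) (hexp s hs _ ?_))
                  (by positivity)
                · linarith [hκ.2, hκ.1]
                · linarith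
            _ = D * |κ - κ'| * (x - s) ^ (-L) := by rw [hD]; ring
            _ ≤ _ := by gcongr; exact hpw s hs)
      rw [habs2R, Real.norm_eq_abs] at hb
      refine hb.trans ?_
      calc D * |κ - κ'| * ((R + 2) ^ L * (1 + |x|) ^ (-L)) * B * (2 * R) =
            D * 1 * (B * (2 * R) * (R + 2) ^ L) * |κ - κ'| * (1 + |x|) ^ (-L) := by ring
        _ ≤ D * (2 * R + 1) * (B * (2 * R) * (R + 2) ^ L) * |κ - κ'| * (1 + |x|) ^ (-L) := by
              gcongr
              linarith
        _ = _ := by rw [hC]; ring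

end primitive

/-! ### Increments of fractional primitives -/

section increments

/-- A compactly supported function with vanishing integral has a compactly supported primitive. -/
theorem exists_primitive_hasCompactSupport {n : ℕ} {θ : ℝ → ℝ} (hθ : ContDiff ℝ n θ)
    (hs : HasCompactSupport θ) (h0 : ∫ s, θ s = 0) :
    ∃ G : ℝ → ℝ, ContDiff ℝ (n + 1) G ∧ HasCompactSupport G ∧ deriv G = θ := by
  obtain ⟨R, hR, hz⟩ := exists_radius hs
  have hc := hθ.continuous
  have hd : ∀ x, HasDerivAt (fun x => ∫ s in (-R)..x, θ s) (θ x) x := fun x =>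
    intervalIntegral.integral_hasDerivAt_right (hc.intervalIntegrable _ _)
      (hc.stronglyMeasurableAtFilter _ _) hc.continuousAt
  have hderiv : deriv (fun x => ∫ s in (-R)..x, θ s) = θ := funext fun x => (hd x).deriv
  refine ⟨fun x => ∫ s in (-R)..x, θ s, ?_, ?_, hderiv⟩
  · rw [contDiff_succ_iff_deriv, hderiv]
    exact ⟨fun x => (hd x).differentiableAt, by simp, hθ⟩
  · refine HasCompactSupport.of_support_subset_isCompact (isCompact_Icc (a := -R) (b := R))
      fun x hx => ?_
    by_contra hcon
    refine hx ?_
    rw [mem_Icc, not_and_or, not_le, not_le] at hcon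
    rcases hcon with h | h
    · refine intervalIntegral.integral_zero_ae (Eventually.of_forall fun s hs => hz s ?_)
      rw [uIoc_of_ge h.le] at hs
      exact le_abs.2 (Or.inr (by linarith [hs.2]))
    · dsimp only
      rw [intervalIntegral.integral_eq_integral_of_support_subset, h0]
      intro s hs
      by_contra hcon
      refine hs (hz s ?_)
      rw [mem_Ioc, not_and_or, not_lt, not_le] at hcon
      rcases hcon with h' | h'
      · exact le_abs.2 (Or.inr (by linarith))
      · exact le_abs.2 (Or.inl (by linarith))

/-- If the first moment of `G'` vanishes, then so does the integral of `G`. -/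
theorem integral_primitive_eq_zero {G : ℝ → ℝ} (hG : ContDiff ℝ 1 G) (hs : HasCompactSupport G)
    (h1 : ∫ s, s * deriv G s = 0) : ∫ s, G s = 0 := by
  have hc1 : Continuous (deriv G) := hG.continuous_deriv le_rfl
  have h := integral_mul_deriv_eq_deriv_mul_of_integrable (u := fun s : ℝ => s) (v := G)
    (u' := fun _ => 1) (v' := deriv G) (fun s _ => hasDerivAt_id s)
    (fun s _ => (hG.differentiable (by norm_num) s).hasDerivAt)
    ((continuous_id.mul hc1).integrable_of_hasCompactSupport hs.deriv.mul_left)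
    ((continuous_const.mul hG.continuous).integrable_of_hasCompactSupport hs.mul_left)
    ((continuous_id.mul hG.continuous).integrable_of_hasCompactSupport hs.mul_left)
  rw [h1] at h
  simpa using h.symm

/-- A compactly supported continuously differentiable function whose moments of orders `0` and `1`
vanish. These functions play the role of mother wavelets. -/
structure IsMotherFunction (θ : ℝ → ℝ) : Prop where
  contDiff : ContDiff ℝ 1 θ
  hasCompactSupport : HasCompactSupport θ
  integral_eq_zero : ∫ s, θ s = 0
  integral_mul_eq_zero : ∫ s, s * θ s = 0

theorem fracPrimitive_eq_integral_sub (θ : ℝ → ℝ) (κ x : ℝ) :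
    fracPrimitive θ κ x = ∫ t, truncPow t κ * θ (x - t) := by
  have h := integral_sub_left_eq_self (fun t => truncPow t κ * θ (x - t)) volume x
  rw [← h, fracPrimitive]
  congr 1; ext s; simp

theorem hasDerivAt_fracPrimitive {θ : ℝ → ℝ} (hθ : ContDiff ℝ 1 θ) (hs : HasCompactSupport θ)
    {κ : ℝ} (hκ : 0 < κ) (x : ℝ) :
    HasDerivAt (fracPrimitive θ κ) (fracPrimitive (deriv θ) κ x) x := by
  have h := hs.hasDerivAt_convolution_right (ContinuousLinearMap.mul ℝ ℝ) (μ := volume)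
    (f₀ := fun t => truncPow t κ) (continuous_truncPow hκ).locallyIntegrable hθ x
  have e : ∀ g : ℝ → ℝ, fracPrimitive g κ =
      convolution (fun t => truncPow t κ) g (ContinuousLinearMap.mul ℝ ℝ) volume := by
    intro g
    ext y
    rw [fracPrimitive_eq_integral_sub]
    rfl
  rw [e, e]
  exact h

theorem one_add_abs_rpow_neg_le {L : ℝ} (hL : 0 < L) {x z : ℝ} (h : |x - z| ≤ 1) :
    (1 + |z|) ^ (-L) ≤ 2 ^ L * (1 + |x|) ^ (-L) := by
  have h1 : (1 + |x|) / 2 ≤ 1 + |z| := by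
    have := abs_sub_abs_le_abs_sub x z
    linarith [abs_nonneg z]
  calc (1 + |z|) ^ (-L) ≤ ((1 + |x|) / 2) ^ (-L) :=
        Real.rpow_le_rpow_of_nonpos (by positivity) h1 (by linarith)
    _ = _ := by
      rw [Real.div_rpow (by positivity) (by norm_num), Real.rpow_neg (by norm_num : (0:ℝ) ≤ 2),
        div_inv_eq_mul, mul_comm]

/-- The size of the increments, between `x` and `y`, of a function which, together with its
derivative, decays like `|x| ^ (-L)`. -/
def incrementBound (L x y : ℝ) : ℝ :=
  min 1 |x - y| * ((1 + |x|) ^ (-L) + (1 + |y|) ^ (-L))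

theorem incrementBound_nonneg (L x y : ℝ) : 0 ≤ incrementBound L x y := by
  unfold incrementBound; positivity

theorem abs_sub_le_incrementBound {h h' : ℝ → ℝ} {A L : ℝ} (hL : 0 < L) (hA : 0 ≤ A)
    (hd : ∀ x, HasDerivAt h (h' x) x)
    (hb : ∀ x, |h x| ≤ A * (1 + |x|) ^ (-L)) (hb' : ∀ x, |h' x| ≤ A * (1 + |x|) ^ (-L))
    (x y : ℝ) : |h x - h y| ≤ 2 ^ L * A * incrementBound L x y := by
  have h2 : (1 : ℝ) ≤ 2 ^ L := Real.one_le_rpow (by norm_num) hL.le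
  have hx0 : 0 ≤ (1 + |x|) ^ (-L) := by positivity
  have hy0 : 0 ≤ (1 + |y|) ^ (-L) := by positivity
  rcases le_total |x - y| 1 with hxy | hxy
  · have hm := Convex.norm_image_sub_le_of_norm_hasDerivWithin_le (f := h) (f' := h')
      (s := uIcc x y) (x := x) (y := y) (C := 2 ^ L * A * (1 + |x|) ^ (-L))
      (fun z _ => (hd z).hasDerivWithinAt)
      (fun z hz => by
        refine (hb' z).trans ?_
        have hz' : |x - z| ≤ 1 := by
          rw [abs_sub_comm]
          exact (abs_sub_left_of_mem_uIcc hz).trans (by rwa [abs_sub_comm])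
        calc A * (1 + |z|) ^ (-L) ≤ A * (2 ^ L * (1 + |x|) ^ (-L)) :=
              mul_le_mul_of_nonneg_left (one_add_abs_rpow_neg_le hL hz') hA
          _ = _ := by ring)
      (convex_uIcc x y) left_mem_uIcc right_mem_uIcc
    rw [Real.norm_eq_abs, Real.norm_eq_abs, abs_sub_comm, abs_sub_comm y x] at hm
    refine hm.trans ?_
    rw [incrementBound, min_eq_right hxy]
    calc 2 ^ L * A * (1 + |x|) ^ (-L) * |x - y| = 2 ^ L * A * (|x - y| * (1 + |x|) ^ (-L)) := by
          ring
      _ ≤ _ := by gcongr; linarith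
  · rw [incrementBound, min_eq_left hxy, one_mul]
    calc |h x - h y| ≤ |h x| + |h y| := abs_sub _ _
      _ ≤ A * (1 + |x|) ^ (-L) + A * (1 + |y|) ^ (-L) := add_le_add (hb x) (hb y)
      _ = 1 * (A * ((1 + |x|) ^ (-L) + (1 + |y|) ^ (-L))) := by ring
      _ ≤ 2 ^ L * (A * ((1 + |x|) ^ (-L) + (1 + |y|) ^ (-L))) := by gcongr
      _ = _ := by ring

/-- The increments of the fractional primitives of a mother function are small and localized, and
they are Lipschitz continuous in the exponent. -/
theorem IsMotherFunction.exists_increment_bound {θ : ℝ → ℝ} (hθ : IsMotherFunction θ)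
    {m M L : ℝ} (hm : 0 < m) (hM : M < 1) (hL0 : 0 < L) (hL : L < 2 - M) :
    ∃ C : ℝ, 0 ≤ C ∧ ∀ κ ∈ Icc m M, ∀ κ' ∈ Icc m M, ∀ x y : ℝ,
      |fracPrimitive θ κ x - fracPrimitive θ κ y| ≤ C * incrementBound L x y ∧
      |(fracPrimitive θ κ x - fracPrimitive θ κ y) -
        (fracPrimitive θ κ' x - fracPrimitive θ κ' y)| ≤
        C * |κ - κ'| * incrementBound L x y := by
  -- the two vanishing moments allow two primitives with compact support: `θ = G1' = G''`
  obtain ⟨G1, hG1, hs1, hd1⟩ := exists_primitive_hasCompactSupport (n := 1)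
    (by simpa using hθ.contDiff) hθ.hasCompactSupport hθ.integral_eq_zero
  have hG1' : ContDiff ℝ 2 G1 := by simpa [one_add_one_eq_two] using hG1
  obtain ⟨G, hG, hs, hd⟩ := exists_primitive_hasCompactSupport (n := 2)
    (by simpa using hG1') hs1 (integral_primitive_eq_zero (hG1'.of_le (by norm_num)) hs1
      (by rw [hd1]; exact hθ.integral_mul_eq_zero))
  have hG' : ContDiff ℝ 2 G := hG.of_le (by norm_num)
  obtain ⟨C1, hC1, h1⟩ := exists_fracPrimitive_bound hG' hs hm hM hL0 hL
  -- the derivative of the fractional primitive is that of `θ' = G1''`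
  obtain ⟨C2, hC2, h2⟩ := exists_fracPrimitive_bound hG1' hs1 hm hM hL0 hL
  rw [hd, hd1] at h1
  rw [hd1] at h2
  have hCm : 0 ≤ max C1 C2 := hC1.trans (le_max_left _ _)
  refine ⟨2 ^ L * max C1 C2, by positivity, fun κ hκ κ' hκ' x y => ⟨?_, ?_⟩⟩
  · refine abs_sub_le_incrementBound hL0 hCm
      (hasDerivAt_fracPrimitive hθ.contDiff hθ.hasCompactSupport (hm.trans_le hκ.1))
      (fun z => ((h1 κ hκ κ' hκ' z).1).trans ?_) (fun z => ((h2 κ hκ κ' hκ' z).1).trans ?_) x y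
    · gcongr; exact le_max_left _ _
    · gcongr; exact le_max_right _ _
  · have := abs_sub_le_incrementBound (L := L) (A := max C1 C2 * |κ - κ'|) hL0 (by positivity)
      (fun z => (hasDerivAt_fracPrimitive hθ.contDiff hθ.hasCompactSupport
        (hm.trans_le hκ.1) z).sub (hasDerivAt_fracPrimitive hθ.contDiff hθ.hasCompactSupport
        (hm.trans_le hκ'.1) z))
      (fun z => ((h1 κ hκ κ' hκ' z).2).trans ?_) (fun z => ((h2 κ hκ κ' hκ' z).2).trans ?_) x y
    · rw [mul_assoc (2 ^ L)]
      refine le_trans (le_of_eq ?_) this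
      simp only [Pi.sub_apply]
      congr 1; ring
    · gcongr; exact le_max_left _ _
    · gcongr; exact le_max_right _ _

end increments

/-! ### Multiscale sums -/

section sums

/-- The family `f` is summable, with sum at most `B`. -/
def SumLE {ι : Type*} (f : ι → ℝ) (B : ℝ) : Prop := Summable f ∧ ∑' i, f i ≤ B

namespace SumLE

variable {ι κ : Type*} {f g : ι → ℝ} {A B : ℝ}

theorem mono (hg : SumLE g B) (h0 : ∀ i, 0 ≤ f i) (h : ∀ i, f i ≤ g i) : SumLE f B := by
  have hf := Summable.of_nonneg_of_le h0 h hg.1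
  exact ⟨hf, (hf.tsum_le_tsum h hg.1).trans hg.2⟩

theorem le (hf : SumLE f A) (h : A ≤ B) : SumLE f B := ⟨hf.1, hf.2.trans h⟩

theorem add (hf : SumLE f A) (hg : SumLE g B) : SumLE (fun i => f i + g i) (A + B) :=
  ⟨hf.1.add hg.1, by rw [hf.1.tsum_add hg.1]; exact add_le_add hf.2 hg.2⟩

theorem mul_left (hf : SumLE f A) {c : ℝ} (hc : 0 ≤ c) : SumLE (fun i => c * f i) (c * A) :=
  ⟨hf.1.mul_left c, by rw [tsum_mul_left]; exact mul_le_mul_of_nonneg_left hf.2 hc⟩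

theorem prod {f : ι × κ → ℝ} {b : ι → ℝ} (h0 : ∀ p, 0 ≤ f p)
    (hf : ∀ i, SumLE (fun k => f (i, k)) (b i)) (hb : SumLE b B) : SumLE f B := by
  have h1 : SumLE (fun i => ∑' k, f (i, k)) B :=
    hb.mono (fun i => tsum_nonneg fun k => h0 _) fun i => (hf i).2
  have hs : Summable f := (summable_prod_of_nonneg h0).2 ⟨fun i => (hf i).1, h1.1⟩
  exact ⟨hs, by rw [hs.tsum_prod]; exact h1.2⟩

theorem abs_tsum_sub_le (hf : Summable f) (hg : Summable g)
    (h : SumLE (fun i => |f i - g i|) B) : |∑' i, f i - ∑' i, g i| ≤ B := by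
  rw [← hf.tsum_sub hg]
  have h1 : Summable fun i => ‖f i - g i‖ := h.1
  have h2 := norm_tsum_le_tsum_norm h1
  simp only [Real.norm_eq_abs] at h2
  exact h2.trans h.2

end SumLE

theorem exists_sumLE_shift {r : ℝ} (hr : 1 < r) :
    ∃ C : ℝ, 0 ≤ C ∧ ∀ x : ℝ, SumLE (fun k : ℤ => (1 + |x - k|) ^ (-r)) C := by
  have hs := summable_one_add_abs_int_rpow hr
  refine ⟨2 ^ r * ∑' k : ℤ, (1 + |(k : ℝ)|) ^ (-r),
    mul_nonneg (by positivity) (tsum_nonneg fun k => by positivity), fun x => ?_⟩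
  have hsh : SumLE (fun k : ℤ => (1 + |((⌊x⌋ - k : ℤ) : ℝ)|) ^ (-r))
      (∑' k : ℤ, (1 + |(k : ℝ)|) ^ (-r)) :=
    ⟨((Equiv.subLeft ⌊x⌋).summable_iff (f := fun k : ℤ => (1 + |(k : ℝ)|) ^ (-r))).2 hs,
      ((Equiv.subLeft ⌊x⌋).tsum_eq (fun k : ℤ => (1 + |(k : ℝ)|) ^ (-r))).le⟩
  refine (hsh.mul_left (c := 2 ^ r) (by positivity)).mono (fun k => by positivity) fun k => ?_
  refine one_add_abs_rpow_neg_le (by linarith) ?_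
  push_cast
  rw [show (⌊x⌋ : ℝ) - k - (x - k) = -(x - ⌊x⌋) by ring, abs_neg,
    abs_of_nonneg (sub_nonneg.2 (Int.floor_le x))]
  linarith [Int.lt_floor_add_one x]

theorem one_add_abs_le_mul (x y : ℝ) : 1 + |y| ≤ (1 + |x|) * (1 + |x - y|) := by
  have h : |y| ≤ |x| + |x - y| := by
    have := abs_sub x (x - y)
    rwa [sub_sub_cancel] at this
  nlinarith [abs_nonneg x, abs_nonneg (x - y), mul_nonneg (abs_nonneg x) (abs_nonneg (x - y))]

theorem log_two_add_abs_le_mul (x y : ℝ) :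
    Real.log (2 + |y|) ≤ 2 / Real.log 2 * (Real.log (2 + |x|) * Real.log (2 + |x - y|)) := by
  have h2 : (0 : ℝ) < Real.log 2 := Real.log_pos (by norm_num)
  have h : |y| ≤ |x| + |x - y| := by
    have := abs_sub x (x - y)
    rwa [sub_sub_cancel] at this
  have hx : Real.log 2 ≤ Real.log (2 + |x|) :=
    Real.log_le_log (by norm_num) (by linarith [abs_nonneg x])
  have hxy : Real.log 2 ≤ Real.log (2 + |x - y|) :=
    Real.log_le_log (by norm_num) (by linarith [abs_nonneg (x - y)])
  have h3 : Real.log (2 + |y|) ≤ Real.log (2 + |x|) + Real.log (2 + |x - y|) := by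
    rw [← Real.log_mul (by positivity) (by positivity)]
    refine Real.log_le_log (by positivity) ?_
    nlinarith [abs_nonneg x, abs_nonneg (x - y), mul_nonneg (abs_nonneg x) (abs_nonneg (x - y))]
  rw [div_mul_eq_mul_div, le_div_iff₀ h2]
  nlinarith

theorem exists_log_rpow_le {q δ : ℝ} (hq : 0 < q) (hδ : 0 < δ) :
    ∃ C : ℝ, 0 ≤ C ∧ ∀ x : ℝ, Real.log (2 + |x|) ^ q ≤ C * (1 + |x|) ^ δ := by
  refine ⟨(2 ^ (δ / q) / (δ / q)) ^ q, by positivity, fun x => ?_⟩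
  have h1 := Real.log_le_rpow_div (x := 2 + |x|) (ε := δ / q) (by positivity) (by positivity)
  have h2 : (2 + |x|) ^ (δ / q) ≤ 2 ^ (δ / q) * (1 + |x|) ^ (δ / q) := by
    rw [← Real.mul_rpow (by norm_num) (by positivity)]
    exact Real.rpow_le_rpow (by positivity) (by linarith [abs_nonneg x]) (by positivity)
  have h3 : Real.log (2 + |x|) ≤ 2 ^ (δ / q) / (δ / q) * (1 + |x|) ^ (δ / q) :=
    h1.trans (by rw [div_mul_eq_mul_div]; gcongr)
  refine (Real.rpow_le_rpow (log_two_add_abs_pos x).le h3 hq.le).trans_eq ?_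
  rw [Real.mul_rpow (by positivity) (by positivity), ← Real.rpow_mul (by positivity),
    div_mul_cancel₀ _ hq.ne']

/-- Summing weights with polynomial and logarithmic growth against a fast decay around `x`
reproduces the weight at `x`. -/
theorem exists_sumLE_translates {ρ q L : ℝ} (hρ : 0 < ρ) (hq : 0 < q) (hL : 1 + ρ < L) :
    ∃ C : ℝ, 0 ≤ C ∧ ∀ x : ℝ, SumLE (fun k : ℤ =>
      (1 + |(k : ℝ)|) ^ ρ * Real.log (2 + |(k : ℝ)|) ^ q * (1 + |x - k|) ^ (-L))
      (C * ((1 + |x|) ^ ρ * Real.log (2 + |x|) ^ q)) := by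
  -- half of the spare exponent absorbs the logarithm, the other half ensures summability
  set δ := (L - 1 - ρ) / 2 with hδ
  have hδ0 : 0 < δ := by rw [hδ]; linarith
  obtain ⟨C1, hC1, h1⟩ := exists_log_rpow_le hq hδ0
  obtain ⟨C2, hC2, h2⟩ := exists_sumLE_shift (r := L - ρ - δ) (by rw [hδ]; linarith)
  have hl2 : (0 : ℝ) < Real.log 2 := Real.log_pos (by norm_num)
  refine ⟨(2 / Real.log 2) ^ q * C1 * C2, by positivity, fun x => ?_⟩
  have hlx := log_two_add_abs_pos x
  refine SumLE.le ((h2 x).mul_left (c := (2 / Real.log 2) ^ q * C1 *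
    ((1 + |x|) ^ ρ * Real.log (2 + |x|) ^ q)) (by positivity)
    |>.mono (fun k => ?_) fun k => ?_) (le_of_eq (by ring))
  · have := log_two_add_abs_pos (k : ℝ)
    positivity
  · have hlk := log_two_add_abs_pos (k : ℝ)
    have hlxk := log_two_add_abs_pos (x - k)
    have e1 : (1 + |(k : ℝ)|) ^ ρ ≤ (1 + |x|) ^ ρ * (1 + |x - k|) ^ ρ := by
      rw [← Real.mul_rpow (by positivity) (by positivity)]
      exact Real.rpow_le_rpow (by positivity) (one_add_abs_le_mul x k) hρ.le
    have e2 : Real.log (2 + |(k : ℝ)|) ^ q ≤ (2 / Real.log 2) ^ q *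
        (Real.log (2 + |x|) ^ q * (C1 * (1 + |x - k|) ^ δ)) := by
      refine (Real.rpow_le_rpow hlk.le (log_two_add_abs_le_mul x k) hq.le).trans ?_
      rw [Real.mul_rpow (by positivity) (by positivity), Real.mul_rpow hlx.le hlxk.le]
      gcongr
      exact h1 _
    calc _ ≤ ((1 + |x|) ^ ρ * (1 + |x - k|) ^ ρ) * ((2 / Real.log 2) ^ q *
        (Real.log (2 + |x|) ^ q * (C1 * (1 + |x - k|) ^ δ))) * (1 + |x - k|) ^ (-L) := by
          gcongr
      _ = (2 / Real.log 2) ^ q * C1 * ((1 + |x|) ^ ρ * Real.log (2 + |x|) ^ q) *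
          ((1 + |x - k|) ^ ρ * (1 + |x - k|) ^ δ * (1 + |x - k|) ^ (-L)) := by ring
      _ = _ := by
        rw [← Real.rpow_add (by positivity), ← Real.rpow_add (by positivity)]
        congr 2; ring

theorem exists_scale_le {ρ q M : ℝ} (hρ : 0 < ρ) (hq : 0 < q) (hM : 0 ≤ M) :
    ∃ C : ℝ, 0 ≤ C ∧ ∀ j : ℤ, ∀ u : ℝ, |u| ≤ M →
      (1 + |(2 : ℝ) ^ j * u|) ^ ρ * Real.log (2 + |(2 : ℝ) ^ j * u|) ^ q ≤
        C * ((1 + |(j : ℝ)|) ^ q * max 1 ((2 : ℝ) ^ j) ^ ρ) := by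
  have hl2 : (0 : ℝ) < Real.log 2 := Real.log_pos (by norm_num)
  have hlM : 0 < Real.log (2 + M) := Real.log_pos (by linarith)
  refine ⟨(1 + M) ^ ρ * (Real.log (2 + M) + 1) ^ q, by positivity, fun j u hu => ?_⟩
  have hj : (0 : ℝ) < 2 ^ j := by positivity
  have habs : |(2 : ℝ) ^ j * u| ≤ 2 ^ j * M := by
    rw [abs_mul, abs_of_pos hj]
    gcongr
  have e1 : 1 + |(2 : ℝ) ^ j * u| ≤ (1 + M) * max 1 ((2 : ℝ) ^ j) := by
    have h1 := le_max_left 1 ((2 : ℝ) ^ j)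
    have h2 := le_max_right 1 ((2 : ℝ) ^ j)
    nlinarith
  have e2 : Real.log (2 + |(2 : ℝ) ^ j * u|) ≤ (Real.log (2 + M) + 1) * (1 + |(j : ℝ)|) := by
    have h3 : (2 : ℝ) ^ j ≤ 2 ^ |(j : ℝ)| := by
      rw [← Real.rpow_intCast]
      exact Real.rpow_le_rpow_of_exponent_le (by norm_num) (le_abs_self _)
    have h4 : (1 : ℝ) ≤ 2 ^ |(j : ℝ)| := Real.one_le_rpow (by norm_num) (abs_nonneg _)
    have h5 : 2 + |(2 : ℝ) ^ j * u| ≤ (2 + M) * 2 ^ |(j : ℝ)| := by nlinarith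
    have h6 := Real.log_le_log (by positivity) h5
    rw [Real.log_mul (by positivity) (by positivity), Real.log_rpow (by norm_num)] at h6
    have h7 : Real.log 2 ≤ 1 := by linarith [Real.log_two_lt_d9]
    nlinarith [abs_nonneg (j : ℝ), mul_nonneg hlM.le (abs_nonneg (j : ℝ)),
      mul_le_mul_of_nonneg_left h7 (abs_nonneg (j : ℝ))]
  have hl := log_two_add_abs_pos ((2 : ℝ) ^ j * u)
  calc _ ≤ ((1 + M) * max 1 ((2 : ℝ) ^ j)) ^ ρ *
        ((Real.log (2 + M) + 1) * (1 + |(j : ℝ)|)) ^ q := by gcongr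
    _ = _ := by
      rw [Real.mul_rpow (by positivity) (by positivity),
        Real.mul_rpow (by positivity) (by positivity)]
      ring

/-- The weighted sum over the translations, at a fixed scale. -/
theorem exists_sumLE_growthWeight {α η L M : ℝ} (hα : 0 < α) (hη : 0 < η) (hL : 1 + 1 / α < L)
    (hM : 0 ≤ M) :
    ∃ C : ℝ, 0 ≤ C ∧ ∀ j : ℤ, ∀ t s : ℝ, |t| ≤ M → |s| ≤ M →
      SumLE (fun k : ℤ => growthWeight α η j k * incrementBound L ((2 : ℝ) ^ j * t - k)
        ((2 : ℝ) ^ j * s - k))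
        (C * ((1 + |(j : ℝ)|) ^ (2 / α + 2 * η) * max 1 ((2 : ℝ) ^ j) ^ (1 / α) *
          min 1 ((2 : ℝ) ^ j * |t - s|))) := by
  have hq : 0 < 1 / α + η := by positivity
  obtain ⟨C1, hC1, h1⟩ := exists_sumLE_translates (by positivity : 0 < 1 / α) hq hL
  obtain ⟨C2, hC2, h2⟩ := exists_scale_le (by positivity : 0 < 1 / α) hq hM
  refine ⟨2 * C1 * C2, by positivity, fun j t s ht hs => ?_⟩
  have hmin : 0 ≤ min 1 ((2 : ℝ) ^ j * |t - s|) := by positivity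
  have h3 := ((h1 ((2 : ℝ) ^ j * t)).add (h1 ((2 : ℝ) ^ j * s))).mul_left
    (c := (1 + |(j : ℝ)|) ^ (1 / α + η) * min 1 ((2 : ℝ) ^ j * |t - s|)) (by positivity)
  refine SumLE.le (h3.mono (fun k => ?_) fun k => le_of_eq ?_) ?_
  · exact mul_nonneg (growthWeight_pos _ _ _ _).le (incrementBound_nonneg _ _ _)
  · rw [incrementBound, growthWeight, show (2 : ℝ) ^ j * t - k - ((2 : ℝ) ^ j * s - k) =
      (2 : ℝ) ^ j * (t - s) by ring, abs_mul, abs_of_pos (by positivity : (0 : ℝ) < 2 ^ j)]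
    ring
  · have ht' := mul_le_mul_of_nonneg_left (h2 j t ht) hC1
    have hs' := mul_le_mul_of_nonneg_left (h2 j s hs) hC1
    refine (mul_le_mul_of_nonneg_left (add_le_add ht' hs') (by positivity)).trans_eq ?_
    have e : (1 + |(j : ℝ)|) ^ (2 / α + 2 * η) =
        (1 + |(j : ℝ)|) ^ (1 / α + η) * (1 + |(j : ℝ)|) ^ (1 / α + η) := by
      rw [← Real.rpow_add (by positivity)]
      congr 1; ring
    rw [e]
    ring

theorem exists_rpow_mul_exp_le (Q : ℝ) (hQ : 0 ≤ Q) {c : ℝ} (hc : 0 < c) :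
    ∃ C : ℝ, 0 ≤ C ∧ ∀ y : ℝ,
      (1 + |y|) ^ Q * (2 : ℝ) ^ (-(c * |y|)) ≤ C * (1 + |y|) ^ (-(2 : ℝ)) := by
  have hl2 : (0 : ℝ) < Real.log 2 := Real.log_pos (by norm_num)
  set ε := c * Real.log 2 / (Q + 2) with hε
  have hε0 : 0 < ε := by positivity
  set K := max 1 (1 / ε) with hK
  have hK0 : 0 < K := lt_max_of_lt_left one_pos
  refine ⟨K ^ (Q + 2), by positivity, fun y => ?_⟩
  have h1 : 1 + |y| ≤ K * Real.exp (ε * |y|) := by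
    have h2 := Real.add_one_le_exp (ε * |y|)
    have h3 : 1 ≤ K := le_max_left _ _
    have h4 : 1 ≤ K * ε := by
      have := mul_le_mul_of_nonneg_right (le_max_right 1 (1 / ε)) hε0.le
      rwa [one_div_mul_cancel hε0.ne'] at this
    calc 1 + |y| ≤ K * (ε * |y| + 1) := by
          nlinarith [abs_nonneg y, mul_le_mul_of_nonneg_right h4 (abs_nonneg y)]
      _ ≤ _ := by gcongr
  have h5 : (1 + |y|) ^ (Q + 2) ≤ K ^ (Q + 2) * 2 ^ (c * |y|) := by
    refine (Real.rpow_le_rpow (by positivity) h1 (by positivity)).trans_eq ?_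
    rw [Real.mul_rpow hK0.le (Real.exp_pos _).le, ← Real.exp_mul,
      Real.rpow_def_of_pos (by norm_num : (0 : ℝ) < 2)]
    congr 2
    rw [hε]
    field_simp
  have h6 : 0 < (1 + |y|) ^ (2 : ℝ) := by positivity
  rw [Real.rpow_neg (by norm_num), Real.rpow_neg (by positivity), ← div_eq_mul_inv,
    ← div_eq_mul_inv, div_le_div_iff₀ (by positivity) h6, ← Real.rpow_add (by positivity)]
  exact h5

theorem min_one_two_rpow_mul_le {κ c y : ℝ} (h1 : c ≤ κ) (h2 : c ≤ 1 - κ) :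
    (2 : ℝ) ^ (-(y * κ)) * min 1 ((2 : ℝ) ^ y) ≤ (2 : ℝ) ^ (-(c * |y|)) := by
  rcases le_total 0 y with hy | hy
  · calc _ ≤ (2 : ℝ) ^ (-(y * κ)) * 1 := by gcongr; exact min_le_left _ _
      _ ≤ _ := by
        rw [mul_one, abs_of_nonneg hy]
        refine Real.rpow_le_rpow_of_exponent_le (by norm_num) ?_
        nlinarith
  · calc _ ≤ (2 : ℝ) ^ (-(y * κ)) * (2 : ℝ) ^ y := by gcongr; exact min_le_right _ _
      _ ≤ _ := by
        rw [← Real.rpow_add (by norm_num), abs_of_nonpos hy]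
        refine Real.rpow_le_rpow_of_exponent_le (by norm_num) ?_
        nlinarith

/-- The contribution of the scale `j` to the increments, over a distance `δ`, of a wavelet series of
Hurst parameter `v`: the size `2 ^ (-j v)`, the growth of the coefficients at the translations
which matter, and the smoothness of the terms at the scale `j`. -/
def scaleTerm (ρ Q v δ : ℝ) (j : ℤ) : ℝ :=
  (2 : ℝ) ^ (-(j : ℝ) * v) * ((1 + |(j : ℝ)|) ^ Q * max 1 ((2 : ℝ) ^ j) ^ ρ *
    min 1 ((2 : ℝ) ^ j * δ))

theorem scaleTerm_nonneg (ρ Q v : ℝ) {δ : ℝ} (hδ : 0 ≤ δ) (j : ℤ) : 0 ≤ scaleTerm ρ Q v δ j := by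
  unfold scaleTerm; positivity

/-- The sum over the scales. Only the scales `2 ^ (-j)` close to `δ` matter, so that the sum is
governed by `y = j + log₂ δ`. -/
theorem exists_sumLE_scaleTerm {ρ a b Q M : ℝ} (hρ : 0 < ρ) (ha : ρ < a) (hb : b < 1)
    (hQ : 0 ≤ Q) :
    ∃ C : ℝ, 0 ≤ C ∧ ∀ v ∈ Icc a b, ∀ δ : ℝ, 0 < δ → δ ≤ M →
      SumLE (scaleTerm ρ Q v δ) (C * (δ ^ (v - ρ) * (1 + |Real.log δ|) ^ Q)) := by
  have hl2 : (0 : ℝ) < Real.log 2 := Real.log_pos (by norm_num)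
  set c := min (a - ρ) (1 - b) with hc
  have hc0 : 0 < c := lt_min (by linarith) (by linarith)
  have hca : c ≤ a - ρ := min_le_left _ _
  have hcb : c ≤ 1 - b := min_le_right _ _
  obtain ⟨C1, hC1, h1⟩ := exists_rpow_mul_exp_le Q hQ hc0
  obtain ⟨C2, hC2, h2⟩ := exists_sumLE_shift (r := 2) (by norm_num)
  set A := (1 / Real.log 2) ^ Q with hA
  have hA0 : 0 < A := by positivity
  refine ⟨C1 * C2 * (A + max 1 M), by positivity, fun v hv δ hδ hδM => ?_⟩
  -- the logarithm of `δ` to the base `2`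
  set ℓ := Real.log δ / Real.log 2 with hℓ
  have hδℓ : (2 : ℝ) ^ ℓ = δ := by
    rw [Real.rpow_def_of_pos (by norm_num), hℓ, mul_div_cancel₀ _ hl2.ne', Real.exp_log hδ]
  set P := δ ^ (v - ρ) * (1 + |Real.log δ|) ^ Q with hP
  have hP0 : 0 ≤ P := by positivity
  have hlog1 : (1 : ℝ) ≤ (1 + |Real.log δ|) ^ Q :=
    Real.one_le_rpow (by linarith [abs_nonneg (Real.log δ)]) hQ
  have hS := (((h2 (-ℓ)).mul_left (c := A) hA0.le).add
    ((h2 0).mul_left (c := max 1 M) (by positivity))).mul_left (c := P * C1) (by positivity)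
  refine SumLE.le (hS.mono (scaleTerm_nonneg _ _ _ hδ.le) fun j => ?_) (le_of_eq (by ring))
  have hz1 : 0 ≤ (1 + |(-ℓ) - (j : ℝ)|) ^ (-(2 : ℝ)) := by positivity
  have hz2 : 0 ≤ (1 + |(0 : ℝ) - (j : ℝ)|) ^ (-(2 : ℝ)) := by positivity
  rcases le_or_gt 0 j with hj | hj
  -- fine scales
  · have hj' : (0 : ℝ) ≤ j := by exact_mod_cast hj
    set y := (j : ℝ) + ℓ with hy
    have e0 : |(-ℓ) - (j : ℝ)| = |y| := by rw [hy, ← abs_neg]; congr 1; ring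
    have hmax : max 1 ((2 : ℝ) ^ j) = (2 : ℝ) ^ (j : ℝ) := by
      rw [← Real.rpow_intCast]
      exact max_eq_right (Real.one_le_rpow (by norm_num) hj')
    have hmin : (2 : ℝ) ^ j * δ = (2 : ℝ) ^ y := by
      rw [← Real.rpow_intCast, hy, Real.rpow_add (by norm_num), hδℓ]
    have hsc : (2 : ℝ) ^ (-(j : ℝ) * v) * ((2 : ℝ) ^ (j : ℝ)) ^ ρ =
        δ ^ (v - ρ) * (2 : ℝ) ^ (-(y * (v - ρ))) := by
      have hδκ : δ ^ (v - ρ) = (2 : ℝ) ^ (ℓ * (v - ρ)) := by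
        rw [Real.rpow_mul (by norm_num), hδℓ]
      rw [hδκ, ← Real.rpow_mul (by norm_num), ← Real.rpow_add (by norm_num),
        ← Real.rpow_add (by norm_num)]
      congr 1
      rw [hy]; ring
    have hj1 : (1 + |(j : ℝ)|) ^ Q ≤ A * (1 + |Real.log δ|) ^ Q * (1 + |y|) ^ Q := by
      rw [hA, ← Real.mul_rpow (by positivity) (by positivity),
        ← Real.mul_rpow (by positivity) (by positivity)]
      refine Real.rpow_le_rpow (by positivity) ?_ hQ
      have h4 := one_add_abs_le_mul ℓ (-(j : ℝ))
      rw [abs_neg, show ℓ - -(j : ℝ) = y by rw [hy]; ring] at h4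
      refine h4.trans (mul_le_mul_of_nonneg_right ?_ (by positivity))
      rw [hℓ, abs_div, abs_of_pos hl2, div_mul_eq_mul_div, one_mul, le_div_iff₀ hl2, add_mul,
        div_mul_cancel₀ _ hl2.ne']
      linarith [Real.log_two_lt_d9]
    rw [e0]
    have hmm := min_one_two_rpow_mul_le (κ := v - ρ) (c := c) (y := y) (by linarith [hv.1])
      (by linarith [hv.2])
    rw [scaleTerm, hmax, hmin]
    calc _ = ((2 : ℝ) ^ (-(j : ℝ) * v) * ((2 : ℝ) ^ (j : ℝ)) ^ ρ) * (1 + |(j : ℝ)|) ^ Q *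
          min 1 ((2 : ℝ) ^ y) := by ring
      _ = δ ^ (v - ρ) * (1 + |(j : ℝ)|) ^ Q *
          ((2 : ℝ) ^ (-(y * (v - ρ))) * min 1 ((2 : ℝ) ^ y)) := by rw [hsc]; ring
      _ ≤ δ ^ (v - ρ) * (A * (1 + |Real.log δ|) ^ Q * (1 + |y|) ^ Q) *
          (2 : ℝ) ^ (-(c * |y|)) := by gcongr
      _ = P * A * ((1 + |y|) ^ Q * (2 : ℝ) ^ (-(c * |y|))) := by rw [hP]; ring
      _ ≤ P * A * (C1 * (1 + |y|) ^ (-(2 : ℝ))) :=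
          mul_le_mul_of_nonneg_left (h1 y) (by positivity)
      _ = P * C1 * (A * (1 + |y|) ^ (-(2 : ℝ)) + 0) := by ring
      _ ≤ _ := by
        rw [e0] at hz1
        gcongr
        positivity
  -- coarse scales, where the increments are at most `2 ^ j * δ`
  · have hj' : (j : ℝ) < 0 := by exact_mod_cast hj
    have hmax : max 1 ((2 : ℝ) ^ j) = 1 := by
      rw [← Real.rpow_intCast]
      exact max_eq_left (Real.rpow_le_one_of_one_le_of_nonpos (by norm_num) hj'.le)
    have e0 : |(0 : ℝ) - (j : ℝ)| = |(j : ℝ)| := by rw [zero_sub, abs_neg]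
    have hδP : δ ≤ max 1 M * P := by
      have h5 : δ = δ ^ (v - ρ) * δ ^ (1 - (v - ρ)) := by
        rw [← Real.rpow_add hδ]; ring_nf; rw [Real.rpow_one]
      have h6 : δ ^ (1 - (v - ρ)) ≤ max 1 M := by
        calc δ ^ (1 - (v - ρ)) ≤ max 1 M ^ (1 - (v - ρ)) :=
              Real.rpow_le_rpow hδ.le (hδM.trans (le_max_right _ _)) (by linarith [hv.2])
          _ ≤ max 1 M ^ (1 : ℝ) :=
              Real.rpow_le_rpow_of_exponent_le (le_max_left _ _) (by linarith [hv.1])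
          _ = _ := Real.rpow_one _
      calc δ = δ ^ (1 - (v - ρ)) * (δ ^ (v - ρ) * 1) := by rw [mul_one, mul_comm]; exact h5
        _ ≤ max 1 M * (δ ^ (v - ρ) * (1 + |Real.log δ|) ^ Q) := by gcongr
    have hexp : (2 : ℝ) ^ (-(j : ℝ) * v) * (2 : ℝ) ^ j ≤ (2 : ℝ) ^ (-(c * |(j : ℝ)|)) := by
      rw [← Real.rpow_intCast, ← Real.rpow_add (by norm_num), abs_of_neg hj']
      refine Real.rpow_le_rpow_of_exponent_le (by norm_num) ?_
      nlinarith [hv.2]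
    rw [e0, scaleTerm, hmax, Real.one_rpow, mul_one]
    calc _ ≤ (2 : ℝ) ^ (-(j : ℝ) * v) * ((1 + |(j : ℝ)|) ^ Q * ((2 : ℝ) ^ j * δ)) := by
          gcongr
          exact min_le_right _ _
      _ = δ * (1 + |(j : ℝ)|) ^ Q * ((2 : ℝ) ^ (-(j : ℝ) * v) * (2 : ℝ) ^ j) := by ring
      _ ≤ (max 1 M * P) * (1 + |(j : ℝ)|) ^ Q * (2 : ℝ) ^ (-(c * |(j : ℝ)|)) := by gcongr
      _ = max 1 M * P * ((1 + |(j : ℝ)|) ^ Q * (2 : ℝ) ^ (-(c * |(j : ℝ)|))) := by ring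
      _ ≤ max 1 M * P * (C1 * (1 + |(j : ℝ)|) ^ (-(2 : ℝ))) :=
          mul_le_mul_of_nonneg_left (h1 j) (by positivity)
      _ = P * C1 * (0 + max 1 M * (1 + |(j : ℝ)|) ^ (-(2 : ℝ))) := by ring
      _ ≤ _ := by gcongr; positivity

theorem exists_sumLE_scaleTerm_const {ρ a b Q M : ℝ} (hρ : 0 < ρ) (ha : ρ < a) (hb : b < 1)
    (hQ : 0 ≤ Q) (hM : 0 < M) :
    ∃ C : ℝ, 0 ≤ C ∧ ∀ v ∈ Icc a b, ∀ δ : ℝ, 0 ≤ δ → δ ≤ M → SumLE (scaleTerm ρ Q v δ) C := by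
  obtain ⟨C, hC, h⟩ := exists_sumLE_scaleTerm (M := M) hρ ha hb hQ
  refine ⟨C * (max 1 M * (1 + |Real.log M|) ^ Q), by positivity, fun v hv δ hδ hδM => ?_⟩
  refine SumLE.le ((h v hv M hM le_rfl).mono (scaleTerm_nonneg _ _ _ hδ) fun j => ?_) ?_
  · unfold scaleTerm
    gcongr
  · gcongr
    calc M ^ (v - ρ) ≤ max 1 M ^ (v - ρ) :=
          Real.rpow_le_rpow hM.le (le_max_right _ _) (by linarith [hv.1])
      _ ≤ max 1 M ^ (1 : ℝ) :=
          Real.rpow_le_rpow_of_exponent_le (le_max_left _ _) (by linarith [hv.2])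
      _ = _ := Real.rpow_one _

end sums

/-! ### Regularity of the random wavelet field -/

section field

variable {Ω : Type*} {α : ℝ} {θ : ℝ → ℝ} {ε : ℤ → ℤ → Ω → ℝ} {ω : Ω}

theorem waveletTerm_zero (v : ℝ) (p : ℤ × ℤ) : waveletTerm α θ ε 0 v ω p = 0 := by
  simp [waveletTerm]

/-- The sum over all scales and translations of the weighted increments is controlled by the sum
over the scales. -/
theorem exists_sumLE_double {η L M : ℝ} (hα : 0 < α) (hη : 0 < η) (hL : 1 + 1 / α < L)
    (hM : 0 ≤ M) :
    ∃ C : ℝ, 0 ≤ C ∧ ∀ (v r B t s : ℝ), |t| ≤ M → |s| ≤ M →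
      SumLE (scaleTerm (1 / α) (2 / α + 2 * η + r) v |t - s|) B →
      SumLE (fun p : ℤ × ℤ => (2 : ℝ) ^ (-(p.1 : ℝ) * v) * (1 + |(p.1 : ℝ)|) ^ r *
        (growthWeight α η p.1 p.2 * incrementBound L ((2 : ℝ) ^ p.1 * t - p.2)
          ((2 : ℝ) ^ p.1 * s - p.2))) (C * B) := by
  obtain ⟨C, hC, h⟩ := exists_sumLE_growthWeight hα hη hL hM
  refine ⟨C, hC, fun v r B t s ht hs hB => ?_⟩
  refine SumLE.prod (b := fun j => C * scaleTerm (1 / α) (2 / α + 2 * η + r) v |t - s| j)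
    (fun p => ?_) (fun j => ?_) (hB.mul_left hC)
  · exact mul_nonneg (by positivity)
      (mul_nonneg (growthWeight_pos _ _ _ _).le (incrementBound_nonneg _ _ _))
  · refine ((h j t s ht hs).mul_left
      (c := (2 : ℝ) ^ (-(j : ℝ) * v) * (1 + |(j : ℝ)|) ^ r) (by positivity)).le (le_of_eq ?_)
    rw [scaleTerm, Real.rpow_add (by positivity : 0 < 1 + |(j : ℝ)|) _ r]
    ring

/-- The growth condition on the coefficients, at a fixed `ω`. -/
def HasGrowth (α η : ℝ) (ε : ℤ → ℤ → Ω → ℝ) (ω : Ω) : Prop :=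
  ∃ C : ℝ, ∀ j k : ℤ, |ε j k ω| ≤ C * growthWeight α η j k

theorem HasGrowth.exists_nonneg {η : ℝ} (h : HasGrowth α η ε ω) :
    ∃ C : ℝ, 0 ≤ C ∧ ∀ j k : ℤ, |ε j k ω| ≤ C * growthWeight α η j k := by
  obtain ⟨C, hC⟩ := h
  exact ⟨C, nonneg_of_mul_nonneg_left ((abs_nonneg _).trans (hC 0 0)) (growthWeight_pos α η 0 0),
    hC⟩

theorem IsGoodEvent.hasGrowth [MeasurableSpace Ω] {μ : Measure Ω} {Ω₀ : Set Ω}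
    (h : IsGoodEvent μ α ε Ω₀) (hω : ω ∈ Ω₀) {η : ℝ} (hη : 0 < η) : HasGrowth α η ε ω := by
  obtain ⟨C, hC⟩ := h.growth ω hω η hη
  refine ⟨C, fun j k => (hC j k).trans_eq ?_⟩
  rw [growthWeight]; ring

/-- The increments in the space variable, for a fixed Hurst parameter. -/
theorem exists_sumLE_increment_space (hθ : IsMotherFunction θ) (hα : 0 < α) {η : ℝ} (hη : 0 < η)
    (hε : HasGrowth α η ε ω) {a b M : ℝ} (ha : 1 / α < a) (hb : b < 1) (hM : 0 ≤ M) :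
    ∃ C : ℝ, 0 ≤ C ∧ ∀ v ∈ Icc a b, ∀ t s : ℝ, |t| ≤ M → |s| ≤ M → t ≠ s →
      SumLE (fun p => |waveletTerm α θ ε t v ω p - waveletTerm α θ ε s v ω p|)
        (C * (|t - s| ^ (v - 1 / α) * (1 + |Real.log (|t - s|)|) ^ (2 / α + 2 * η))) := by
  have hρ : 0 < 1 / α := by positivity
  obtain ⟨Cε, hCε, hε⟩ := hε.exists_nonneg
  -- the decay must exceed `1 + 1 / α` to sum over the translations, and `2 - (b - 1 / α)` is its
  -- upper limit
  obtain ⟨C1, hC1, h1⟩ := hθ.exists_increment_bound (m := a - 1 / α) (M := b - 1 / α)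
    (L := 1 + 1 / α + (1 - b) / 2) (by linarith) (by linarith) (by linarith) (by linarith)
  obtain ⟨C2, hC2, h2⟩ := exists_sumLE_double (L := 1 + 1 / α + (1 - b) / 2) hα hη (by linarith) hM
  obtain ⟨C3, hC3, h3⟩ := exists_sumLE_scaleTerm (M := 2 * M) (Q := 2 / α + 2 * η + 0) hρ ha hb
    (by positivity)
  refine ⟨Cε * C1 * (C2 * C3), by positivity, fun v hv t s ht hs hts => ?_⟩
  have hδ : 0 < |t - s| := abs_pos.2 (sub_ne_zero.2 hts)
  have hδM : |t - s| ≤ 2 * M := (abs_sub _ _).trans (by linarith)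
  have hκ : v - 1 / α ∈ Icc (a - 1 / α) (b - 1 / α) := ⟨by linarith [hv.1], by linarith [hv.2]⟩
  have h4 := (h2 v 0 _ t s ht hs (h3 v hv _ hδ hδM)).mul_left (c := Cε * C1) (by positivity)
  rw [add_zero] at h4
  refine SumLE.le (h4.mono (fun p => abs_nonneg _) fun p => ?_) (le_of_eq (by ring))
  have e : waveletTerm α θ ε t v ω p - waveletTerm α θ ε s v ω p =
      (2 : ℝ) ^ (-(p.1 : ℝ) * v) * (ε p.1 p.2 ω *
        (fracPrimitive θ (v - 1 / α) ((2 : ℝ) ^ p.1 * t - p.2) -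
          fracPrimitive θ (v - 1 / α) ((2 : ℝ) ^ p.1 * s - p.2))) := by
    simp only [waveletTerm, waveletPrimitive_eq]
    ring
  rw [e, abs_mul, abs_mul, abs_of_pos (by positivity : (0 : ℝ) < 2 ^ (-(p.1 : ℝ) * v)),
    Real.rpow_zero, mul_one]
  have h5 := (h1 _ hκ _ hκ ((2 : ℝ) ^ p.1 * t - p.2) ((2 : ℝ) ^ p.1 * s - p.2)).1
  have hw := (growthWeight_pos α η p.1 p.2).le
  calc _ ≤ (2 : ℝ) ^ (-(p.1 : ℝ) * v) * ((Cε * growthWeight α η p.1 p.2) *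
        (C1 * incrementBound (1 + 1 / α + (1 - b) / 2) ((2 : ℝ) ^ p.1 * t - p.2)
          ((2 : ℝ) ^ p.1 * s - p.2))) := by
        gcongr
        exact hε _ _
    _ = _ := by ring

/-- The increments in the Hurst parameter. The derivative in `v` costs a factor `j` at the scale
`2 ^ (-j)`, which the geometric decay in the scales absorbs. -/
theorem exists_sumLE_increment_hurst (hθ : IsMotherFunction θ) (hα : 0 < α) {η : ℝ} (hη : 0 < η)
    (hε : HasGrowth α η ε ω) {a b M : ℝ} (ha : 1 / α < a) (hb : b < 1) (hM : 0 < M) :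
    ∃ C : ℝ, 0 ≤ C ∧ ∀ v ∈ Icc a b, ∀ v' ∈ Icc a b, ∀ u : ℝ, |u| ≤ M →
      SumLE (fun p => |waveletTerm α θ ε u v ω p - waveletTerm α θ ε u v' ω p|)
        (C * |v - v'|) := by
  have hρ : 0 < 1 / α := by positivity
  obtain ⟨Cε, hCε, hε⟩ := hε.exists_nonneg
  obtain ⟨C1, hC1, h1⟩ := hθ.exists_increment_bound (m := a - 1 / α) (M := b - 1 / α)
    (L := 1 + 1 / α + (1 - b) / 2) (by linarith) (by linarith) (by linarith) (by linarith)
  obtain ⟨C2, hC2, h2⟩ := exists_sumLE_double (L := 1 + 1 / α + (1 - b) / 2) hα hη (by linarith)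
    hM.le
  obtain ⟨C3, hC3, h3⟩ := exists_sumLE_scaleTerm_const (Q := 2 / α + 2 * η + 1) hρ ha hb
    (by positivity) hM
  refine ⟨Cε * C1 * (C2 * C3 + C2 * C3), by positivity, fun v hv v' hv' u hu => ?_⟩
  have hκ : v - 1 / α ∈ Icc (a - 1 / α) (b - 1 / α) := ⟨by linarith [hv.1], by linarith [hv.2]⟩
  have hκ' : v' - 1 / α ∈ Icc (a - 1 / α) (b - 1 / α) :=
    ⟨by linarith [hv'.1], by linarith [hv'.2]⟩
  -- each term is itself an increment, between `u` and `0`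
  have h0 : |(0 : ℝ)| ≤ M := by simpa using hM.le
  have hu0 : |u - 0| ≤ M := by simpa using hu
  have h4 := ((h2 v 1 _ u 0 hu h0 (h3 v hv _ (abs_nonneg _) hu0)).add
    (h2 v' 1 _ u 0 hu h0 (h3 v' hv' _ (abs_nonneg _) hu0))).mul_left
    (c := Cε * C1 * |v - v'|) (by positivity)
  refine SumLE.le (h4.mono (fun p => abs_nonneg _) fun p => ?_) (le_of_eq (by ring))
  set j := p.1 with hj
  set x := (2 : ℝ) ^ j * u - p.2 with hx
  set y := (2 : ℝ) ^ j * 0 - p.2 with hy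
  set I := incrementBound (1 + 1 / α + (1 - b) / 2) x y with hI
  have hI0 : 0 ≤ I := incrementBound_nonneg _ _ _
  have hw := (growthWeight_pos α η j p.2).le
  set D := fracPrimitive θ (v - 1 / α) x - fracPrimitive θ (v - 1 / α) y with hD
  set D' := fracPrimitive θ (v' - 1 / α) x - fracPrimitive θ (v' - 1 / α) y with hD'
  have hDb : |D| ≤ C1 * I := (h1 _ hκ _ hκ x y).1
  have hDD : |D - D'| ≤ C1 * |v - v'| * I := by
    have := (h1 _ hκ _ hκ' x y).2
    rwa [show v - 1 / α - (v' - 1 / α) = v - v' by ring] at this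
  set E := (2 : ℝ) ^ (-(j : ℝ) * v) with hE
  set E' := (2 : ℝ) ^ (-(j : ℝ) * v') with hE'
  have hE0 : 0 < E := by positivity
  have hE0' : 0 < E' := by positivity
  have hEE : |E - E'| ≤ |j| * |v - v'| * (E + E') := by
    have h5 := abs_exp_sub_exp_le (Real.log 2 * (-(j : ℝ) * v)) (Real.log 2 * (-(j : ℝ) * v'))
    rw [← Real.rpow_def_of_pos (by norm_num), ← Real.rpow_def_of_pos (by norm_num)] at h5
    refine h5.trans (mul_le_mul_of_nonneg_right ?_ (by positivity))
    rw [show Real.log 2 * (-(j : ℝ) * v) - Real.log 2 * (-(j : ℝ) * v') =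
      Real.log 2 * (-(j : ℝ) * (v - v')) by ring, abs_mul, abs_mul, abs_neg, Int.cast_abs,
      abs_of_pos (Real.log_pos (by norm_num : (1 : ℝ) < 2))]
    exact mul_le_of_le_one_left (by positivity) (by linarith [Real.log_two_lt_d9])
  have e : waveletTerm α θ ε u v ω p - waveletTerm α θ ε u v' ω p =
      ε j p.2 ω * ((E - E') * D + E' * (D - D')) := by
    simp only [waveletTerm, waveletPrimitive_eq, hD, hD', hx, hy, hE, hE', mul_zero, zero_sub,
      ← hj]
    ring
  rw [e, abs_mul, Real.rpow_one]
  have h6 : |(E - E') * D + E' * (D - D')| ≤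
      C1 * |v - v'| * I * ((1 + |(j : ℝ)|) * (E + E')) := by
    refine (abs_add_le _ _).trans ?_
    rw [abs_mul, abs_mul, abs_of_pos hE0']
    calc _ ≤ (|(j : ℝ)| * |v - v'| * (E + E')) * (C1 * I) + E' * (C1 * |v - v'| * I) := by
          refine add_le_add (mul_le_mul ?_ hDb (abs_nonneg _) (by positivity))
            (mul_le_mul_of_nonneg_left hDD hE0'.le)
          rwa [Int.cast_abs] at hEE
      _ = C1 * |v - v'| * I * (|(j : ℝ)| * (E + E') + E') := by ring
      _ ≤ _ := by
        refine mul_le_mul_of_nonneg_left ?_ (by positivity)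
        linarith
  calc _ ≤ (Cε * growthWeight α η j p.2) *
        (C1 * |v - v'| * I * ((1 + |(j : ℝ)|) * (E + E'))) :=
        mul_le_mul (hε _ _) h6 (abs_nonneg _) (by positivity)
    _ = _ := by ring

/-- Absolute convergence of the random series, whose terms are increments between `u` and `0`. -/
theorem summable_abs_waveletTerm (hθ : IsMotherFunction θ) (hα : 0 < α) {η : ℝ} (hη : 0 < η)
    (hε : HasGrowth α η ε ω) {v : ℝ} (hv : v ∈ Ioo (1 / α) 1) (u : ℝ) :
    Summable fun p => |waveletTerm α θ ε u v ω p| := by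
  obtain ⟨C, hC, h⟩ := exists_sumLE_increment_space hθ hα hη hε hv.1 hv.2 (abs_nonneg u)
  by_cases hu : u = 0
  · simp only [hu, waveletTerm_zero, abs_zero]
    exact summable_zero
  · have := (h v ⟨le_rfl, le_rfl⟩ u 0 le_rfl (by simp) hu).1
    simpa only [waveletTerm_zero, sub_zero] using this

theorem summable_waveletTerm (hθ : IsMotherFunction θ) (hα : 0 < α) {η : ℝ} (hη : 0 < η)
    (hε : HasGrowth α η ε ω) {v : ℝ} (hv : v ∈ Ioo (1 / α) 1) (u : ℝ) :
    Summable fun p => waveletTerm α θ ε u v ω p :=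
  (summable_abs_waveletTerm hθ hα hη hε hv u).of_abs

variable {Ω₀ : Set Ω}

theorem waveletField_of_mem (hω : ω ∈ Ω₀) (u v : ℝ) :
    waveletField α θ ε Ω₀ u v ω = ∑' p, waveletTerm α θ ε u v ω p :=
  indicator_of_mem hω _

theorem exists_bound_waveletField (hθ : IsMotherFunction θ) (hα : 0 < α) {η : ℝ} (hη : 0 < η)
    (hω : ω ∈ Ω₀) (hε : HasGrowth α η ε ω) {a b M : ℝ} (ha : 1 / α < a) (hb : b < 1)
    (hM : 0 < M) :
    ∃ C : ℝ, 0 ≤ C ∧ ∀ v ∈ Icc a b, ∀ v' ∈ Icc a b, ∀ t s : ℝ, |t| ≤ M → |s| ≤ M → t ≠ s →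
      |waveletField α θ ε Ω₀ t v ω - waveletField α θ ε Ω₀ s v' ω| ≤
        C * (|t - s| ^ (v - 1 / α) * (1 + |Real.log (|t - s|)|) ^ (2 / α + 2 * η) + |v - v'|) := by
  obtain ⟨C1, hC1, h1⟩ := exists_sumLE_increment_space hθ hα hη hε ha hb hM.le
  obtain ⟨C2, hC2, h2⟩ := exists_sumLE_increment_hurst hθ hα hη hε ha hb hM
  refine ⟨max C1 C2, hC1.trans (le_max_left _ _), fun v hv v' hv' t s ht hs hts => ?_⟩
  have hmem : ∀ w ∈ Icc a b, w ∈ Ioo (1 / α) 1 := fun w hw =>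
    ⟨ha.trans_le hw.1, hw.2.trans_lt hb⟩
  have hsm : ∀ u, ∀ w ∈ Icc a b, Summable fun p => waveletTerm α θ ε u w ω p := fun u w hw =>
    summable_waveletTerm hθ hα hη hε (hmem w hw) u
  have h3 := SumLE.abs_tsum_sub_le (hsm t v hv) (hsm s v hv) (h1 v hv t s ht hs hts)
  have h4 := SumLE.abs_tsum_sub_le (hsm s v hv) (hsm s v' hv') (h2 v hv v' hv' s hs)
  simp only [waveletField_of_mem hω]
  refine (abs_sub_le _ (∑' p, waveletTerm α θ ε s v ω p) _).trans ((add_le_add h3 h4).trans ?_)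
  rw [mul_add]
  gcongr
  · exact le_max_left _ _
  · exact le_max_right _ _

theorem exists_Icc_of_continuous {H : ℝ → ℝ} (hH : Continuous H)
    (hHr : ∀ t, H t ∈ Ioo (1 / α) 1) {M : ℝ} (hM : 0 < M) :
    ∃ a b : ℝ, 1 / α < a ∧ b < 1 ∧ ∀ t : ℝ, |t| ≤ M → H t ∈ Icc a b := by
  have hne : (Icc (-M) M).Nonempty := ⟨0, by constructor <;> linarith⟩
  obtain ⟨x, _, hmin⟩ := isCompact_Icc.exists_isMinOn hne hH.continuousOn
  obtain ⟨y, _, hmax⟩ := isCompact_Icc.exists_isMaxOn hne hH.continuousOn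
  exact ⟨H x, H y, (hHr x).1, (hHr y).2, fun t ht => ⟨hmin (abs_le.1 ht), hmax (abs_le.1 ht)⟩⟩

/-- The modulus of continuity of the process. The growth with exponent `η / 2` is used because the
exponent enters twice, through the scale and through the location of the translations. -/
theorem exists_bound_waveletLMSM (hθ : IsMotherFunction θ) (hα : 0 < α) {η : ℝ} (hη : 0 < η)
    (hω : ω ∈ Ω₀) (hε : HasGrowth α (η / 2) ε ω) {H : ℝ → ℝ} (hH : Continuous H)
    (hHr : ∀ t, H t ∈ Ioo (1 / α) 1) {M : ℝ} (hM : 0 < M) :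
    ∃ C : ℝ, 0 ≤ C ∧ ∀ t ∈ Icc (-M) M, ∀ s ∈ Icc (-M) M,
      |waveletLMSM α θ ε Ω₀ H t ω - waveletLMSM α θ ε Ω₀ H s ω| ≤
        C * (|t - s| ^ (max (H t) (H s) - 1 / α) *
          (1 + |Real.log (|t - s|)|) ^ (2 / α + η) + |H t - H s|) := by
  obtain ⟨a, b, ha, hb, hab⟩ := exists_Icc_of_continuous hH hHr hM
  obtain ⟨C, hC, h⟩ := exists_bound_waveletField hθ hα (half_pos hη) hω hε ha hb hM
  rw [show 2 / α + 2 * (η / 2) = 2 / α + η by ring] at h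
  refine ⟨C, hC, fun t ht s hs => ?_⟩
  have ht' := abs_le.2 ht
  have hs' := abs_le.2 hs
  by_cases hts : t = s
  · rw [hts, sub_self, abs_zero]; positivity
  -- the increment in space may be taken at either of the two Hurst parameters
  rcases le_total (H s) (H t) with hle | hle
  · rw [max_eq_left hle]
    exact h _ (hab t ht') _ (hab s hs') t s ht' hs' hts
  · rw [max_eq_right hle, abs_sub_comm, abs_sub_comm t s, abs_sub_comm (H t)]
    exact h _ (hab s hs') _ (hab t ht') s t hs' ht' (Ne.symm hts)

theorem tendsto_rpow_mul_log {κ q : ℝ} (hκ : 0 < κ) (hq : 0 < q) :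
    Tendsto (fun x : ℝ => x ^ κ * (1 + |Real.log x|) ^ q) (𝓝[>] 0) (𝓝 0) := by
  set δ := κ / (2 * q) with hδ
  have hδ0 : 0 < δ := by positivity
  have hlim : Tendsto (fun x : ℝ => (2 / δ + 1) ^ q * x ^ (κ / 2)) (𝓝[>] 0) (𝓝 0) := by
    have h1 : Tendsto (fun x : ℝ => (2 / δ + 1) ^ q * x ^ (κ / 2)) (𝓝 0)
        (𝓝 ((2 / δ + 1) ^ q * 0 ^ (κ / 2))) :=
      ((continuous_id.rpow_const fun x => Or.inr (by positivity)).const_mul _).tendsto 0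
    rw [Real.zero_rpow (by positivity), mul_zero] at h1
    exact h1.mono_left nhdsWithin_le_nhds
  refine squeeze_zero' ?_ ?_ hlim
  · filter_upwards [self_mem_nhdsWithin] with x hx
    have : (0 : ℝ) < x := hx
    positivity
  · filter_upwards [Ioo_mem_nhdsGT (zero_lt_one' ℝ)] with x hx
    have hx0 := hx.1
    have h2 := abs_log_le_rpow_add_rpow hx0 hδ0
    have h3 : x ^ δ ≤ 1 := Real.rpow_le_one hx0.le hx.2.le hδ0.le
    have h4 : 1 ≤ x ^ (-δ) := Real.one_le_rpow_of_pos_of_le_one_of_nonpos hx0 hx.2.le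
      (by linarith)
    have h5 : 1 + |Real.log x| ≤ (2 / δ + 1) * x ^ (-δ) := by
      have h6 : (x ^ δ + x ^ (-δ)) / δ ≤ 2 / δ * x ^ (-δ) := by
        rw [div_mul_eq_mul_div]; gcongr; linarith
      linarith
    calc x ^ κ * (1 + |Real.log x|) ^ q ≤ x ^ κ * ((2 / δ + 1) * x ^ (-δ)) ^ q := by gcongr
      _ = (2 / δ + 1) ^ q * (x ^ κ * x ^ (-δ * q)) := by
        rw [Real.mul_rpow (by positivity) (by positivity), ← Real.rpow_mul hx0.le]; ring
      _ = _ := by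
        rw [← Real.rpow_add hx0]
        congr 2
        rw [hδ]; field_simp; ring

theorem continuous_waveletLMSM (hθ : IsMotherFunction θ) (hα : 0 < α) {η : ℝ} (hη : 0 < η)
    (hω : ω ∈ Ω₀) (hε : HasGrowth α (η / 2) ε ω) {H : ℝ → ℝ} (hH : Continuous H)
    (hHr : ∀ t, H t ∈ Ioo (1 / α) 1) : Continuous fun t => waveletLMSM α θ ε Ω₀ H t ω := by
  rw [continuous_iff_continuousAt]
  intro t
  have hM : 0 < |t| + 1 := by positivity
  obtain ⟨C, hC, h⟩ := exists_bound_waveletLMSM hθ hα hη hω hε hH hHr hM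
  have hκ : 0 < H t - 1 / α := by linarith [(hHr t).1]
  rw [continuousAt_iff_punctured_nhds, tendsto_iff_norm_sub_tendsto_zero]
  have habs : Tendsto (fun s : ℝ => |s - t|) (𝓝[≠] t) (𝓝[>] 0) := by
    refine tendsto_nhdsWithin_iff.2 ⟨?_, ?_⟩
    · have : Tendsto (fun s : ℝ => |s - t|) (𝓝 t) (𝓝 |t - t|) :=
        ((continuous_id.sub continuous_const).abs).tendsto t
      rw [sub_self, abs_zero] at this
      exact this.mono_left nhdsWithin_le_nhds
    · filter_upwards [self_mem_nhdsWithin] with s hs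
      exact abs_pos.2 (sub_ne_zero.2 hs)
  have hlim : Tendsto (fun s => C * (|s - t| ^ (H t - 1 / α) *
      (1 + |Real.log (|s - t|)|) ^ (2 / α + η) + |H s - H t|)) (𝓝[≠] t) (𝓝 0) := by
    have h1 := (tendsto_rpow_mul_log (q := 2 / α + η) hκ (by positivity)).comp habs
    have h2 : Tendsto (fun s : ℝ => |H s - H t|) (𝓝[≠] t) (𝓝 0) := by
      have : Tendsto (fun s : ℝ => |H s - H t|) (𝓝 t) (𝓝 |H t - H t|) :=
        ((hH.sub continuous_const).abs).tendsto t
      rw [sub_self, abs_zero] at this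
      exact this.mono_left nhdsWithin_le_nhds
    simpa [Function.comp_def] using (h1.add h2).const_mul C
  refine squeeze_zero' (Eventually.of_forall fun s => norm_nonneg _) ?_ hlim
  have hball : Metric.ball t 1 ∈ 𝓝[≠] t := nhdsWithin_le_nhds (Metric.ball_mem_nhds t one_pos)
  filter_upwards [hball, self_mem_nhdsWithin] with s hs hst
  rw [Metric.mem_ball, Real.dist_eq] at hs
  have hst' : 0 < |s - t| := abs_pos.2 (sub_ne_zero.2 hst)
  have hsM : |s| ≤ |t| + 1 := by
    have := abs_sub_abs_le_abs_sub s t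
    linarith
  refine (h s (abs_le.1 hsM) t (abs_le.1 (by linarith))).trans ?_
  gcongr C * (?_ * _ + _)
  exact Real.rpow_le_rpow_of_exponent_ge hst' hs.le (by linarith [le_max_right (H s) (H t)])

end field

/-! ### Unconditional convergence in `L^p` -/

section LpSum

variable {ι : Type*} {p q : ENNReal} {F : ι → ℝ → ℝ} {g h : ℝ → ℝ}

/-- The family `F` of real functions is unconditionally summable in `L^p(ℝ)`, with sum `g`. -/
def LpHasSum (p : ENNReal) (F : ι → ℝ → ℝ) (g : ℝ → ℝ) : Prop :=
  Tendsto (fun s : Finset ι => eLpNorm (fun x => ∑ i ∈ s, F i x - g x) p volume) atTop (𝓝 0)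

theorem lpHasSum_toLp_iff [Fact (1 ≤ p)] (hF : ∀ i, MemLp (F i) p volume)
    (hg : MemLp g p volume) :
    HasSum (fun i => (hF i).toLp (F i)) (hg.toLp g) ↔ LpHasSum p F g := by
  have hs : ∀ s : Finset ι, MemLp (fun x => ∑ i ∈ s, F i x) p volume := fun s =>
    memLp_finsetSum s fun i _ => hF i
  have e : ∀ s : Finset ι, ∑ i ∈ s, (hF i).toLp (F i) = (hs s).toLp _ := by
    intro s
    ext1
    filter_upwards [Lp.coeFn_finsetSum s fun i => (hF i).toLp (F i), (hs s).coeFn_toLp,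
      (ae_ball_iff (Finset.countable_toSet s)).2 fun i _ => (hF i).coeFn_toLp] with x h1 h2 h3
    rw [h1, h2, Finset.sum_apply]
    exact Finset.sum_congr rfl fun i hi => h3 i hi
  rw [HasSum, SummationFilter.unconditional_filter]
  simp_rw [e]
  exact Lp.tendsto_Lp_iff_tendsto_eLpNorm'' (fun s : Finset ι => fun x => ∑ i ∈ s, F i x) hs g hg

theorem exists_lpHasSum (hp : 1 ≤ p) (hF : ∀ i, MemLp (F i) p volume)
    (hs : Summable fun i => (eLpNorm (F i) p volume).toReal) :
    ∃ g, MemLp g p volume ∧ LpHasSum p F g := by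
  have : Fact (1 ≤ p) := ⟨hp⟩
  have h1 : Summable fun i => (hF i).toLp (F i) := by
    refine Summable.of_norm (hs.congr fun i => ?_)
    rw [Lp.norm_toLp]
  obtain ⟨a, ha⟩ := h1
  refine ⟨a, Lp.memLp a, (lpHasSum_toLp_iff hF (Lp.memLp a)).1 ?_⟩
  rwa [Lp.toLp_coeFn]

theorem LpHasSum.tendstoInMeasure (hp : p ≠ 0) (hF : ∀ i, MemLp (F i) p volume)
    (hg : MemLp g p volume) (h : LpHasSum p F g) :
    TendstoInMeasure volume (fun s : Finset ι => fun x => ∑ i ∈ s, F i x) atTop g :=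
  tendstoInMeasure_of_tendsto_eLpNorm hp
    (fun s => (memLp_finsetSum s fun i _ => hF i).aestronglyMeasurable) hg.aestronglyMeasurable h

/-- The sums of the same family in two spaces `L^p` and `L^q` agree, since both convergences imply
convergence in measure. -/
theorem LpHasSum.ae_unique [Countable ι] (hp : p ≠ 0) (hq : q ≠ 0)
    (hF : ∀ i, MemLp (F i) p volume) (hF' : ∀ i, MemLp (F i) q volume) (hg : MemLp g p volume)
    (hh : MemLp h q volume) (h1 : LpHasSum p F g) (h2 : LpHasSum q F h) : g =ᵐ[volume] h :=
  tendstoInMeasure_ae_unique (h1.tendstoInMeasure hp hF hg) (h2.tendstoInMeasure hq hF' hh)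

theorem LpHasSum.ae_eq_of_hasSum [Countable ι] (hp : p ≠ 0)
    (hF : ∀ i, MemLp (F i) p volume) (hg : MemLp g p volume) (h1 : LpHasSum p F g)
    (h2 : ∀ᵐ x, HasSum (fun i => F i x) (h x)) : g =ᵐ[volume] h := by
  obtain ⟨ns, hns, hlim⟩ := (h1.tendstoInMeasure hp hF hg).exists_seq_tendsto_ae'
  filter_upwards [hlim, h2] with x hx hx'
  rw [HasSum, SummationFilter.unconditional_filter] at hx'
  exact tendsto_nhds_unique hx (hx'.comp hns)

/-- Absolute convergence in `L^p` implies pointwise absolute convergence almost everywhere. -/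
theorem ae_summable_abs_of_summable_eLpNorm [Countable ι] (hp : 1 ≤ p)
    (hF : ∀ i, MemLp (F i) p volume)
    (hs : Summable fun i => (eLpNorm (F i) p volume).toReal) :
    ∀ᵐ x, Summable fun i => |F i x| := by
  have hF' : ∀ i, MemLp (fun x => |F i x|) p volume := fun i => (hF i).abs
  have hs' : Summable fun i => (eLpNorm (fun x => |F i x|) p volume).toReal := by
    refine hs.congr fun i => ?_
    rw [← eLpNorm_norm (F i)]
    rfl
  obtain ⟨g, hg, hgs⟩ := exists_lpHasSum hp hF' hs'
  obtain ⟨ns, hns, hlim⟩ :=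
    (hgs.tendstoInMeasure (by positivity) hF' hg).exists_seq_tendsto_ae'
  filter_upwards [hlim] with x hx
  obtain ⟨B, hB⟩ := hx.bddAbove_range
  refine summable_of_sum_le (c := B) (fun i => abs_nonneg _) fun u => ?_
  obtain ⟨n, hn⟩ := (hns.eventually (eventually_ge_atTop u)).exists
  exact (Finset.sum_le_sum_of_subset_of_nonneg hn fun _ _ _ => abs_nonneg _).trans
    (hB ⟨n, rfl⟩)

end LpSum

/-! ### The kernel of linear fractional stable motion -/

section Kernel

/-- The kernel of the stochastic integral which defines linear fractional stable motion: it is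
`(u - s)_+^κ - (-s)_+^κ`. -/
def fracKernel (u κ s : ℝ) : ℝ := truncPow (u - s) κ - truncPow (-s) κ

theorem continuous_fracKernel (u : ℝ) {κ : ℝ} (hκ : 0 < κ) : Continuous (fracKernel u κ) :=
  ((continuous_truncPow hκ).comp (continuous_const.sub continuous_id)).sub
    ((continuous_truncPow hκ).comp continuous_neg)

/-- Far away from the origin, the kernel is at most an increment of `x ^ κ`, which the mean value
theorem bounds by a multiple of `x ^ (κ - 1)`. -/
theorem exists_fracKernel_bound (u : ℝ) {κ : ℝ} (hκ : 0 < κ) (hκ1 : κ < 1) :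
    ∃ C : ℝ, 0 ≤ C ∧ ∀ s, |fracKernel u κ s| ≤ C * (1 + |s|) ^ (κ - 1) := by
  set R := 2 * |u| + 1 with hR
  have hR0 : 0 < R := by positivity
  obtain ⟨K, hK⟩ := (isCompact_Icc (a := -R) (b := R)).exists_bound_of_continuousOn
    (continuous_fracKernel u hκ).continuousOn
  have hK0 : 0 ≤ K := (norm_nonneg _).trans (hK 0 ⟨by linarith, by linarith⟩)
  refine ⟨max (K * (1 + R) ^ (1 - κ)) (κ * |u| * 4 ^ (1 - κ)), by positivity, fun s => ?_⟩
  have hs0 : 0 < 1 + |s| := by positivity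
  have hu := abs_nonneg u
  rcases le_or_gt |s| R with h | h
  · refine (hK s (abs_le.1 h)).trans ?_
    have h1 : 1 ≤ (1 + R) ^ (1 - κ) * (1 + |s|) ^ (κ - 1) := by
      rw [show κ - 1 = -(1 - κ) by ring, Real.rpow_neg hs0.le, ← div_eq_mul_inv,
        ← Real.div_rpow (by positivity) hs0.le]
      refine Real.one_le_rpow ?_ (by linarith)
      rw [one_le_div hs0]; linarith
    calc K ≤ K * ((1 + R) ^ (1 - κ) * (1 + |s|) ^ (κ - 1)) := le_mul_of_one_le_right hK0 h1
      _ = K * (1 + R) ^ (1 - κ) * (1 + |s|) ^ (κ - 1) := by ring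
      _ ≤ _ := mul_le_mul_of_nonneg_right (le_max_left _ _) (by positivity)
  · refine le_trans ?_ (mul_le_mul_of_nonneg_right (le_max_right _ _) (by positivity))
    have hu1 := neg_abs_le u
    have hu2 := le_abs_self u
    rcases le_or_gt 0 s with h0 | h0
    -- both truncated powers vanish to the right of `0` and `u`
    · rw [abs_of_nonneg h0] at h
      rw [fracKernel, truncPow, truncPow, if_neg (by linarith), if_neg (by linarith)]
      simp only [sub_self, abs_zero]
      positivity
    · rw [abs_of_neg h0] at h
      rw [fracKernel, truncPow, truncPow, if_pos (by linarith), if_pos (by linarith)]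
      -- both `-s` and `u - s` are at least `(1 + |s|) / 4`
      have hb : ∀ x ∈ Ici ((1 + |s|) / 4), ‖κ * x ^ (κ - 1)‖ ≤ κ * ((1 + |s|) / 4) ^ (κ - 1) := by
        intro x hx
        have hx0 : 0 < x := lt_of_lt_of_le (by positivity) hx
        rw [Real.norm_of_nonneg (by positivity)]
        exact mul_le_mul_of_nonneg_left
          (Real.rpow_le_rpow_of_nonpos (by positivity) hx (by linarith)) hκ.le
      have hd : ∀ x ∈ Ici ((1 + |s|) / 4),
          HasDerivWithinAt (fun x : ℝ => x ^ κ) (κ * x ^ (κ - 1)) (Ici ((1 + |s|) / 4)) x := by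
        intro x hx
        have hx0 : 0 < x := lt_of_lt_of_le (by positivity) hx
        exact (Real.hasDerivAt_rpow_const (Or.inl hx0.ne')).hasDerivWithinAt
      have h1 := (convex_Ici ((1 + |s|) / 4)).norm_image_sub_le_of_norm_hasDerivWithin_le hd hb
        (x := -s) (y := u - s) (by rw [mem_Ici, abs_of_neg h0]; linarith)
        (by rw [mem_Ici, abs_of_neg h0]; linarith)
      rw [Real.norm_eq_abs, Real.norm_eq_abs] at h1
      refine h1.trans_eq ?_
      rw [Real.div_rpow hs0.le (by norm_num), show (κ - 1) = -(1 - κ) by ring,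
        Real.rpow_neg (by norm_num : (0 : ℝ) ≤ 4), div_inv_eq_mul, show u - s - -s = u by ring]
      ring

theorem memLp_fracKernel (u : ℝ) {κ p : ℝ} (hκ : 0 < κ) (hκ1 : κ < 1) (hp : 0 < p)
    (h : 1 < p * (1 - κ)) : MemLp (fracKernel u κ) (ENNReal.ofReal p) volume := by
  obtain ⟨C, hC, hb⟩ := exists_fracKernel_bound u hκ hκ1
  have h1 : MemLp (fun s : ℝ => C * (1 + |s|) ^ (κ - 1)) (ENNReal.ofReal p) volume := by
    refine MemLp.const_mul ?_ C
    have hm : AEStronglyMeasurable (fun s : ℝ => (1 + |s|) ^ (κ - 1)) volume := by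
      refine Continuous.aestronglyMeasurable ?_
      exact (continuous_const.add continuous_abs).rpow_const fun x =>
        Or.inl (by have := abs_nonneg x; positivity : (1 : ℝ) + |x| ≠ 0)
    rw [← integrable_norm_rpow_iff hm (by simpa using hp) ENNReal.ofReal_ne_top,
      ENNReal.toReal_ofReal hp.le]
    have h2 := integrable_one_add_norm (E := ℝ) (μ := volume) (r := p * (1 - κ)) (by simpa using h)
    refine h2.congr (Eventually.of_forall fun s => ?_)
    simp only [Real.norm_eq_abs]
    have hs : 0 ≤ (1 + |s|) ^ (κ - 1) := by positivity
    rw [abs_of_nonneg hs, ← Real.rpow_mul (by positivity)]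
    congr 1; ring
  refine h1.mono (continuous_fracKernel u hκ).aestronglyMeasurable
    (Eventually.of_forall fun s => ?_)
  rw [Real.norm_eq_abs, Real.norm_of_nonneg (by positivity)]
  exact hb s

/-- The scaling property of the kernel: its dyadic averages are increments of the fractional
primitive. -/
theorem integral_fracKernel_mul {θ : ℝ → ℝ} (hθ : Continuous θ) (hs : HasCompactSupport θ)
    (u : ℝ) {κ : ℝ} (hκ : 0 < κ) {a : ℝ} (ha : 0 < a) (k : ℝ) :
    ∫ r, fracKernel u κ (a⁻¹ * (r + k)) * θ r =
      a ^ (-κ) * (fracPrimitive θ κ (a * u - k) - fracPrimitive θ κ (-k)) := by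
  rw [fracPrimitive, fracPrimitive, ← integral_sub (integrable_truncPow_mul hθ hs hκ _)
    (integrable_truncPow_mul hθ hs hκ _), ← integral_const_mul]
  congr 1
  ext r
  have e1 : u - a⁻¹ * (r + k) = a⁻¹ * (a * u - k - r) := by field_simp; ring
  have e2 : -(a⁻¹ * (r + k)) = a⁻¹ * (-k - r) := by ring
  rw [fracKernel, e1, e2, truncPow_mul (by positivity), truncPow_mul (by positivity),
    Real.inv_rpow ha.le, ← Real.rpow_neg ha.le]
  ring

end Kernel

/-! ### Wavelet series of stochastic integrals -/

section Representation

variable {α : ℝ} {θ e : ℝ → ℝ}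

/-- The deterministic factor of the term of index `p` of the wavelet series. -/
def waveletCoeff (α : ℝ) (θ : ℝ → ℝ) (u v : ℝ) (p : ℤ × ℤ) : ℝ :=
  (2 : ℝ) ^ (-(p.1 : ℝ) * v) *
    (waveletPrimitive α θ ((2 : ℝ) ^ p.1 * u - p.2) v - waveletPrimitive α θ (-(p.2 : ℝ)) v)

/-- The dilated and translated function `2^{j/α} e(2^j s - k)`, for `p = (j, k)`; all these
functions have the same `L^α` norm. -/
def waveletAtom (α : ℝ) (e : ℝ → ℝ) (p : ℤ × ℤ) (s : ℝ) : ℝ :=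
  (2 : ℝ) ^ ((p.1 : ℝ) / α) * e ((2 : ℝ) ^ p.1 * s - p.2)

theorem waveletTerm_eq_waveletCoeff_mul {Ω : Type*} (ε : ℤ → ℤ → Ω → ℝ) (u v : ℝ) (ω : Ω)
    (p : ℤ × ℤ) : waveletTerm α θ ε u v ω p = waveletCoeff α θ u v p * ε p.1 p.2 ω := by
  rw [waveletTerm, waveletCoeff]; ring

/-- This is the absolute convergence of the random series whose coefficients all equal `1`. -/
theorem summable_abs_waveletCoeff (hθ : IsMotherFunction θ) (hα : 0 < α) {v : ℝ}
    (hv : v ∈ Ioo (1 / α) 1) (u : ℝ) : Summable fun p => |waveletCoeff α θ u v p| := by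
  obtain ⟨C, hC⟩ := one_le_growthWeight hα one_pos
  have h := summable_abs_waveletTerm (ε := fun _ _ (_ : Unit) => (1 : ℝ)) (ω := ()) hθ hα one_pos
    ⟨C, fun j k => by simpa using hC j k⟩ hv u
  simpa only [waveletTerm_eq_waveletCoeff_mul, mul_one] using h

/-- By scaling, the powers of `2` in the wavelet coefficient and in the atom combine so that the
product is a dilated average of the kernel times the translated and dilated function `e`. -/
theorem waveletCoeff_mul_waveletAtom (hθ : Continuous θ) (hs : HasCompactSupport θ) (u : ℝ)
    {v : ℝ} (hv : 1 / α < v) (p : ℤ × ℤ) (s : ℝ) :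
    waveletCoeff α θ u v p * waveletAtom α e p s =
      (∫ r, fracKernel u (v - 1 / α) (((2 : ℝ) ^ p.1)⁻¹ * (r + p.2)) * θ r) *
        e ((2 : ℝ) ^ p.1 * s - p.2) := by
  rw [integral_fracKernel_mul hθ hs u (by linarith) (by positivity), waveletCoeff, waveletAtom,
    waveletPrimitive_eq, waveletPrimitive_eq, ← Real.rpow_intCast 2 p.1, ← Real.rpow_mul two_pos.le,
    show (p.1 : ℝ) * -(v - 1 / α) = -(p.1 : ℝ) * v + p.1 / α by ring, Real.rpow_add two_pos]
  ring

theorem memLp_waveletAtom {q : ENNReal} (he : MemLp e q volume) (p : ℤ × ℤ) :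
    MemLp (waveletAtom α e p) q volume :=
  memLp_comp_affine he (by positivity) _ _

theorem memLp_waveletCoeff_mul_waveletAtom {q : ENNReal} (he : MemLp e q volume) (u v : ℝ)
    (p : ℤ × ℤ) :
    MemLp (fun s => waveletCoeff α θ u v p * waveletAtom α e p s) q volume :=
  (memLp_waveletAtom he p).const_mul _

theorem summable_eLpNorm_waveletCoeff_mul_waveletAtom (hθ : IsMotherFunction θ) (hα : 0 < α)
    {v : ℝ} (hv : v ∈ Ioo (1 / α) 1) (u : ℝ) :
    Summable fun p => (eLpNorm (fun s => waveletCoeff α θ u v p * waveletAtom α e p s)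
      (ENNReal.ofReal α) volume).toReal := by
  refine ((summable_abs_waveletCoeff hθ hα hv u).mul_right (stableScale α e)).congr fun p => ?_
  rw [← stableScale_wavelet hα p.1 p.2, stableScale]
  change _ = (eLpNorm (waveletCoeff α θ u v p • waveletAtom α e p) _ _).toReal
  rw [eLpNorm_const_smul, ENNReal.toReal_mul]
  simp only [toReal_enorm, Real.norm_eq_abs]
  rfl

theorem exists_lpHasSum_wavelet (hθ : IsMotherFunction θ) (hα : 1 ≤ α)
    (he : MemLp e (ENNReal.ofReal α) volume) {v : ℝ} (hv : v ∈ Ioo (1 / α) 1) (u : ℝ) :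
    ∃ g, MemLp g (ENNReal.ofReal α) volume ∧
      LpHasSum (ENNReal.ofReal α)
        (fun p s => waveletCoeff α θ u v p * waveletAtom α e p s) g :=
  exists_lpHasSum (by simpa using hα)
    (fun p => memLp_waveletCoeff_mul_waveletAtom he u v p)
    (summable_eLpNorm_waveletCoeff_mul_waveletAtom hθ (by linarith) hv u)

variable {Ω : Type*} [MeasurableSpace Ω] {μ : Measure Ω} {β : ℝ → ℝ} {Z : Set ℝ → Ω → ℝ}
  {ε : ℤ → ℤ → Ω → ℝ} {Ω₀ : Set Ω}

theorem ae_mem_of_isGoodEvent [IsProbabilityMeasure μ] (hΩ : IsGoodEvent μ α ε Ω₀) :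
    ∀ᵐ ω ∂μ, ω ∈ Ω₀ := by
  change Ω₀ ∈ ae μ
  rw [mem_ae_iff]
  exact (prob_compl_eq_zero_iff hΩ.measurableSet).2 hΩ.measure_eq_one

theorem measurable_waveletField (hθ : IsMotherFunction θ) (hα : 0 < α)
    (hε : IsWaveletCoeff μ α Z e ε) (hΩ : IsGoodEvent μ α ε Ω₀) {v : ℝ}
    (hv : v ∈ Ioo (1 / α) 1) (u : ℝ) : Measurable (waveletField α θ ε Ω₀ u v) := by
  obtain ⟨ns, hns⟩ := exists_seq_tendsto (atTop : Filter (Finset (ℤ × ℤ)))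
  refine measurable_of_tendsto_metrizable
    (f := fun n => Ω₀.indicator fun ω => ∑ p ∈ ns n, waveletTerm α θ ε u v ω p) (fun n => ?_) ?_
  · refine Measurable.indicator ?_ hΩ.measurableSet
    simp only [waveletTerm_eq_waveletCoeff_mul]
    exact Finset.measurable_fun_sum _ fun p _ => (hε p.1 p.2).2.1.const_mul _
  · rw [tendsto_pi_nhds]
    intro ω
    by_cases hω : ω ∈ Ω₀
    · simp only [indicator_of_mem hω, waveletField_of_mem hω]
      have h := (summable_waveletTerm hθ hα one_pos (hΩ.hasGrowth hω one_pos) hv u).hasSum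
      rw [HasSum, SummationFilter.unconditional_filter] at h
      exact h.comp hns
    · simp only [waveletField, indicator_of_notMem hω]
      exact tendsto_const_nhds

/-- If the deterministic series `∑ c_p e_p` converges to `g` in `L^α`, then the random series
obtained by replacing the functions `e_p` by their stochastic integrals is `∫ g dZ`. -/
theorem isStableIntegral_waveletField [IsProbabilityMeasure μ] (hZ : IsStableRandomMeasure μ α β Z)
    (hα : 1 ≤ α) (hβ : ∀ s, β s ∈ Icc (-1 : ℝ) 1) (hθ : IsMotherFunction θ)
    (hε : IsWaveletCoeff μ α Z e ε) (hΩ : IsGoodEvent μ α ε Ω₀) {u v : ℝ}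
    (hv : v ∈ Ioo (1 / α) 1) {g : ℝ → ℝ} (hg : MemLp g (ENNReal.ofReal α) volume)
    (hsum : LpHasSum (ENNReal.ofReal α)
      (fun p s => waveletCoeff α θ u v p * waveletAtom α e p s) g) :
    IsStableIntegral μ α Z g (waveletField α θ ε Ω₀ u v) := by
  have hα0 : 0 < α := by linarith
  obtain ⟨ns, hns⟩ := exists_seq_tendsto (atTop : Filter (Finset (ℤ × ℤ)))
  refine isStableIntegral_of_tendsto hZ hα hβ hg
    (F := fun n s => ∑ p ∈ ns n, waveletCoeff α θ u v p * waveletAtom α e p s)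
    (X := fun n ω => ∑ p ∈ ns n, waveletCoeff α θ u v p * ε p.1 p.2 ω)
    (fun n => IsStableIntegral.sum hZ hα _ (fun p _ => hε p.1 p.2) _) (hsum.comp hns)
    (measurable_waveletField hθ hα0 hε hΩ hv u) ?_
  filter_upwards [ae_mem_of_isGoodEvent hΩ] with ω hω
  have h := (summable_waveletTerm hθ hα0 one_pos (hΩ.hasGrowth hω one_pos) hv u).hasSum
  rw [HasSum, SummationFilter.unconditional_filter] at h
  rw [waveletField_of_mem hω]
  simp only [waveletTerm_eq_waveletCoeff_mul] at h ⊢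
  exact h.comp hns

end Representation

/-! ### Expansion of the kernel in an orthonormal wavelet basis -/

section Orthonormal

variable {α : ℝ} {ψ : ℝ → ℝ}

theorem IsSmoothMotherWavelet.isMotherFunction (hψ : IsSmoothMotherWavelet ψ) :
    IsMotherFunction ψ := by
  obtain ⟨Q, hQ, h, -⟩ := hψ.vanishing_moments
  exact ⟨hψ.contDiff.of_le (by norm_num), hψ.hasCompactSupport,
    by simpa using h 0 (by omega), by simpa using h 1 (by omega)⟩

theorem IsMotherFunction.memLp {θ : ℝ → ℝ} (hθ : IsMotherFunction θ) (q : ENNReal) :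
    MemLp θ q volume :=
  hθ.contDiff.continuous.memLp_of_hasCompactSupport hθ.hasCompactSupport

/-- The expansion of the kernel in the orthonormal wavelet basis of `L²`. -/
theorem IsSmoothMotherWavelet.lpHasSum_fracKernel (hψ : IsSmoothMotherWavelet ψ) {u v : ℝ}
    (hv : 1 / α < v) (hf : MemLp (fracKernel u (v - 1 / α)) 2 volume) :
    LpHasSum 2 (fun p s => waveletCoeff α ψ u v p * waveletAtom α ψ p s)
      (fracKernel u (v - 1 / α)) := by
  obtain ⟨b, hb⟩ := hψ.orthonormal_basis
  have hm := hψ.isMotherFunction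
  have hF : ∀ p : ℤ × ℤ,
      MemLp (fun s => waveletCoeff α ψ u v p * waveletAtom α ψ p s) 2 volume := fun p =>
    memLp_waveletCoeff_mul_waveletAtom (hm.memLp 2) u v p
  have : Fact ((1 : ENNReal) ≤ 2) := ⟨by norm_num⟩
  rw [← lpHasSum_toLp_iff hF hf]
  convert b.hasSum_repr (hf.toLp _) using 1
  funext p
  obtain ⟨j, k⟩ := p
  have ha : (0 : ℝ) < 2 ^ j := by positivity
  have hsq : (2 : ℝ) ^ ((j : ℝ) / 2) * (2 : ℝ) ^ ((j : ℝ) / 2) = 2 ^ j := by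
    rw [← Real.rpow_add two_pos, add_halves, Real.rpow_intCast]
  have hinner : b.repr (hf.toLp _) (j, k) = (2 : ℝ) ^ ((j : ℝ) / 2) * ((2 : ℝ) ^ j)⁻¹ *
      ∫ r, fracKernel u (v - 1 / α) (((2 : ℝ) ^ j)⁻¹ * (r + k)) * ψ r := by
    rw [b.repr_apply_apply, L2.inner_def]
    have h1 : ∫ s, inner ℝ ((b (j, k)) s) ((hf.toLp _ : Lp ℝ 2 volume) s) =
        ∫ s, (2 : ℝ) ^ ((j : ℝ) / 2) * (fun r => fracKernel u (v - 1 / α)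
          (((2 : ℝ) ^ j)⁻¹ * (r + k)) * ψ r) (2 ^ j * s - k) := by
      refine integral_congr_ae ?_
      filter_upwards [hb j k, hf.coeFn_toLp] with s h1 h2
      rw [h1, h2, RCLike.inner_apply]
      simp only [conj_trivial, sub_add_cancel, inv_mul_cancel_left₀ ha.ne']
      ring
    rw [h1, integral_const_mul, mul_assoc]
    congr 1
    have h2 := Measure.integral_comp_mul_left (fun s => (fun r => fracKernel u (v - 1 / α)
          (((2 : ℝ) ^ j)⁻¹ * (r + k)) * ψ r) (s - k)) ((2 : ℝ) ^ j)
    rw [h2, integral_sub_right_eq_self (fun r => fracKernel u (v - 1 / α)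
          (((2 : ℝ) ^ j)⁻¹ * (r + k)) * ψ r) (k : ℝ), abs_of_pos (by positivity), smul_eq_mul]
  ext1
  filter_upwards [(hF (j, k)).coeFn_toLp, Lp.coeFn_smul (b.repr (hf.toLp _) (j, k)) (b (j, k)),
    hb j k] with s h1 h2 h3
  rw [h1, h2, Pi.smul_apply, h3, hinner,
    waveletCoeff_mul_waveletAtom hm.contDiff.continuous hm.hasCompactSupport u hv, smul_eq_mul]
  have h4 : (2 : ℝ) ^ ((j : ℝ) / 2) * ((2 : ℝ) ^ j)⁻¹ * (2 : ℝ) ^ ((j : ℝ) / 2) = 1 := by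
    rw [mul_right_comm, hsq, mul_inv_cancel₀ ha.ne']
  linear_combination (-(∫ r, fracKernel u (v - 1 / α) (((2 : ℝ) ^ j)⁻¹ * (r + k)) * ψ r) *
    ψ (2 ^ j * s - k)) * h4

theorem memLp_fracKernel_of_mem_Ioo (hα : α ∈ Ioo (1 : ℝ) 2) {v : ℝ} (hv : v ∈ Ioo (1 / α) 1)
    (u : ℝ) : MemLp (fracKernel u (v - 1 / α)) (ENNReal.ofReal α) volume := by
  have hα0 : 0 < α := by linarith [hα.1]
  have h1 : α * (1 / α) = 1 := by field_simp
  have h2 : 0 < 1 / α := by positivity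
  refine memLp_fracKernel u (by linarith [hv.1]) (by linarith [hv.2]) hα0 ?_
  nlinarith [hv.2]

/-- The kernel need not be approximated in `L^α` by hand: the wavelet series converges absolutely in
`L^α`, and its sum there must be its sum in `L²`. The kernel is square integrable because
`v - 1 / α < 1 / 2`, as `1 / α > 1 / 2`. -/
theorem IsSmoothMotherWavelet.lpHasSum_fracKernel_stable (hψ : IsSmoothMotherWavelet ψ)
    (hα : α ∈ Ioo (1 : ℝ) 2) {v : ℝ} (hv : v ∈ Ioo (1 / α) 1) (u : ℝ) :
    LpHasSum (ENNReal.ofReal α) (fun p s => waveletCoeff α ψ u v p * waveletAtom α ψ p s)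
      (fracKernel u (v - 1 / α)) := by
  have hα0 : 0 < α := by linarith [hα.1]
  have hm := hψ.isMotherFunction
  have h1 : 1 / 2 < 1 / α := one_div_lt_one_div_of_lt hα0 hα.2
  have hf2 : MemLp (fracKernel u (v - 1 / α)) 2 volume := by
    have := memLp_fracKernel u (κ := v - 1 / α) (p := 2) (by linarith [hv.1])
      (by linarith [hv.2]) two_pos (by linarith [hv.2])
    simpa using this
  obtain ⟨g, hg, hgs⟩ := exists_lpHasSum_wavelet hm hα.1.le (hm.memLp _) hv u
  have hae := hgs.ae_unique (by simpa using hα0) two_ne_zero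
    (fun p => memLp_waveletCoeff_mul_waveletAtom (hm.memLp _) u v p)
    (fun p => memLp_waveletCoeff_mul_waveletAtom (hm.memLp _) u v p) hg hf2
    (hψ.lpHasSum_fracKernel hv.1 hf2)
  refine hgs.congr fun s => eLpNorm_congr_ae ?_
  filter_upwards [hae] with x hx
  rw [hx]

end Orthonormal

/-! ### Piecewise linear interpolation -/

section Hat

/-- The hat function, which generates the continuous piecewise linear functions with integer
nodes. -/
def hat (x : ℝ) : ℝ := max 0 (1 - |x|)

theorem continuous_hat : Continuous hat :=
  continuous_const.max (continuous_const.sub continuous_abs)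

theorem hat_eq_zero {x : ℝ} (h : 1 ≤ |x|) : hat x = 0 := max_eq_left (by linarith)

theorem hat_of_nonneg {x : ℝ} (h0 : 0 ≤ x) (h1 : x ≤ 1) : hat x = 1 - x := by
  rw [hat, abs_of_nonneg h0, max_eq_right (by linarith)]

theorem hat_of_nonpos {x : ℝ} (h0 : x ≤ 0) (h1 : -1 ≤ x) : hat x = 1 + x := by
  rw [hat, abs_of_nonpos h0, max_eq_right (by linarith)]; ring

theorem hasCompactSupport_hat : HasCompactSupport hat :=
  HasCompactSupport.intro (isCompact_Icc (a := -1) (b := 1)) fun x hx => by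
    refine hat_eq_zero ?_
    by_contra h
    exact hx (abs_le.1 (not_le.1 h).le)

/-- The value at `x` of the continuous function which equals `c k` at each integer `k` and is
affine between consecutive integers. -/
def linearInterp (c : ℤ → ℝ) (x : ℝ) : ℝ :=
  (1 - Int.fract x) * c ⌊x⌋ + Int.fract x * c (⌊x⌋ + 1)

/-- Refining the mesh: the difference between the piecewise linear interpolations of `c'` at the
half-integers and of `c` at the integers is a series of hat functions of half the width. -/
theorem hasSum_linearInterp_sub (c c' : ℤ → ℝ) (x : ℝ) :
    ∃ A B : ℝ, HasSum (fun k : ℤ => (c' (2 * k) - c k) * hat (2 * (x - k))) A ∧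
      HasSum (fun k : ℤ => (c' (2 * k + 1) - (c k + c (k + 1)) / 2) * hat (2 * (x - k) - 1)) B ∧
      A + B = linearInterp c' (2 * x) - linearInterp c x := by
  set n := ⌊x⌋ with hn
  set y := Int.fract x with hy
  have hx : x = n + y := (Int.floor_add_fract x).symm
  have hy0 : 0 ≤ y := Int.fract_nonneg x
  have hy1 : y < 1 := Int.fract_lt_one x
  have hlow : ∀ k : ℤ, k < n → (k : ℝ) ≤ n - 1 := fun k hk => by
    have : k ≤ n - 1 := by omega
    exact_mod_cast this
  have hhigh : ∀ k : ℤ, n < k → (n : ℝ) + 1 ≤ k := fun k hk => by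
    have : n + 1 ≤ k := by omega
    exact_mod_cast this
  have hhigh2 : ∀ k : ℤ, n + 1 < k → (n : ℝ) + 2 ≤ k := fun k hk => by
    have : n + 2 ≤ k := by omega
    exact_mod_cast this
  have hA := hasSum_sum_of_ne_finset_zero (L := SummationFilter.unconditional ℤ)
    (f := fun k : ℤ => (c' (2 * k) - c k) * hat (2 * (x - k))) (s := {n, n + 1}) fun k hk => by
      rw [Finset.mem_insert, Finset.mem_singleton, not_or] at hk
      have h0 : hat (2 * (x - k)) = 0 := by
        refine hat_eq_zero (le_abs.2 ?_)
        rcases lt_or_gt_of_ne hk.1 with h | h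
        · left; have := hlow k h; linarith
        · right; have := hhigh2 k (by omega); linarith
      rw [h0, mul_zero]
  have hB := hasSum_sum_of_ne_finset_zero (L := SummationFilter.unconditional ℤ)
    (f := fun k : ℤ => (c' (2 * k + 1) - (c k + c (k + 1)) / 2) * hat (2 * (x - k) - 1))
    (s := {n}) fun k hk => by
      rw [Finset.mem_singleton] at hk
      have h0 : hat (2 * (x - k) - 1) = 0 := by
        refine hat_eq_zero (le_abs.2 ?_)
        rcases lt_or_gt_of_ne hk with h | h
        · left; have := hlow k h; linarith
        · right; have := hhigh k h; linarith
      rw [h0, mul_zero]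
  refine ⟨_, _, hA, hB, ?_⟩
  rw [Finset.sum_pair (by omega), Finset.sum_singleton, linearInterp, linearInterp, ← hn, ← hy]
  push_cast
  rw [show x - n = y by linarith, show x - (n + 1) = y - 1 by linarith]
  rcases lt_or_ge y (1 / 2) with h | h
  · have hf : ⌊2 * x⌋ = 2 * n := by
      rw [Int.floor_eq_iff]; push_cast; constructor <;> linarith
    have hfr : Int.fract (2 * x) = 2 * y := by
      rw [Int.fract, hf]; push_cast; linarith
    rw [hf, hfr, hat_of_nonneg (by linarith) (by linarith),
      hat_eq_zero (x := 2 * (y - 1)) (le_abs.2 (Or.inr (by linarith))),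
      hat_of_nonpos (x := 2 * y - 1) (by linarith) (by linarith)]
    ring
  · have hf : ⌊2 * x⌋ = 2 * n + 1 := by
      rw [Int.floor_eq_iff]; push_cast; constructor <;> linarith
    have hfr : Int.fract (2 * x) = 2 * y - 1 := by
      rw [Int.fract, hf]; push_cast; linarith
    rw [hf, hfr, hat_eq_zero (x := 2 * y) (le_abs.2 (Or.inl (by linarith))),
      hat_of_nonpos (x := 2 * (y - 1)) (by linarith) (by linarith),
      hat_of_nonneg (x := 2 * y - 1) (by linarith) (by linarith),
      show 2 * n + 1 + 1 = 2 * (n + 1) by ring]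
    ring

end Hat

/-! ### Quasi-interpolation at dyadic scales -/

section Averages

/-- A function whose translates and dilates are used to average functions: it is continuously
differentiable, compactly supported, has integral one and a vanishing first moment. -/
structure IsAveragingKernel (ρ : ℝ → ℝ) : Prop where
  contDiff : ContDiff ℝ 1 ρ
  hasCompactSupport : HasCompactSupport ρ
  integral_eq_one : ∫ s, ρ s = 1
  integral_mul_eq_zero : ∫ s, s * ρ s = 0

theorem exists_isAveragingKernel : ∃ ρ, IsAveragingKernel ρ := by
  let b : ContDiffBump (0 : ℝ) := ⟨1, 2, one_pos, by norm_num⟩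
  refine ⟨b.normed volume, b.contDiff_normed, b.hasCompactSupport_normed,
    b.integral_normed, ?_⟩
  -- the first moment vanishes by symmetry
  have h := integral_neg_eq_self (fun s : ℝ => s * b.normed volume s) volume
  simp only [b.normed_neg, neg_mul, integral_neg] at h
  linarith

theorem integral_comp_affine {a : ℝ} (ha : 0 < a) (b : ℝ) (h : ℝ → ℝ) :
    ∫ s, h (a * s - b) = a⁻¹ * ∫ s, h s := by
  rw [Measure.integral_comp_mul_left (fun s => h (s - b)) a, integral_sub_right_eq_self h b,
    abs_of_pos (by positivity), smul_eq_mul]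

variable {ρ : ℝ → ℝ}

/-- The mother function of the corrections at the even nodes, that is, of the differences between
the averages at two consecutive scales. (The arguments `2 * s - 0` and `1 * s - 0` have the shape
`a * s - b` of the change of variables.) -/
def evenMother (ρ : ℝ → ℝ) (s : ℝ) : ℝ := 2 * ρ (2 * s - 0) - ρ (1 * s - 0)

/-- The mother function of the corrections at the odd nodes, that is, of the differences between the
average at a midpoint and the mean of the averages at its two neighbours in the coarser scale. -/
def oddMother (ρ : ℝ → ℝ) (s : ℝ) : ℝ :=
  2 * ρ (2 * s - 1) - (ρ (1 * s - 0) + ρ (1 * s - 1)) / 2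

theorem IsAveragingKernel.continuous_comp (hρ : IsAveragingKernel ρ) (a b : ℝ) :
    Continuous fun s => ρ (a * s - b) :=
  hρ.contDiff.continuous.comp (by fun_prop)

theorem IsAveragingKernel.hasCompactSupport_comp (hρ : IsAveragingKernel ρ) {a : ℝ} (ha : 0 < a)
    (b : ℝ) : HasCompactSupport fun s => ρ (a * s - b) := by
  have h := hρ.hasCompactSupport.comp_homeomorph
    ((Homeomorph.mulLeft₀ a ha.ne').trans (Homeomorph.subRight b))
  exact h

theorem IsAveragingKernel.integrable_mul (hρ : IsAveragingKernel ρ) {g : ℝ → ℝ}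
    (hg : Continuous g) {a : ℝ} (ha : 0 < a) (b : ℝ) :
    Integrable fun s => g s * ρ (a * s - b) :=
  (hg.mul (hρ.continuous_comp a b)).integrable_of_hasCompactSupport
    (hρ.hasCompactSupport_comp ha b).mul_left

/-- Integrating against the mother functions amounts to comparing averages at two scales. -/
theorem IsAveragingKernel.integral_mul_evenMother (hρ : IsAveragingKernel ρ) {g : ℝ → ℝ}
    (hg : Continuous g) :
    ∫ s, g s * evenMother ρ s = (∫ r, g (r / 2) * ρ r) - ∫ r, g r * ρ r := by
  have e : ∀ s, g s * evenMother ρ s =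
      2 * (g s * ρ (2 * s - 0)) - g s * ρ (1 * s - 0) := fun s => by rw [evenMother]; ring
  simp_rw [e]
  rw [integral_sub ((hρ.integrable_mul hg two_pos 0).const_mul 2)
    (hρ.integrable_mul hg one_pos 0), integral_const_mul]
  have h := integral_comp_affine two_pos 0 fun r => g (r / 2) * ρ r
  simp only [sub_zero, mul_div_cancel_left₀ _ (two_ne_zero (α := ℝ))] at h
  simp only [sub_zero, one_mul, h]
  ring

theorem IsAveragingKernel.integral_mul_oddMother (hρ : IsAveragingKernel ρ) {g : ℝ → ℝ}
    (hg : Continuous g) :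
    ∫ s, g s * oddMother ρ s =
      (∫ r, g ((r + 1) / 2) * ρ r) - ((∫ r, g r * ρ r) + ∫ r, g (r + 1) * ρ r) / 2 := by
  have e : ∀ s, g s * oddMother ρ s = 2 * (g s * ρ (2 * s - 1)) -
      (g s * ρ (1 * s - 0) + g s * ρ (1 * s - 1)) / 2 := fun s => by rw [oddMother]; ring
  have hi : Integrable fun s => (g s * ρ (1 * s - 0) + g s * ρ (1 * s - 1)) / 2 :=
    ((hρ.integrable_mul hg one_pos 0).add (hρ.integrable_mul hg one_pos 1)).div_const 2
  simp_rw [e]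
  rw [integral_sub ((hρ.integrable_mul hg two_pos 1).const_mul 2) hi,
    integral_const_mul, integral_div, integral_add (hρ.integrable_mul hg one_pos 0)
    (hρ.integrable_mul hg one_pos 1)]
  have h := integral_comp_affine two_pos 1 fun r => g ((r + 1) / 2) * ρ r
  have h' := integral_comp_affine one_pos 1 fun r => g (r + 1) * ρ r
  simp only [sub_add_cancel, mul_div_cancel_left₀ _ (two_ne_zero (α := ℝ))] at h
  simp only [sub_add_cancel, one_mul, inv_one] at h'
  simp only [sub_zero, one_mul, h, h']
  ring

theorem IsAveragingKernel.isMotherFunction_evenMother (hρ : IsAveragingKernel ρ) :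
    IsMotherFunction (evenMother ρ) where
  contDiff := by
    have := hρ.contDiff
    unfold evenMother
    fun_prop
  hasCompactSupport :=
    (hρ.hasCompactSupport_comp two_pos 0).mul_left.sub (hρ.hasCompactSupport_comp one_pos 0)
  integral_eq_zero := by
    have h := hρ.integral_mul_evenMother (g := fun _ => 1) continuous_const
    simpa using h
  integral_mul_eq_zero := by
    have h := hρ.integral_mul_evenMother (g := fun s => s) continuous_id
    rw [h, hρ.integral_mul_eq_zero]
    simp only [div_mul_eq_mul_div, integral_div, hρ.integral_mul_eq_zero]
    ring

theorem IsAveragingKernel.isMotherFunction_oddMother (hρ : IsAveragingKernel ρ) :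
    IsMotherFunction (oddMother ρ) where
  contDiff := by
    have := hρ.contDiff
    unfold oddMother
    fun_prop
  hasCompactSupport := by
    have h := (hρ.hasCompactSupport_comp two_pos 1).mul_left (f := fun _ => (2 : ℝ))
    have h' := ((hρ.hasCompactSupport_comp one_pos 0).add
      (hρ.hasCompactSupport_comp one_pos 1)).mul_left (f := fun _ => (2⁻¹ : ℝ))
    have e : oddMother ρ = (fun _ => (2 : ℝ)) * (fun s => ρ (2 * s - 1)) -
        (fun _ => (2⁻¹ : ℝ)) * ((fun s => ρ (1 * s - 0)) + fun s => ρ (1 * s - 1)) := by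
      ext s
      simp only [oddMother, Pi.sub_apply, Pi.mul_apply, Pi.add_apply]
      ring
    rw [e]
    exact h.sub h'
  integral_eq_zero := by
    have h := hρ.integral_mul_oddMother (g := fun _ => 1) continuous_const
    simp only [one_mul, hρ.integral_eq_one] at h
    rw [h]; norm_num
  integral_mul_eq_zero := by
    have h := hρ.integral_mul_oddMother (g := fun s => s) continuous_id
    have i0 : Integrable fun s => ρ s := by
      simpa using hρ.integrable_mul continuous_const (g := fun _ => 1) one_pos 0
    have i1 : Integrable fun s => s * ρ s := by
      simpa using hρ.integrable_mul continuous_id (g := fun s => s) one_pos 0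
    have h1 : ∫ s, (s + 1) * ρ s = 1 := by
      simp only [add_mul, one_mul]
      rw [integral_add i1 i0, hρ.integral_mul_eq_zero, hρ.integral_eq_one, zero_add]
    rw [h, h1, hρ.integral_mul_eq_zero]
    simp only [div_mul_eq_mul_div, integral_div, h1]
    norm_num

/-- The average of `f` around the dyadic point `2^{-j} k`, at the scale `2^{-j}`. -/
def dyadicAverage (ρ f : ℝ → ℝ) (j k : ℤ) : ℝ := ∫ r, f (((2 : ℝ) ^ j)⁻¹ * (r + k)) * ρ r

/-- The piecewise linear function with nodes at the dyadic points `2^{-j} k` whose values at the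
nodes are the averages of `f`. -/
def dyadicApprox (ρ f : ℝ → ℝ) (j : ℤ) (s : ℝ) : ℝ :=
  linearInterp (dyadicAverage ρ f j) ((2 : ℝ) ^ j * s)

variable {f : ℝ → ℝ}

theorem IsAveragingKernel.dyadicAverage_even (hρ : IsAveragingKernel ρ) (hf : Continuous f)
    (j k : ℤ) :
    ∫ r, f (((2 : ℝ) ^ j)⁻¹ * (r + k)) * evenMother ρ r =
      dyadicAverage ρ f (j + 1) (2 * k) - dyadicAverage ρ f j k := by
  rw [hρ.integral_mul_evenMother (g := fun r => f (((2 : ℝ) ^ j)⁻¹ * (r + k)))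
    (hf.comp (by fun_prop))]
  have ha : (2 : ℝ) ^ j ≠ 0 := by positivity
  simp only [dyadicAverage]
  congr 2
  ext r
  congr 2
  rw [zpow_add_one₀ two_ne_zero]; push_cast; field_simp

theorem IsAveragingKernel.dyadicAverage_odd (hρ : IsAveragingKernel ρ) (hf : Continuous f)
    (j k : ℤ) :
    ∫ r, f (((2 : ℝ) ^ j)⁻¹ * (r + k)) * oddMother ρ r =
      dyadicAverage ρ f (j + 1) (2 * k + 1) -
        (dyadicAverage ρ f j k + dyadicAverage ρ f j (k + 1)) / 2 := by
  rw [hρ.integral_mul_oddMother (g := fun r => f (((2 : ℝ) ^ j)⁻¹ * (r + k)))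
    (hf.comp (by fun_prop))]
  have ha : (2 : ℝ) ^ j ≠ 0 := by positivity
  simp only [dyadicAverage]
  congr 2
  · ext r
    congr 2
    rw [zpow_add_one₀ two_ne_zero]; push_cast; field_simp; ring
  · congr 2
    ext r
    congr 2
    push_cast; ring

/-- Averages along converging arguments converge, by dominated convergence. -/
theorem IsAveragingKernel.tendsto_integral_mul (hρ : IsAveragingKernel ρ) (hf : Continuous f)
    {K : ℝ} (hK : ∀ s, |f s| ≤ K) {m : ℕ → ℝ → ℝ} (hm : ∀ n, Continuous (m n)) {l : ℝ}
    (hlim : ∀ᵐ r, Tendsto (fun n => f (m n r)) atTop (𝓝 l)) :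
    Tendsto (fun n => ∫ r, f (m n r) * ρ r) atTop (𝓝 l) := by
  have i0 : Integrable fun s => ρ s := by
    simpa using hρ.integrable_mul continuous_const (g := fun _ => 1) one_pos 0
  have h := tendsto_integral_of_dominated_convergence (F := fun n r => f (m n r) * ρ r)
    (f := fun r => l * ρ r) (fun r => K * |ρ r|)
    (fun n => ((hf.comp (hm n)).mul hρ.contDiff.continuous).aestronglyMeasurable)
    (i0.abs.const_mul K)
    (fun n => Eventually.of_forall fun r => by
      rw [norm_mul, Real.norm_eq_abs, Real.norm_eq_abs]
      exact mul_le_mul_of_nonneg_right (hK _) (abs_nonneg _))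
    (by filter_upwards [hlim] with r hr using hr.mul_const _)
  rwa [integral_const_mul, hρ.integral_eq_one, mul_one] at h

theorem abs_linearInterp_sub_le (c : ℤ → ℝ) (x l : ℝ) :
    |linearInterp c x - l| ≤ |c ⌊x⌋ - l| + |c (⌊x⌋ + 1) - l| := by
  have h0 := Int.fract_nonneg x
  have h1 := (Int.fract_lt_one x).le
  have e : linearInterp c x - l =
      (1 - Int.fract x) * (c ⌊x⌋ - l) + Int.fract x * (c (⌊x⌋ + 1) - l) := by
    rw [linearInterp]; ring
  rw [e]
  refine (abs_add_le _ _).trans (add_le_add ?_ ?_)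
  · rw [abs_mul, abs_of_nonneg (by linarith)]
    exact mul_le_of_le_one_left (abs_nonneg _) (by linarith)
  · rw [abs_mul, abs_of_nonneg h0]
    exact mul_le_of_le_one_left (abs_nonneg _) h1

/-- At fine scales, the approximations converge to the function. -/
theorem IsAveragingKernel.tendsto_dyadicApprox (hρ : IsAveragingKernel ρ) (hf : Continuous f)
    {K : ℝ} (hK : ∀ s, |f s| ≤ K) (s : ℝ) :
    Tendsto (fun n : ℕ => dyadicApprox ρ f n s) atTop (𝓝 (f s)) := by
  have h2 : Tendsto (fun n : ℕ => ((2 : ℝ) ^ (n : ℤ))⁻¹) atTop (𝓝 0) := by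
    simp only [zpow_natCast]
    exact tendsto_inv_atTop_zero.comp (tendsto_pow_atTop_atTop_of_one_lt one_lt_two)
  have key : ∀ i : ℤ, Tendsto (fun n : ℕ =>
      dyadicAverage ρ f n (⌊(2 : ℝ) ^ (n : ℤ) * s⌋ + i)) atTop (𝓝 (f s)) := by
    intro i
    refine hρ.tendsto_integral_mul hf hK (fun n => by fun_prop) (Eventually.of_forall fun r => ?_)
    refine (hf.tendsto s).comp ?_
    rw [tendsto_iff_norm_sub_tendsto_zero]
    refine squeeze_zero (fun _ => norm_nonneg _) (fun n => ?_)
      (by simpa using h2.mul_const (|r + i| + 1))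
    have ha : (0 : ℝ) < 2 ^ (n : ℤ) := by positivity
    have e : ((2 : ℝ) ^ (n : ℤ))⁻¹ * (r + ((⌊(2 : ℝ) ^ (n : ℤ) * s⌋ + i : ℤ) : ℝ)) - s =
        ((2 : ℝ) ^ (n : ℤ))⁻¹ * (r + i - Int.fract ((2 : ℝ) ^ (n : ℤ) * s)) := by
      rw [Int.fract]; push_cast; field_simp; ring
    rw [e, Real.norm_eq_abs, abs_mul, abs_of_pos (inv_pos.2 ha)]
    refine mul_le_mul_of_nonneg_left ((abs_sub _ _).trans ?_) (inv_pos.2 ha).le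
    rw [abs_of_nonneg (Int.fract_nonneg ((2 : ℝ) ^ (n : ℤ) * s))]
    linarith [Int.fract_lt_one ((2 : ℝ) ^ (n : ℤ) * s)]
  have k0 := (tendsto_iff_norm_sub_tendsto_zero.1 (key 0)).add
    (tendsto_iff_norm_sub_tendsto_zero.1 (key 1))
  rw [add_zero] at k0
  rw [tendsto_iff_norm_sub_tendsto_zero]
  refine squeeze_zero (fun _ => norm_nonneg _) (fun n => ?_) k0
  simpa only [add_zero, Real.norm_eq_abs, dyadicApprox] using
    abs_linearInterp_sub_le (dyadicAverage ρ f n) ((2 : ℝ) ^ (n : ℤ) * s) (f s)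

/-- At coarse scales, the approximations of a function which vanishes at infinity tend to zero. -/
theorem IsAveragingKernel.tendsto_dyadicApprox_neg (hρ : IsAveragingKernel ρ) (hf : Continuous f)
    {K : ℝ} (hK : ∀ s, |f s| ≤ K) (h0 : Tendsto f (cocompact ℝ) (𝓝 0)) (s : ℝ) :
    Tendsto (fun n : ℕ => dyadicApprox ρ f (-(n : ℤ)) s) atTop (𝓝 0) := by
  have h2 : Tendsto (fun n : ℕ => (2 : ℝ) ^ n) atTop atTop :=
    tendsto_pow_atTop_atTop_of_one_lt one_lt_two
  have key : ∀ i : ℤ, Tendsto (fun n : ℕ => dyadicAverage ρ f (-(n : ℤ)) i) atTop (𝓝 0) := by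
    intro i
    refine hρ.tendsto_integral_mul hf hK (fun n => by fun_prop) ?_
    -- the arguments tend to infinity, except at the single point `r = -i`
    filter_upwards [compl_mem_ae_iff.2 (measure_singleton (-(i : ℝ)))] with r hr
    have hr' : 0 < |r + i| := abs_pos.2 fun h => hr (by rw [mem_singleton_iff]; linarith)
    refine h0.comp ?_
    rw [← Metric.cobounded_eq_cocompact, ← tendsto_norm_atTop_iff_cobounded]
    have e : ∀ n : ℕ, ‖((2 : ℝ) ^ (-(n : ℤ)))⁻¹ * (r + i)‖ = 2 ^ n * |r + i| := by
      intro n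
      rw [zpow_neg, inv_inv, zpow_natCast, norm_mul, Real.norm_eq_abs, Real.norm_eq_abs,
        abs_of_pos (by positivity)]
    simp_rw [e]
    exact h2.atTop_mul_const hr'
  -- the integer part of `2 ^ (-n) * s` is eventually `0` or `-1`
  have k := (((tendsto_iff_norm_sub_tendsto_zero.1 (key (-1))).add
    (tendsto_iff_norm_sub_tendsto_zero.1 (key 0))).add
    (tendsto_iff_norm_sub_tendsto_zero.1 (key 1)))
  simp only [add_zero, sub_zero] at k
  rw [tendsto_zero_iff_norm_tendsto_zero]
  refine squeeze_zero' (Eventually.of_forall fun _ => norm_nonneg _) ?_ k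
  filter_upwards [h2.eventually_gt_atTop |s|] with n hn
  have hx : |(2 : ℝ) ^ (-(n : ℤ)) * s| < 1 := by
    rw [zpow_neg, zpow_natCast, abs_mul, abs_of_pos (by positivity), ← div_eq_inv_mul,
      div_lt_one (by positivity)]
    exact hn
  have h := abs_linearInterp_sub_le (dyadicAverage ρ f (-(n : ℤ))) ((2 : ℝ) ^ (-(n : ℤ)) * s) 0
  simp only [sub_zero] at h
  refine h.trans ?_
  simp only [Real.norm_eq_abs]
  obtain ⟨hx1, hx2⟩ := abs_lt.1 hx
  have a1 := abs_nonneg (dyadicAverage ρ f (-(n : ℤ)) (-1))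
  have a2 := abs_nonneg (dyadicAverage ρ f (-(n : ℤ)) 1)
  rcases lt_or_ge ((2 : ℝ) ^ (-(n : ℤ)) * s) 0 with hs | hs
  · have : ⌊(2 : ℝ) ^ (-(n : ℤ)) * s⌋ = -1 := by
      rw [Int.floor_eq_iff]; push_cast; constructor <;> linarith
    rw [this, show (-1 : ℤ) + 1 = 0 by norm_num]
    linarith
  · have : ⌊(2 : ℝ) ^ (-(n : ℤ)) * s⌋ = 0 := by
      rw [Int.floor_eq_iff]; push_cast; constructor <;> linarith
    rw [this, show (0 : ℤ) + 1 = 1 by norm_num]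
    linarith

/-- A summable telescoping series over `ℤ`. -/
theorem HasSum.eq_of_telescoping {a : ℤ → ℝ} {S l : ℝ}
    (h : HasSum (fun j => a (j + 1) - a j) S)
    (h1 : Tendsto (fun n : ℕ => a n) atTop (𝓝 l))
    (h2 : Tendsto (fun n : ℕ => a (-(n : ℤ))) atTop (𝓝 0)) : S = l := by
  have h3 := h.nat_add_neg_add_one.tendsto_sum_nat
  have e : ∀ N : ℕ, ∑ n ∈ Finset.range N, ((a ((n : ℤ) + 1) - a n) +
      (a (-((n : ℤ) + 1) + 1) - a (-((n : ℤ) + 1)))) = a N - a (-(N : ℤ)) := by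
    intro N
    induction N with
    | zero => simp
    | succ N ih =>
      rw [Finset.sum_range_succ, ih]
      push_cast
      rw [show -((N : ℤ) + 1) + 1 = -N by ring]
      ring
  simp_rw [e] at h3
  have h4 := h1.sub h2
  rw [sub_zero] at h4
  exact tendsto_nhds_unique h3 h4

end Averages

/-! ### A continuous version without orthonormal wavelets -/

section QuasiInterpolation

variable {α u v : ℝ} {ρ : ℝ → ℝ}

theorem exists_abs_fracKernel_le (u : ℝ) {κ : ℝ} (hκ : 0 < κ) (hκ1 : κ < 1) :
    ∃ K : ℝ, ∀ s, |fracKernel u κ s| ≤ K := by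
  obtain ⟨C, hC, h⟩ := exists_fracKernel_bound u hκ hκ1
  refine ⟨C, fun s => (h s).trans (mul_le_of_le_one_right hC ?_)⟩
  exact Real.rpow_le_one_of_one_le_of_nonpos (by linarith [abs_nonneg s]) (by linarith)

theorem tendsto_fracKernel_cocompact (u : ℝ) {κ : ℝ} (hκ : 0 < κ) (hκ1 : κ < 1) :
    Tendsto (fracKernel u κ) (cocompact ℝ) (𝓝 0) := by
  obtain ⟨C, hC, h⟩ := exists_fracKernel_bound u hκ hκ1
  have h1 : Tendsto (fun s : ℝ => 1 + |s|) (cocompact ℝ) atTop :=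
    tendsto_atTop_add_const_left _ _ tendsto_norm_cocompact_atTop
  have h2 := ((tendsto_rpow_neg_atTop (y := 1 - κ) (by linarith)).comp h1).const_mul C
  rw [mul_zero] at h2
  refine squeeze_zero_norm (fun s => ?_) h2
  rw [Real.norm_eq_abs]
  simpa using h s

/-- The kernel is the sum of the two series of hat functions given by the corrections between
consecutive scales: for almost every `s` the double series converge absolutely, and then they may
be summed first over the nodes of a given scale, where they are finite, and then over the scales,
where they telescope. -/
theorem IsAveragingKernel.ae_add_eq_fracKernel (hρ : IsAveragingKernel ρ) (hα : 1 < α)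
    (hv : v ∈ Ioo (1 / α) 1) (u : ℝ) {g₀ g₁ : ℝ → ℝ}
    (hg₀ : MemLp g₀ (ENNReal.ofReal α) volume) (hg₁ : MemLp g₁ (ENNReal.ofReal α) volume)
    (h₀ : LpHasSum (ENNReal.ofReal α) (fun p s => waveletCoeff α (evenMother ρ) u v p *
      waveletAtom α (fun x => hat (2 * x)) p s) g₀)
    (h₁ : LpHasSum (ENNReal.ofReal α) (fun p s => waveletCoeff α (oddMother ρ) u v p *
      waveletAtom α (fun x => hat (2 * x - 1)) p s) g₁)
    (he₀ : MemLp (fun x => hat (2 * x)) (ENNReal.ofReal α) volume)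
    (he₁ : MemLp (fun x => hat (2 * x - 1)) (ENNReal.ofReal α) volume) :
    (fun s => g₀ s + g₁ s) =ᵐ[volume] fracKernel u (v - 1 / α) := by
  have hα0 : 0 < α := by linarith
  have hα1 : 0 < 1 / α := by positivity
  have hκ : 0 < v - 1 / α := by linarith [hv.1]
  have hκ1 : v - 1 / α < 1 := by linarith [hv.2]
  have hp1 : 1 ≤ ENNReal.ofReal α := by simpa using hα.le
  have hp0 : ENNReal.ofReal α ≠ 0 := by simpa using hα0
  have hm₀ := hρ.isMotherFunction_evenMother
  have hm₁ := hρ.isMotherFunction_oddMother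
  have hf := continuous_fracKernel u hκ
  obtain ⟨K, hK⟩ := exists_abs_fracKernel_le u hκ hκ1
  have hF₀ := memLp_waveletCoeff_mul_waveletAtom (α := α) (θ := evenMother ρ) he₀ u v
  have hF₁ := memLp_waveletCoeff_mul_waveletAtom (α := α) (θ := oddMother ρ) he₁ u v
  have s₀ := ae_summable_abs_of_summable_eLpNorm hp1 hF₀
    (summable_eLpNorm_waveletCoeff_mul_waveletAtom hm₀ hα0 hv u)
  have s₁ := ae_summable_abs_of_summable_eLpNorm hp1 hF₁
    (summable_eLpNorm_waveletCoeff_mul_waveletAtom hm₁ hα0 hv u)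
  have e₀ := h₀.ae_eq_of_hasSum hp0 hF₀ hg₀ (s₀.mono fun x hx => hx.of_abs.hasSum)
  have e₁ := h₁.ae_eq_of_hasSum hp0 hF₁ hg₁ (s₁.mono fun x hx => hx.of_abs.hasSum)
  filter_upwards [s₀, s₁, e₀, e₁] with x hs₀ hs₁ he₀ he₁
  rw [he₀, he₁]
  choose A B hA hB hAB using fun j : ℤ => hasSum_linearInterp_sub
    (dyadicAverage ρ (fracKernel u (v - 1 / α)) j)
    (dyadicAverage ρ (fracKernel u (v - 1 / α)) (j + 1)) ((2 : ℝ) ^ j * x)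
  have hA' := hs₀.of_abs.hasSum.prod_fiberwise (g := A) fun j => by
    simp only [waveletCoeff_mul_waveletAtom hm₀.contDiff.continuous hm₀.hasCompactSupport u hv.1,
      hρ.dyadicAverage_even hf]
    exact hA j
  have hB' := hs₁.of_abs.hasSum.prod_fiberwise (g := B) fun j => by
    simp only [waveletCoeff_mul_waveletAtom hm₁.contDiff.continuous hm₁.hasCompactSupport u hv.1,
      hρ.dyadicAverage_odd hf]
    exact hB j
  have hsum := hA'.add hB'
  simp only [hAB] at hsum
  refine HasSum.eq_of_telescoping (a := fun j => dyadicApprox ρ (fracKernel u (v - 1 / α)) j x)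
    ?_ (hρ.tendsto_dyadicApprox hf hK x)
    (hρ.tendsto_dyadicApprox_neg hf hK (tendsto_fracKernel_cocompact u hκ hκ1) x)
  refine hsum.congr_fun fun j => ?_
  rw [dyadicApprox, dyadicApprox, zpow_add_one₀ two_ne_zero, mul_comm ((2 : ℝ) ^ j) 2, mul_assoc]

theorem memLp_hat_comp (b : ℝ) (p : ENNReal) : MemLp (fun x => hat (2 * x - b)) p volume := by
  have h := memLp_comp_affine (continuous_hat.memLp_of_hasCompactSupport hasCompactSupport_hat
    (p := p) (μ := volume)) two_ne_zero b 1
  simpa using h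

variable {Ω : Type*} [MeasurableSpace Ω] {μ : Measure Ω} {β : ℝ → ℝ} {Z : Set ℝ → Ω → ℝ}

/-- Every stable random measure carries a linear multifractional stable motion which is measurable
at each time and has continuous paths outside a null set. -/
theorem exists_isLMSM_continuous [IsProbabilityMeasure μ] (hZ : IsStableRandomMeasure μ α β Z)
    (hα : α ∈ Ioo (1 : ℝ) 2) (hβ : ∀ s, β s ∈ Icc (-1 : ℝ) 1) {H : ℝ → ℝ} (hH : Continuous H)
    (hHr : ∀ t, H t ∈ Ioo (1 / α) 1) :
    ∃ Y : ℝ → Ω → ℝ, IsLMSM μ α Z H Y ∧ ∀ᵐ ω ∂μ, Continuous fun t => Y t ω := by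
  have hα0 : 0 < α := by linarith [hα.1]
  obtain ⟨ρ, hρ⟩ := exists_isAveragingKernel
  have hm₀ := hρ.isMotherFunction_evenMother
  have hm₁ := hρ.isMotherFunction_oddMother
  have he₀ : MemLp (fun x => hat (2 * x)) (ENNReal.ofReal α) volume := by
    simpa using memLp_hat_comp 0 (ENNReal.ofReal α)
  have he₁ := memLp_hat_comp 1 (ENNReal.ofReal α)
  obtain ⟨ε₀, hε₀⟩ := exists_isWaveletCoeff hZ hα.1.le hβ he₀
  obtain ⟨ε₁, hε₁⟩ := exists_isWaveletCoeff hZ hα.1.le hβ he₁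
  obtain ⟨Ω₀, hΩ₀⟩ := hε₀.exists_isGoodEvent hZ hα.1.le hβ
  obtain ⟨Ω₁, hΩ₁⟩ := hε₁.exists_isGoodEvent hZ hα.1.le hβ
  refine ⟨fun t ω => 1 * waveletLMSM α (evenMother ρ) ε₀ Ω₀ H t ω +
    1 * waveletLMSM α (oddMother ρ) ε₁ Ω₁ H t ω, fun t => ?_, ?_⟩
  · obtain ⟨g₀, hg₀, h₀⟩ := exists_lpHasSum_wavelet hm₀ hα.1.le he₀ (hHr t) t
    obtain ⟨g₁, hg₁, h₁⟩ := exists_lpHasSum_wavelet hm₁ hα.1.le he₁ (hHr t) t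
    have i₀ := isStableIntegral_waveletField hZ hα.1.le hβ hm₀ hε₀ hΩ₀ (hHr t) hg₀ h₀
    have i₁ := isStableIntegral_waveletField hZ hα.1.le hβ hm₁ hε₁ hΩ₁ (hHr t) hg₁ h₁
    have i := i₀.linear hZ hα.1.le i₁ 1 1
    refine i.congr ?_ (ae_eq_refl _) i.2.1
    simp only [one_mul]
    exact hρ.ae_add_eq_fracKernel hα.1 (hHr t) t hg₀ hg₁ h₀ h₁ he₀ he₁
  · filter_upwards [ae_mem_of_isGoodEvent hΩ₀, ae_mem_of_isGoodEvent hΩ₁] with ω hω₀ hω₁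
    have c₀ := continuous_waveletLMSM hm₀ hα0 one_pos hω₀ (hΩ₀.hasGrowth hω₀ (half_pos one_pos))
      hH hHr
    have c₁ := continuous_waveletLMSM hm₁ hα0 one_pos hω₁ (hΩ₁.hasGrowth hω₁ (half_pos one_pos))
      hH hHr
    exact (c₀.const_mul 1).add (c₁.const_mul 1)

end QuasiInterpolation

end

theorem theorem5p1 {Ω : Type*} [MeasurableSpace Ω] (μ : Measure Ω) [IsProbabilityMeasure μ]
    (α : ℝ) (hα : α ∈ Ioo (1 : ℝ) 2)
    (β : ℝ → ℝ) (hβ : Measurable β) (hβ_range : ∀ s, β s ∈ Icc (-1 : ℝ) 1)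
    (Z : Set ℝ → Ω → ℝ) (hZ : IsStableRandomMeasure μ α β Z) :
    (∀ ψ : ℝ → ℝ, IsSmoothMotherWavelet ψ →
      (∃ ε : ℤ → ℤ → Ω → ℝ, IsWaveletCoeff μ α Z ψ ε) ∧
      ∀ ε : ℤ → ℤ → Ω → ℝ, IsWaveletCoeff μ α Z ψ ε →
        (∃ Ω₀ : Set Ω, IsGoodEvent μ α ε Ω₀) ∧
        ∀ Ω₀ : Set Ω, IsGoodEvent μ α ε Ω₀ →
          (∀ ω ∈ Ω₀, ∀ u : ℝ, ∀ v ∈ Ioo (1 / α) 1,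
            Summable fun p : ℤ × ℤ => |waveletTerm α ψ ε u v ω p|) ∧
          ∀ H : ℝ → ℝ, Continuous H → (∀ t, H t ∈ Ioo (1 / α) 1) →
            (∀ ω ∈ Ω₀, ∀ M : ℝ, 0 < M → ∀ η : ℝ, 0 < η →
              ∃ C : ℝ, ∀ t ∈ Icc (-M) M, ∀ s ∈ Icc (-M) M,
                |waveletLMSM α ψ ε Ω₀ H t ω - waveletLMSM α ψ ε Ω₀ H s ω| ≤
                  C * (|t - s| ^ (max (H t) (H s) - 1 / α) *
                    (1 + |Real.log (|t - s|)|) ^ (2 / α + η) + |H t - H s|)) ∧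
            (∀ ω ∈ Ω₀, Continuous fun t => waveletLMSM α ψ ε Ω₀ H t ω) ∧
            IsLMSM μ α Z H (waveletLMSM α ψ ε Ω₀ H) ∧
            ∀ Y : ℝ → Ω → ℝ, IsLMSM μ α Z H Y →
              ∀ t, waveletLMSM α ψ ε Ω₀ H t =ᵐ[μ] Y t) ∧
    (∀ H : ℝ → ℝ, Continuous H → (∀ t, H t ∈ Ioo (1 / α) 1) →
      (∃ Y : ℝ → Ω → ℝ, IsLMSM μ α Z H Y) ∧
      ∀ Y : ℝ → Ω → ℝ, IsLMSM μ α Z H Y →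
        ∃ Y' : ℝ → Ω → ℝ, (∀ t, Measurable (Y' t)) ∧ (∀ t, Y' t =ᵐ[μ] Y t) ∧
          ∀ᵐ ω ∂μ, Continuous fun t => Y' t ω) := by
  have hα0 : 0 < α := by linarith [hα.1]
  refine ⟨fun ψ hψ => ?_, fun H hH hHr => ?_⟩
  · have hm := hψ.isMotherFunction
    refine ⟨exists_isWaveletCoeff hZ hα.1.le hβ_range (hm.memLp _), fun ε hε =>
      ⟨hε.exists_isGoodEvent hZ hα.1.le hβ_range, fun Ω₀ hΩ => ⟨fun ω hω u v hv =>
        summable_abs_waveletTerm hm hα0 one_pos (hΩ.hasGrowth hω one_pos) hv u,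
        fun H hH hHr => ?_⟩⟩⟩
    have hY : IsLMSM μ α Z H (waveletLMSM α ψ ε Ω₀ H) := fun t =>
      isStableIntegral_waveletField hZ hα.1.le hβ_range hm hε hΩ (hHr t)
        (memLp_fracKernel_of_mem_Ioo hα (hHr t) t) (hψ.lpHasSum_fracKernel_stable hα (hHr t) t)
    refine ⟨fun ω hω M hM η hη => ?_, fun ω hω => ?_, hY, fun Y hY' t =>
      (hY t).ae_eq hZ hα.1.le hβ_range (hY' t)⟩
    · obtain ⟨C, -, hC⟩ := exists_bound_waveletLMSM hm hα0 hη hω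
        (hΩ.hasGrowth hω (half_pos hη)) hH hHr hM
      exact ⟨C, hC⟩
    · exact continuous_waveletLMSM hm hα0 one_pos hω (hΩ.hasGrowth hω (half_pos one_pos)) hH hHr
  · obtain ⟨Y', hY', hc⟩ := exists_isLMSM_continuous hZ hα hβ_range hH hHr
    exact ⟨⟨Y', hY'⟩, fun Y hY => ⟨Y', fun t => (hY' t).2.1, fun t =>
      (hY' t).ae_eq hZ hα.1.le hβ_range (hY t), hc⟩⟩
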